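/- **Setting.** Let $F\subset\{0,1\}^{\mathbb N}$ be a closed set containing sequences with both first letters, and let $T_F$ be the subtree of the rooted binary tree formed by the rays from the root $\mathring v$ to the points of $F$ (so $T_F$ has no dead ends, $\deg\mathring v=2$, and $F$ is its space of ends). One side of $\mathring v$ is called positive, the other one negative. Let $V_F$ be its set of vertices and let $\nu:V_F\to\{0,1\}$ be any coloring. *Tiles.* $L^0$ (resp. $L^1$, $H^0$, $H^1$) is a closed disk (resp. closed annulus, torus minus an open disk, torus minus two open disks with disjoint closures) from which a Cantor subset of each boundary circle has been removed. The boundary components of $L^1$ and $H^1$ are called outer or inner according to the boundary circle in which they lie. If $v=\mathring v$ or $\deg v=3$, let $L_v$ be a copy of $L^1$ when $\nu(v)=0$ and of $H^1$ when $\nu(v)=1$; for the other vertices (of degree $2$), let $L_v$ be a copy of $L^0$ when $\nu(v)=0$ and of $H^0$ when $\nu(v)=1$. *The surface.* For each edge of $T_F$ choose a boundary component of each of the tiles of its two endpoints and a homeomorphism between these two components (in the oriented construction it preserves orientations; this is not needed here), such that: distinct edges at a vertex $v$ use distinct boundary components of $L_v$; the edges from a vertex of degree $3$ other than $\mathring v$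 to its two children do not use two outer or two inner components; at $\mathring v$ the edge of the positive side uses an outer component and the edge of the negative side an inner one. Let $W=W_F^\nu$ be the surface with boundary obtained from $\bigsqcup_{v\in V_F}L_v$ by gluing along all these homeomorphisms; its boundary consists of the boundary components of the tiles that are not glued. *Ends.* Let $\mathcal E(W)$ be the space of ends of $W$, $\mathcal B(W)\subset\mathcal E(W)$ the set of the ends defined by the noncompact components of $\partial W$, and $\asymp$ the equivalence relation on $\mathcal E(W)$ generated by identifying the two ends of each noncompact boundary component. Each $\mathbf e\in F$, with ray $\mathring v=v_0,v_1,v_2,\dots$ in $T_F$, is identified with the end of $W$ all of whose neighborhoods contain the tiles $L_{v_n}$ for all large $n$. For $n>0$ let $\xi^{\mathbf e}_n=-1$ if $L_{v_n}$ is of type $L^1$ or $H^1$ and the components of $\partial L_{v_n}$ used by the edges $v_{n-1}v_n$ and $v_nv_{n+1}$ are not both outer nor both inner, and $\xi^{\mathbf e}_n=1$ otherwise. The end $\mathbf e$ is topologically accessible if $\xi^{\mathbf e}_n=1$ for all large $n$. For $v$ such that $L_v$ is of type $L^1$ or $H^1$, let $\tau_v$ denote any loop in the interior of $L_v$ whose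 complement in $L_v$ has two connected components, one containing all the outer boundary components and the other one all the inner ones. For $\mathbf e\in F$ let $\mathcal B(W,\mathbf e)$ be the set of those $\mathbf b\in\mathcal B(W)$ that are not separated from $\mathbf e$ by any loop $\tau_v$, i.e. that lie in the same component of $W\setminus\tau_v$ as $\mathbf e$. **Lemma.** Each $\mathbf e\in F$ does define an end of $W$ as above, distinct points of $F$ define distinct ends, and: 1. for $\mathbf e\in F$, $\mathcal B(W,\mathbf e)\neq\emptyset$ if and only if $\mathbf e$ is topologically accessible; 2. the sets $\mathcal B(W,\mathbf e)$, $\mathbf e\in F$, are pairwise disjoint and their union is $\mathcal B(W)$ (so the nonempty ones form a partition of $\mathcal B(W)$); 3. if $\mathcal B(W,\mathbf e)\neq\emptyset$, then its closure $\overline{\mathcal B(W,\mathbf e)}$ in $\mathcal E(W)$ is a Cantor set, $\overline{\mathcal B(W,\mathbf e)}\cap F=\{\mathbf e\}$, and the quotient space $\overline{\mathcal B(W,\mathbf e)}/{\asymp}$ is homeomorphic to the circle. -/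

import Mathlib

open Set Filter Topology TopologicalSpace

/-! ### Ends of a topological space -/

/-- An end of `X` (Freudenthal): a choice, for every compact `K`, of a connected component of
`X \ K`, compatible with inclusions of compact sets. -/
@[ext] structure Ends (X : Type) [TopologicalSpace X] where
  comp : Compacts X → Set X
  isComp : ∀ K : Compacts X, ∃ x ∈ (K : Set X)ᶜ, comp K = connectedComponentIn (K : Set X)ᶜ x
  anti : ∀ K L : Compacts X, K ≤ L → comp L ⊆ comp K

/-- The inverse limit topology: for `K` compact and `C` a component of `X \ K`, the set of ends
lying in `C` is (sub)basic open. -/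
instance Ends.instTopologicalSpace (X : Type) [TopologicalSpace X] : TopologicalSpace (Ends X) :=
  generateFrom {s | ∃ (K : Compacts X) (C : Set X), s = {e | e.comp K = C}}

/-- `g` converges to the end `e` along the filter `l`. -/
def ConvergesToEnd {X α : Type} [TopologicalSpace X] (g : α → X) (l : Filter α) (e : Ends X) :
    Prop :=
  ∀ K : Compacts X, ∀ᶠ t in l, g t ∈ e.comp K

/-- `B` is a noncompact connected component of `bd` (to be used with `bd` the boundary of a
surface; such a `B` is a line). -/
def IsNoncompactComponent {X : Type} [TopologicalSpace X] (bd B : Set X) : Prop :=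
  (∃ x ∈ bd, B = connectedComponentIn bd x) ∧ ¬ IsCompact B

/-- The ends defined by the noncompact boundary components. Every parametrized line can be
reversed, so both ends of each component are included. -/
def boundaryEnds {X : Type} [TopologicalSpace X] (bd : Set X) : Set (Ends X) :=
  {e | ∃ B : Set X, IsNoncompactComponent bd B ∧
    ∃ l : ℝ ≃ₜ B, ConvergesToEnd (fun t => (l t : X)) atTop e}

/-- Two ends are connected by a noncompact boundary component. -/
def JoinedByBoundary {X : Type} [TopologicalSpace X] (bd : Set X) (e e' : Ends X) : Prop :=
  ∃ B : Set X, IsNoncompactComponent bd B ∧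
    ∃ l : ℝ ≃ₜ B, ConvergesToEnd (fun t => (l t : X)) atBot e ∧
      ConvergesToEnd (fun t => (l t : X)) atTop e'

/-- The equivalence relation `≍` on the space of ends, generated by the identification of pairs
of ends connected by a noncompact boundary component. -/
def asympRel {X : Type} [TopologicalSpace X] (bd : Set X) : Ends X → Ends X → Prop :=
  Relation.EqvGen (JoinedByBoundary bd)

/-- A (sub)set is a Cantor set: it is homeomorphic to `{0,1}^ℕ`. -/
def IsCantorSet {X : Type} [TopologicalSpace X] (S : Set X) : Prop :=
  Nonempty (S ≃ₜ (ℕ → Bool))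

/-! ### Noncompact tiles -/

/-- The flat torus `(ℝ/ℤ)²`. -/
abbrev Torus : Type := UnitAddCircle × UnitAddCircle

/-- The square of the distance of `p` and `c` for the flat (Euclidean) metric of the torus. -/
noncomputable def sqDist (p c : Torus) : ℝ := ‖p.1 - c.1‖ ^ 2 + ‖p.2 - c.2‖ ^ 2

/-- The point `(1/2, 1/2)` of the torus. -/
noncomputable def farPoint : Torus := (((1 / 2 : ℝ) : UnitAddCircle), ((1 / 2 : ℝ) : UnitAddCircle))

inductive TileKind where
  | L0 | L1 | H0 | H1

inductive Side where
  | outer | inner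

/-- The compact oriented surface underlying a tile, realized in the torus: a closed disk for `L⁰`
(the radius is less than `1/2`, so that it is isometric to a plane disk), a closed annulus for
`L¹`, a torus minus one open disk for `H⁰`, a torus minus two open disks (with disjoint closures)
for `H¹`; thus `Hⁱ` is the connected sum of `Lⁱ` with a torus. -/
def TileKind.body : TileKind → Set Torus
  | .L0 => {p | sqDist p 0 ≤ (1 / 4) ^ 2}
  | .L1 => {p | (1 / 8) ^ 2 ≤ sqDist p 0 ∧ sqDist p 0 ≤ (1 / 4) ^ 2}
  | .H0 => {p | (1 / 4) ^ 2 ≤ sqDist p 0}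
  | .H1 => {p | (1 / 4) ^ 2 ≤ sqDist p 0 ∧ (1 / 4) ^ 2 ≤ sqDist p farPoint}

/-- The boundary circles of the compact surface: the outer and the inner circle for `L¹` and `H¹`;
for `L⁰` and `H⁰` there is only one circle (and both values give it). -/
def TileKind.circle : TileKind → Side → Set Torus
  | .L0, _ => {p | sqDist p 0 = (1 / 4) ^ 2}
  | .L1, .outer => {p | sqDist p 0 = (1 / 4) ^ 2}
  | .L1, .inner => {p | sqDist p 0 = (1 / 8) ^ 2}
  | .H0, _ => {p | sqDist p 0 = (1 / 4) ^ 2}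
  | .H1, .outer => {p | sqDist p 0 = (1 / 4) ^ 2}
  | .H1, .inner => {p | sqDist p farPoint = (1 / 4) ^ 2}

/-- The boundary of the compact surface. -/
def TileKind.rim (k : TileKind) : Set Torus := k.circle .outer ∪ k.circle .inner

/-- The kinds `L¹` and `H¹`, having outer and inner boundary components. -/
def TileKind.TwoSided : TileKind → Prop
  | .L1 | .H1 => True
  | .L0 | .H0 => False

/-- `A` is a boundary component of the tile obtained from the compact surface of kind `k` by
removing the subset `K` of its rim. -/
def TileKind.IsBoundaryComponent (k : TileKind) (K A : Set Torus) : Prop :=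
  ∃ x ∈ k.rim \ K, A = connectedComponentIn (k.rim \ K) x

/-- The subsets `A`, `B` of the rim are simultaneously outer or simultaneously inner. -/
def TileKind.SameSide (k : TileKind) (A B : Set Torus) : Prop :=
  ∃ s, A ⊆ k.circle s ∧ B ⊆ k.circle s

/-! ### The tree `T_F`

Vertices of the binary tree are finite words, written with the last letter first: the children of
`v` are `b :: v` and the root is `[]`. Infinite words `ℕ → Bool` are the ends of the binary tree.
The positive side of the root is that of the words whose first letter is `true`. -/

/-- The `n`-th vertex of the ray from the root to the end `f` of the binary tree. -/
def rayVertex (f : ℕ → Bool) : ℕ → List Bool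
  | 0 => []
  | n + 1 => f n :: rayVertex f n

/-- `T_F` is the union of the rays from the root to the points of `F`. -/
def treeVertices (F : Set (ℕ → Bool)) : Set (List Bool) :=
  {v | ∃ f ∈ F, ∃ n, rayVertex f n = v}

abbrev Vertex (F : Set (ℕ → Bool)) : Type := {v : List Bool // v ∈ treeVertices F}

/-- The edges of `T_F`, joining a vertex to one of its children. -/
structure Edge (F : Set (ℕ → Bool)) where
  base : List Bool
  dir : Bool
  mem : dir :: base ∈ treeVertices F

theorem mem_treeVertices_of_cons {F : Set (ℕ → Bool)} {b : Bool} {v : List Bool}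
    (h : b :: v ∈ treeVertices F) : v ∈ treeVertices F := by
  obtain ⟨f, hf, n, hn⟩ := h
  cases n with
  | zero => simp [rayVertex] at hn
  | succ n => exact ⟨f, hf, n, (List.cons.inj hn).2⟩

def Edge.parent {F : Set (ℕ → Bool)} (e : Edge F) : Vertex F :=
  ⟨e.base, mem_treeVertices_of_cons e.mem⟩

def Edge.child {F : Set (ℕ → Bool)} (e : Edge F) : Vertex F := ⟨e.dir :: e.base, e.mem⟩

/-- The vertices with two children in `T_F`. When the root has degree `2` these are the root and
the vertices of degree `3`; all the other vertices then have degree `2`. -/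
def Branching (F : Set (ℕ → Bool)) (v : Vertex F) : Prop :=
  ∀ b : Bool, b :: v.1 ∈ treeVertices F

open Classical in
/-- The kind of the tile `L_v` chosen for the vertex `v` of the tree colored by `ν`. -/
noncomputable def tileKind (F : Set (ℕ → Bool)) (ν : Vertex F → Bool) (v : Vertex F) : TileKind :=
  if Branching F v then (if ν v then .H1 else .L1) else (if ν v then .H0 else .L0)

/-- The vertices of the ray from the root to the end `f ∈ F`, as vertices of `T_F`. -/
def rayVertexF {F : Set (ℕ → Bool)} (f : F) (n : ℕ) : Vertex F := ⟨rayVertex f n, f, f.2, n, rfl⟩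

/-- The edge from the `n`-th to the `(n+1)`-st vertex of the ray from the root to `f ∈ F`. -/
def rayEdge {F : Set (ℕ → Bool)} (f : F) (n : ℕ) : Edge F :=
  ⟨rayVertex f n, f.1 n, f, f.2, n + 1, rfl⟩

/-! ### The surface `W_F^ν` -/

/-- The choices made in the construction of `W_F^ν`. The orientation of the edges of `T_F` points
away from the root on the positive side and towards the root on the negative side, so that two
different edges have the same origin or the same target exactly when they join a vertex different
from the root to its two children. -/
structure Realization (F : Set (ℕ → Bool)) (ν : Vertex F → Bool) where
  /-- The subset of the rim that is removed from the compact surface to obtain `L_v`. -/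
  K : Vertex F → Set Torus
  K_subset : ∀ v, K v ⊆ (tileKind F ν v).rim
  K_cantor : ∀ v s, IsCantorSet (K v ∩ (tileKind F ν v).circle s)
  /-- The boundary component of the tile of the parent used by the edge `e`. -/
  atParent : Edge F → Set Torus
  /-- The boundary component of the tile of the child used by the edge `e`. -/
  atChild : Edge F → Set Torus
  isComp_atParent : ∀ e,
    (tileKind F ν e.parent).IsBoundaryComponent (K e.parent) (atParent e)
  isComp_atChild : ∀ e,
    (tileKind F ν e.child).IsBoundaryComponent (K e.child) (atChild e)
  /-- The gluing homeomorphism. -/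
  glue : ∀ e, atChild e ≃ₜ atParent e
  /-- The edges from a vertex to its two children are attached at different sides. -/
  not_sameSide : ∀ e e' : Edge F, e ≠ e' → e.parent = e'.parent →
    ¬ (tileKind F ν e.parent).SameSide (atParent e) (atParent e')
  /-- The positive edge at the root is attached at an outer boundary component. -/
  root_outer : ∀ e : Edge F, e.base = [] → e.dir = true →
    atParent e ⊆ (tileKind F ν e.parent).circle .outer
  /-- The negative edge at the root is attached at an inner boundary component. -/
  root_inner : ∀ e : Edge F, e.base = [] → e.dir = false →
    atParent e ⊆ (tileKind F ν e.parent).circle .inner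
  /-- Different edges at a vertex use different boundary components. -/
  child_ne_parent : ∀ e e' : Edge F, e.child = e'.parent → atChild e ≠ atParent e'

namespace Realization

variable {F : Set (ℕ → Bool)} {ν : Vertex F → Bool} (D : Realization F ν)

/-- The noncompact tile `L_v`. -/
def Tile (v : Vertex F) : Type := {p : Torus // p ∈ (tileKind F ν v).body ∧ p ∉ D.K v}

instance (v : Vertex F) : TopologicalSpace (D.Tile v) :=
  inferInstanceAs (TopologicalSpace {p : Torus // p ∈ (tileKind F ν v).body ∧ p ∉ D.K v})

/-- The identifications given by the gluing maps. -/
def GlueRel (a b : Σ v, D.Tile v) : Prop :=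
  ∃ e : Edge F, a.1 = e.child ∧ b.1 = e.parent ∧
    ∃ x : D.atChild e, a.2.1 = (x : Torus) ∧ b.2.1 = (D.glue e x : Torus)

/-- The surface `W_F^ν`: the quotient of the disjoint union of the tiles by the equivalence
relation generated by the gluing maps. -/
def W : Type := Quot D.GlueRel

instance : TopologicalSpace D.W := inferInstanceAs (TopologicalSpace (Quot D.GlueRel))

/-- The natural map from the tile `L_v` to `W_F^ν`. -/
def incl (v : Vertex F) : C(D.Tile v, D.W) where
  toFun p := Quot.mk _ ⟨v, p⟩
  continuous_toFun := continuous_quot_mk.comp continuous_sigmaMk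

/-- The points of the boundary components of `L_v` that are glued to a neighbouring tile. -/
def gluedPart (v : Vertex F) : Set Torus :=
  {p | ∃ e : Edge F, (e.child = v ∧ p ∈ D.atChild e) ∨ (e.parent = v ∧ p ∈ D.atParent e)}

/-- The boundary of `W_F^ν`: the points of the boundary of a tile which are not glued. -/
def boundary : Set D.W :=
  {x | ∃ (v : Vertex F) (p : D.Tile v),
    p.1 ∈ (tileKind F ν v).rim ∧ p.1 ∉ D.gluedPart v ∧ x = D.incl v p}

/-- `e` is the end of `W_F^ν` defined by the ray of `T_F` with limit `f ∈ F`: every neighborhood of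
`e` contains the tiles `L_{v_n}` of the vertices of the ray for all large `n`. -/
def IsEndOfRay (f : F) (e : Ends D.W) : Prop :=
  ∀ K : Compacts D.W, ∀ᶠ n in atTop, range (D.incl (rayVertexF f n)) ⊆ e.comp K

open Classical in
/-- The sequence `ξ_n`, `n > 0`, along the ray from the root to `f ∈ F` (the value at `0` is
not used). -/
noncomputable def xi (f : F) : ℕ → ℤ
  | 0 => 1
  | n + 1 =>
    if (tileKind F ν (rayVertexF f (n + 1))).TwoSided ∧
        ¬ (tileKind F ν (rayVertexF f (n + 1))).SameSide
          (D.atChild (rayEdge f n)) (D.atParent (rayEdge f (n + 1)))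
    then -1 else 1

/-- Topologically accessible ends. Any two geodesic sequences converging to `f` have the same tail,
so it suffices to consider the one that starts at the root. -/
def TopAccessible (f : F) : Prop := ∃ N : ℕ, ∀ n > N, D.xi f n = 1

/-- `τ` is a loop in the interior of `L_v` which separates `L_v` in two connected components, one
containing all the outer boundary components and the other one all the inner ones. -/
def IsTau (v : Vertex F) (τ : C(Circle, D.Tile v)) : Prop :=
  (∀ t, (τ t).1 ∉ (tileKind F ν v).rim) ∧
  ∃ U V : Set (D.Tile v), IsOpen U ∧ IsOpen V ∧ IsConnected U ∧ IsConnected V ∧ Disjoint U V ∧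
    U ∪ V = (range τ)ᶜ ∧
    (∀ p : D.Tile v, p.1 ∈ (tileKind F ν v).circle .outer → p ∈ U) ∧
    (∀ p : D.Tile v, p.1 ∈ (tileKind F ν v).circle .inner → p ∈ V)

/-- The trace in `W_F^ν` of a loop in the tile `L_v`. -/
def trace (v : Vertex F) (τ : C(Circle, D.Tile v)) : Compacts D.W :=
  ⟨range ((D.incl v).comp τ), isCompact_range ((D.incl v).comp τ).continuous⟩

/-- The set `B(W_F^ν)` of ends defined by the noncompact boundary components. -/
def BEnds : Set (Ends D.W) := boundaryEnds D.boundary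

/-- The set `B(W_F^ν, e)` of the ends in `B(W_F^ν)` that cannot be separated from `e` by any
loop `τ_v`, i.e. that lie in the same component of the complement of the loop. -/
def BEndsAt (e : Ends D.W) : Set (Ends D.W) :=
  {b ∈ D.BEnds | ∀ v : Vertex F, (tileKind F ν v).TwoSided →
    ∀ τ : C(Circle, D.Tile v), D.IsTau v τ → b.comp (D.trace v τ) = e.comp (D.trace v τ)}

/-- The quotient of a set of ends by `≍`, with the quotient topology. -/
abbrev AsympQuotient (S : Set (Ends D.W)) : Type :=
  Quot (fun x y : S => asympRel D.boundary x.1 y.1)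

end Realization

/-! Every noncompact boundary component of `W` is an unglued open arc between two neighboring points
of the Cantor set `K v` removed from a tile (a gap). So `BEnds` consists of the ends `ptEnd v κ`
defined by those removed points `κ` that bound an unglued gap.

Threads. At each vertex every boundary circle of the tile carries an arc glued to a child
(`exists_child_edge`): two edges to children take opposite sides, and a tile with one child has a
single circle. Following these arcs downwards from a circle produces a ray that never changes side,
and since `F` is closed it ends at some `f ∈ F` (`exists_thread`). A removed point on a circle of
this thread cannot be cut off from `f` by a loop `τ_v`: the tiles of the ray, with `L_v` replaced by
the side of `τ_v` containing the circle, form a connected chain (`Thread.comp_eq`). On the other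
hand two points of `F` part at a branching vertex through components of different sides, so a loop
parallel to the outer circle separates them (`exists_tau_separating`). This gives the partition of
`BEnds`, and `BEndsAt` is nonempty exactly when the ray has a thread, which is topological
accessibility (`topAccessible_iff`).

The circle. Take a thread that starts as near to the root as possible. On its `n`-th circle the only
glued arcs are the one towards the next vertex and, for `n > 0`, the one towards the preceding
vertex. These two arcs (for `n = 0` an arbitrary unglued gap replaces the missing one) divide the
Cantor set into two pieces, which Cantor functions send onto `[n, n+1]` and `[-(n+1), -n]`, up to a
sign depending on the gluing maps (`nonempty_frameCoord`, `Chart`). The ends of an unglued gap get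
the same coordinate, and so do the points of consecutive circles that define the same end. The
Cantor sets accumulate only at the end of the ray, which is sent to infinity. The result is a
continuous map from `ℕ∞ × {0,1}^ℕ` onto the one-point compactification of the line, a circle, whose
fibers are the fibers of `≍`.

For this one must know exactly which removed points define the same end: only the limits of a glued
arc seen from its two tiles (`eq_or_matched_of_ptEnd_eq`). All other pairs are separated by the
compact frontier of a box in one tile, or of two matching boxes in adjacent tiles
(`IsIsolation.ne`). -/

/-! ### Polar coordinates on the torus -/

/-- The point with polar coordinates `ρ` and `2πθ` around `c`. -/
noncomputable def polar (c : Torus) (ρ θ : ℝ) : Torus :=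
  (c.1 + ((ρ * Real.cos (2 * Real.pi * θ) : ℝ) : UnitAddCircle),
    c.2 + ((ρ * Real.sin (2 * Real.pi * θ) : ℝ) : UnitAddCircle))

theorem continuous_polar (c : Torus) : Continuous fun x : ℝ × ℝ => polar c x.1 x.2 := by
  have h : Continuous ((↑) : ℝ → UnitAddCircle) := AddCircle.continuous_mk' 1
  unfold polar
  refine Continuous.prodMk ?_ ?_
  · exact continuous_const.add (h.comp (by fun_prop))
  · exact continuous_const.add (h.comp (by fun_prop))

theorem polar_add_int (c : Torus) (ρ θ : ℝ) (n : ℤ) : polar c ρ (θ + n) = polar c ρ θ := by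
  have e : 2 * Real.pi * (θ + n) = 2 * Real.pi * θ + n * (2 * Real.pi) := by ring
  simp [polar, e, Real.cos_add_int_mul_two_pi, Real.sin_add_int_mul_two_pi]

theorem norm_coe_unitAddCircle {x : ℝ} (hx : |x| ≤ 1 / 2) : ‖(x : UnitAddCircle)‖ = |x| := by
  rw [AddCircle.norm_coe_eq_abs_iff 1 one_ne_zero]; simpa using hx

theorem exists_coe_unitAddCircle (a : UnitAddCircle) : ∃ x : ℝ, |x| ≤ 1 / 2 ∧ (x : UnitAddCircle) = a := by
  obtain ⟨y, rfl⟩ := QuotientAddGroup.mk_surjective a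
  refine ⟨y - round y, abs_sub_round y, ?_⟩
  have : ((round y : ℝ) : UnitAddCircle) = 0 := by
    have := AddCircle.coe_period (1 : ℝ)
    rw [show (round y : ℝ) = (round y) • (1 : ℝ) by simp, AddCircle.coe_zsmul, this, smul_zero]
  rw [AddCircle.coe_sub, this, sub_zero]

theorem norm_unitAddCircle_le (a : UnitAddCircle) : ‖a‖ ≤ 1 / 2 := by
  simpa using AddCircle.norm_le_half_period (p := 1) (x := a) one_ne_zero

theorem coe_unitAddCircle_inj {x y : ℝ} (hx : |x| < 1 / 2) (hy : |y| < 1 / 2)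
    (h : (x : UnitAddCircle) = y) : x = y := by
  rw [← sub_eq_zero, ← AddCircle.coe_sub] at h
  have h1 : |x - y| < 1 := by
    have := abs_sub x y
    linarith [abs_sub x y]
  obtain ⟨n, hn⟩ := (AddCircle.coe_eq_zero_iff 1).1 h
  have : |(n : ℝ)| < 1 := by simpa [← hn] using h1
  have : n = 0 := by
    rw [← Int.cast_abs] at this
    have : |n| < 1 := by exact_mod_cast this
    exact Int.abs_lt_one_iff.1 this
  subst this
  simp at hn; linarith

theorem sqDist_polar (c : Torus) {ρ : ℝ} (h0 : 0 ≤ ρ) (h : ρ ≤ 1 / 2) (θ : ℝ) :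
    sqDist (polar c ρ θ) c = ρ ^ 2 := by
  have h1 : |ρ * Real.cos (2 * Real.pi * θ)| ≤ 1 / 2 := by
    rw [abs_mul, abs_of_nonneg h0]
    nlinarith [Real.abs_cos_le_one (2 * Real.pi * θ), abs_nonneg (Real.cos (2 * Real.pi * θ))]
  have h2 : |ρ * Real.sin (2 * Real.pi * θ)| ≤ 1 / 2 := by
    rw [abs_mul, abs_of_nonneg h0]
    nlinarith [Real.abs_sin_le_one (2 * Real.pi * θ), abs_nonneg (Real.sin (2 * Real.pi * θ))]
  simp only [sqDist, polar, add_sub_cancel_left]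
  rw [norm_coe_unitAddCircle h1, norm_coe_unitAddCircle h2, sq_abs, sq_abs]
  nlinarith [Real.sin_sq_add_cos_sq (2 * Real.pi * θ)]

theorem exists_polar (c p : Torus) {ρ : ℝ} (h0 : 0 ≤ ρ) (h : sqDist p c = ρ ^ 2) :
    ∃ θ, p = polar c ρ θ := by
  obtain ⟨x, hx, hx'⟩ := exists_coe_unitAddCircle (p.1 - c.1)
  obtain ⟨y, hy, hy'⟩ := exists_coe_unitAddCircle (p.2 - c.2)
  have hs : x ^ 2 + y ^ 2 = ρ ^ 2 := by
    rw [← h, sqDist, ← hx', ← hy', norm_coe_unitAddCircle hx, norm_coe_unitAddCircle hy, sq_abs,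
      sq_abs]
  set z : ℂ := ⟨x, y⟩ with hz
  have hn : ‖z‖ = ρ := by
    rw [← sq_eq_sq₀ (norm_nonneg _) h0, Complex.sq_norm, Complex.normSq_apply, ← hs]; ring
  refine ⟨z.arg / (2 * Real.pi), ?_⟩
  have e : 2 * Real.pi * (z.arg / (2 * Real.pi)) = z.arg := by
    field_simp
  have h1 : ρ * Real.cos z.arg = x := by rw [← hn, Complex.norm_mul_cos_arg]
  have h2 : ρ * Real.sin z.arg = y := by rw [← hn, Complex.norm_mul_sin_arg]
  ext
  · simp only [polar, e, h1, hx', add_sub_cancel]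
  · simp only [polar, e, h2, hy', add_sub_cancel]

/-- Radii below `1/2` keep both coordinates in the interval where `ℝ → ℝ/ℤ` is injective, so the
equality lifts to the plane. -/
theorem polar_inj {c : Torus} {ρ ρ' θ θ' : ℝ} (h0 : 0 < ρ) (h1 : ρ < 1 / 2) (h0' : 0 < ρ')
    (h1' : ρ' < 1 / 2) (h : polar c ρ θ = polar c ρ' θ') : ρ = ρ' ∧ ∃ n : ℤ, θ' = θ + n := by
  have hρ : ρ = ρ' := by
    have := sqDist_polar c h0.le h1.le θ
    rw [h, sqDist_polar c h0'.le h1'.le, sq_eq_sq₀ h0'.le h0.le] at this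
    exact this.symm
  subst hρ
  refine ⟨rfl, ?_⟩
  have b : ∀ x : ℝ, |x| ≤ 1 → |ρ * x| < 1 / 2 := fun x hx => by
    rw [abs_mul, abs_of_pos h0]; nlinarith [abs_nonneg x]
  have hc := coe_unitAddCircle_inj (b _ (Real.abs_cos_le_one _)) (b _ (Real.abs_cos_le_one _))
    (add_left_cancel (congrArg Prod.fst h))
  have hs := coe_unitAddCircle_inj (b _ (Real.abs_sin_le_one _)) (b _ (Real.abs_sin_le_one _))
    (add_left_cancel (congrArg Prod.snd h))
  have hc := mul_left_cancel₀ h0.ne' hc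
  have hs := mul_left_cancel₀ h0.ne' hs
  have := Real.Angle.cos_sin_inj hc hs
  rw [Real.Angle.angle_eq_iff_two_pi_dvd_sub] at this
  obtain ⟨k, hk⟩ := this
  refine ⟨-k, ?_⟩
  have : 2 * Real.pi * (θ - θ' - k) = 0 := by linear_combination hk
  have := (mul_eq_zero.1 this).resolve_left (by positivity)
  push_cast; linarith

theorem continuous_sqDist (c : Torus) : Continuous fun p => sqDist p c := by
  unfold sqDist; fun_prop

theorem norm_sub_half (a : UnitAddCircle) : ‖a - ((1 / 2 : ℝ) : UnitAddCircle)‖ = 1 / 2 - ‖a‖ := by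
  obtain ⟨x, hx, rfl⟩ := exists_coe_unitAddCircle a
  rw [norm_coe_unitAddCircle hx]
  rcases abs_le.1 hx with ⟨h1, h2⟩
  rcases le_total 0 x with h | h
  · rw [← AddCircle.coe_sub, norm_coe_unitAddCircle (abs_le.2 ⟨by linarith, by linarith⟩),
      abs_of_nonneg h, abs_of_nonpos (by linarith)]; ring
  · have : ((x - 1 / 2 : ℝ) : UnitAddCircle) = ((x + 1 / 2 : ℝ) : UnitAddCircle) := by
      rw [show x + 1 / 2 = x - 1 / 2 + 1 by ring, AddCircle.coe_add 1 (x - 1 / 2) 1,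
        AddCircle.coe_period, add_zero]
    rw [← AddCircle.coe_sub, this, norm_coe_unitAddCircle (abs_le.2 ⟨by linarith, by linarith⟩),
      abs_of_nonpos h, abs_of_nonneg (by linarith)]; ring

theorem sqDist_zero (p : Torus) : sqDist p 0 = ‖p.1‖ ^ 2 + ‖p.2‖ ^ 2 := by simp [sqDist]

theorem sqDist_farPoint (p : Torus) :
    sqDist p farPoint = (1 / 2 - ‖p.1‖) ^ 2 + (1 / 2 - ‖p.2‖) ^ 2 := by
  simp only [sqDist, farPoint, norm_sub_half]

/-- As `2 (9/32)² < 1/4`, this keeps the disks of radius `9/32` about the two centers of `H¹`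
disjoint, and with them the two collars. -/
theorem sqDist_zero_add_farPoint (p : Torus) : 1 / 4 ≤ sqDist p 0 + sqDist p farPoint := by
  rw [sqDist_zero, sqDist_farPoint]
  nlinarith [sq_nonneg (‖p.1‖ - 1 / 4), sq_nonneg (‖p.2‖ - 1 / 4)]

/-! ### Connectedness of subsets of the torus -/

/-- A set described by the distances of the coordinates to `0` is connected if its trace on the
quadrant is connected and contains a point fixed by the symmetries. -/
theorem isPreconnected_of_quadrant {Q : Set (ℝ × ℝ)} (hQ : IsPreconnected Q)
    (hQ' : ∀ q ∈ Q, 0 ≤ q.1 ∧ q.1 ≤ 1 / 2 ∧ 0 ≤ q.2 ∧ q.2 ≤ 1 / 2) {x : ℝ} (hx : (x, (0 : ℝ)) ∈ Q)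
    (hx2 : x = 0 ∨ x = 1 / 2) :
    IsPreconnected {p : Torus | (‖p.1‖, ‖p.2‖) ∈ Q} := by
  have hc : Continuous ((↑) : ℝ → UnitAddCircle) := AddCircle.continuous_mk' 1
  let g : ℝ × ℝ → ℝ × ℝ → Torus := fun ε q => (((ε.1 * q.1 : ℝ) : UnitAddCircle),
    ((ε.2 * q.2 : ℝ) : UnitAddCircle))
  have hg : ∀ ε, Continuous (g ε) := fun ε =>
    (hc.comp (by fun_prop)).prodMk (hc.comp (by fun_prop))
  -- Signs of the four reflections. The four reflected copies of `Q` share the point `(x, 0)`, which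
  -- every reflection fixes because `-1/2 = 1/2` in `ℝ/ℤ`.
  let E : Set (ℝ × ℝ) := {ε | (ε.1 = 1 ∨ ε.1 = -1) ∧ (ε.2 = 1 ∨ ε.2 = -1)}
  have key : {p : Torus | (‖p.1‖, ‖p.2‖) ∈ Q} = ⋃ ε ∈ E, g ε '' Q := by
    ext p
    simp only [mem_ofPred_eq, mem_iUnion, mem_image, exists_prop]
    constructor
    · intro hp
      obtain ⟨a, ha, ha'⟩ := exists_coe_unitAddCircle p.1
      obtain ⟨b, hb, hb'⟩ := exists_coe_unitAddCircle p.2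
      have h1 : ‖p.1‖ = |a| := by rw [← ha', norm_coe_unitAddCircle ha]
      have h2 : ‖p.2‖ = |b| := by rw [← hb', norm_coe_unitAddCircle hb]
      have sgn : ∀ t : ℝ, ∃ ε : ℝ, (ε = 1 ∨ ε = -1) ∧ ε * |t| = t := fun t => by
        rcases abs_choice t with h | h
        · exact ⟨1, Or.inl rfl, by rw [h, one_mul]⟩
        · exact ⟨-1, Or.inr rfl, by rw [h]; ring⟩
      obtain ⟨ε, hε, hε'⟩ := sgn a
      obtain ⟨δ, hδ, hδ'⟩ := sgn b
      refine ⟨(ε, δ), ⟨hε, hδ⟩, _, hp, ?_⟩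
      ext
      · simp only [g, h1, hε', ha']
      · simp only [g, h2, hδ', hb']
    · rintro ⟨⟨ε, δ⟩, ⟨hε, hδ⟩, q, hq, rfl⟩
      obtain ⟨h1, h2, h3, h4⟩ := hQ' q hq
      have abs1 : ∀ {ε t : ℝ}, (ε = 1 ∨ ε = -1) → 0 ≤ t → |ε * t| = t := by
        rintro ε t (rfl | rfl) ht <;> simp [abs_of_nonneg ht]
      have e1 : ‖((ε * q.1 : ℝ) : UnitAddCircle)‖ = q.1 := by
        rw [norm_coe_unitAddCircle, abs1 hε h1]; rw [abs1 hε h1]; exact h2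
      have e2 : ‖((δ * q.2 : ℝ) : UnitAddCircle)‖ = q.2 := by
        rw [norm_coe_unitAddCircle, abs1 hδ h3]; rw [abs1 hδ h3]; exact h4
      simpa only [g, e1, e2] using hq
  rw [key, ← sUnion_image]
  refine isPreconnected_sUnion ((x : UnitAddCircle), ((0 : ℝ) : UnitAddCircle)) _ ?_ ?_
  · rintro _ ⟨⟨ε, δ⟩, ⟨hε, hδ⟩, rfl⟩
    refine ⟨_, hx, ?_⟩
    ext
    · show ((ε * x : ℝ) : UnitAddCircle) = x
      rcases hε with h | h <;> simp only at h <;> subst h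
      · simp
      · rcases hx2 with rfl | rfl
        · simp
        · rw [show (1 / 2 : ℝ) = -1 * (1 / 2) + 1 by norm_num, AddCircle.coe_add 1 (-1 * (1 / 2)) 1,
            AddCircle.coe_period, add_zero]
          norm_num
    · simp [g]
  · rintro _ ⟨ε, -, rfl⟩
    exact hQ.image _ (hg ε).continuousOn

theorem isPreconnected_closedBall_torus (r : ℝ) :
    IsPreconnected {p : Torus | sqDist p 0 ≤ r ^ 2} := by
  have := isPreconnected_of_quadrant
    (Q := {q | (0 ≤ q.1 ∧ q.1 ≤ 1 / 2 ∧ 0 ≤ q.2 ∧ q.2 ≤ 1 / 2) ∧ q.1 ^ 2 + q.2 ^ 2 ≤ r ^ 2})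
    (x := 0) ?_ (fun q hq => hq.1) ⟨by norm_num, by norm_num; positivity⟩ (Or.inl rfl)
  · convert this using 1
    ext p
    have h1 := norm_unitAddCircle_le p.1
    have h2 := norm_unitAddCircle_le p.2
    simp only [mem_ofPred_eq, sqDist_zero, norm_nonneg, h1, h2, true_and]
  · have hs : StarConvex ℝ (0 : ℝ × ℝ)
        {q | (0 ≤ q.1 ∧ q.1 ≤ 1 / 2 ∧ 0 ≤ q.2 ∧ q.2 ≤ 1 / 2) ∧ q.1 ^ 2 + q.2 ^ 2 ≤ r ^ 2} := by
      rw [starConvex_zero_iff]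
      rintro q ⟨⟨a1, a2, a3, a4⟩, hq⟩ t ht0 ht1
      refine ⟨⟨?_, ?_, ?_, ?_⟩, ?_⟩ <;> simp only [Prod.smul_fst, Prod.smul_snd, smul_eq_mul]
      · positivity
      · nlinarith
      · positivity
      · nlinarith
      · have : t ^ 2 ≤ 1 := by nlinarith
        nlinarith [sq_nonneg q.1, sq_nonneg q.2]
    exact (hs.isPathConnected ⟨⟨by norm_num, by norm_num, by norm_num, by norm_num⟩,
      by norm_num; positivity⟩).isConnected.isPreconnected

theorem isPreconnected_annulus_torus {r R : ℝ} (h0 : 0 ≤ r) (hR : 0 ≤ R) (h : R ≤ 1 / 2) :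
    IsPreconnected {p : Torus | r ^ 2 ≤ sqDist p 0 ∧ sqDist p 0 ≤ R ^ 2} := by
  have : {p : Torus | r ^ 2 ≤ sqDist p 0 ∧ sqDist p 0 ≤ R ^ 2} =
      (fun x : ℝ × ℝ => polar 0 x.1 x.2) '' (Icc r R ×ˢ univ) := by
    ext p
    constructor
    · rintro ⟨h1, h2⟩
      have h3 : 0 ≤ sqDist p 0 := by unfold sqDist; positivity
      obtain ⟨θ, hθ⟩ := exists_polar 0 p (Real.sqrt_nonneg _) (Real.sq_sqrt h3).symm
      exact ⟨(_, θ), ⟨⟨Real.le_sqrt_of_sq_le h1, Real.sqrt_le_iff.2 ⟨hR, h2⟩⟩, trivial⟩, hθ.symm⟩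
    · rintro ⟨⟨ρ, θ⟩, ⟨⟨h1, h2⟩, -⟩, rfl⟩
      simp only at h1 h2
      simp only [mem_ofPred_eq, sqDist_polar 0 (h0.trans h1) (h2.trans h)]
      constructor <;> nlinarith
  rw [this]
  exact (isPreconnected_Icc.prod isPreconnected_univ).image _ (continuous_polar 0).continuousOn

/-- A set of points of the quadrant that can be moved to the antidiagonal along the direction of the
diagonal is connected. -/
theorem isPreconnected_of_antidiagonal {Q : Set (ℝ × ℝ)}
    (h : ∀ q ∈ Q, ∀ t ∈ Icc (0 : ℝ) 1, (q.1 + t * ((1 / 2 - q.1 - q.2) / 2),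
      q.2 + t * ((1 / 2 - q.1 - q.2) / 2)) ∈ Q)
    (hA : ∀ a ∈ Icc (0 : ℝ) (1 / 2), (a, 1 / 2 - a) ∈ Q)
    (hQ' : ∀ q ∈ Q, 0 ≤ q.1 ∧ q.1 ≤ 1 / 2 ∧ 0 ≤ q.2 ∧ q.2 ≤ 1 / 2) : IsPreconnected Q := by
  let A : Set (ℝ × ℝ) := (fun a : ℝ => (a, 1 / 2 - a)) '' Icc 0 (1 / 2)
  have hAc : IsPreconnected A := isPreconnected_Icc.image _ (by fun_prop)
  have hAQ : A ⊆ Q := by rintro _ ⟨a, ha, rfl⟩; exact hA a ha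
  refine isPreconnected_of_forall (1 / 2, 0) fun q hq => ?_
  refine ⟨(fun t : ℝ => (q.1 + t * ((1 / 2 - q.1 - q.2) / 2),
      q.2 + t * ((1 / 2 - q.1 - q.2) / 2))) '' Icc 0 1 ∪ A, ?_, ?_, ?_, ?_⟩
  · refine union_subset ?_ hAQ
    rintro _ ⟨t, ht, rfl⟩; exact h q hq t ht
  · exact Or.inr ⟨1 / 2, ⟨by norm_num, le_rfl⟩, by norm_num⟩
  · exact Or.inl ⟨0, ⟨le_rfl, zero_le_one⟩, by simp⟩
  · obtain ⟨h1, h2, h3, h4⟩ := hQ' q hq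
    refine IsPreconnected.union (q.1 + 1 * ((1 / 2 - q.1 - q.2) / 2),
      q.2 + 1 * ((1 / 2 - q.1 - q.2) / 2)) ⟨1, ⟨zero_le_one, le_rfl⟩, rfl⟩ ?_
      (isPreconnected_Icc.image _ (by fun_prop)) hAc
    exact ⟨q.1 + 1 * ((1 / 2 - q.1 - q.2) / 2), ⟨by linarith, by linarith⟩, by ext <;> simp; ring⟩

/-- Here `d` is half of the defect of the coordinate sum from `1/2` and `x` is the difference of the
coordinates; moving along the diagonal replaces `d` by `(1 - t) d` and keeps `x`. The sum of squares
is `2 (1/4 - (1 - t) d)² + x²/2`: it does not decrease if `d ≥ 0`, and it is at least `1/8` if `d ≤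
0`. -/
theorem sum_sq_antidiagonal {d x t R : ℝ} (ht0 : 0 ≤ t) (ht1 : t ≤ 1) (hd : d ≤ 1 / 4)
    (hR : R ≤ 1 / 8)
    (h : R ≤ (1 / 4 - d + x / 2) ^ 2 + (1 / 4 - d - x / 2) ^ 2) :
    R ≤ (1 / 4 - d + x / 2 + t * d) ^ 2 + (1 / 4 - d - x / 2 + t * d) ^ 2 := by
  have e : (1 / 4 - d + x / 2 + t * d) ^ 2 + (1 / 4 - d - x / 2 + t * d) ^ 2
    = 2 * (1 / 4 - (1 - t) * d) ^ 2 + x ^ 2 / 2 := by ring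
  have e' : (1 / 4 - d + x / 2) ^ 2 + (1 / 4 - d - x / 2) ^ 2
    = 2 * (1 / 4 - d) ^ 2 + x ^ 2 / 2 := by ring
  rw [e]; rw [e'] at h
  rcases le_total 0 d with h0 | h0
  · have h1 : 1 / 4 - d ≤ 1 / 4 - (1 - t) * d := by nlinarith
    have := pow_le_pow_left₀ (by linarith : 0 ≤ 1 / 4 - d) h1 2
    linarith
  · have h1 : 1 / 4 ≤ 1 / 4 - (1 - t) * d := by nlinarith
    have := pow_le_pow_left₀ (by norm_num : (0 : ℝ) ≤ 1 / 4) h1 2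
    linarith [sq_nonneg x]

/-- The antidiagonal of the quadrant stays at squared distance at least `1/8` from both centers, so
it avoids both disks, and every point of the region can slide onto it. The point reflection of the
quadrant exchanges the two disks, whence the signs `-d`, `-x` in the second estimate. -/
theorem isPreconnected_compl_balls_torus {r R : ℝ} (hr : r ^ 2 ≤ 1 / 8) (hR : R ^ 2 ≤ 1 / 8) :
    IsPreconnected {p : Torus | r ^ 2 ≤ sqDist p 0 ∧ R ^ 2 ≤ sqDist p farPoint} := by
  have := isPreconnected_of_quadrant
    (Q := {q | (0 ≤ q.1 ∧ q.1 ≤ 1 / 2 ∧ 0 ≤ q.2 ∧ q.2 ≤ 1 / 2) ∧ r ^ 2 ≤ q.1 ^ 2 + q.2 ^ 2 ∧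
      R ^ 2 ≤ (1 / 2 - q.1) ^ 2 + (1 / 2 - q.2) ^ 2})
    (x := 1 / 2) ?_ (fun q hq => hq.1) ⟨by norm_num, by norm_num; constructor <;> linarith⟩
    (Or.inr rfl)
  · convert this using 1
    ext p
    have h1 := norm_unitAddCircle_le p.1
    have h2 := norm_unitAddCircle_le p.2
    simp only [mem_ofPred_eq, sqDist_zero, sqDist_farPoint, norm_nonneg, h1, h2, true_and]
  · refine isPreconnected_of_antidiagonal ?_ ?_ (fun q hq => hq.1)
    · rintro ⟨a, b⟩ ⟨⟨h1, h2, h3, h4⟩, h5, h6⟩ t ⟨ht0, ht1⟩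
      obtain ⟨d, hd⟩ : ∃ d, d = (1 / 2 - a - b) / 2 := ⟨_, rfl⟩
      obtain ⟨x, hx⟩ : ∃ x, x = a - b := ⟨_, rfl⟩
      show (a + t * ((1 / 2 - a - b) / 2), b + t * ((1 / 2 - a - b) / 2)) ∈ _
      rw [← hd]
      have ea : a = 1 / 4 - d + x / 2 := by linarith
      have eb : b = 1 / 4 - d - x / 2 := by linarith
      clear hd hx
      subst ea eb
      have c1 : ∀ y : ℝ, 0 ≤ y → 0 ≤ y + d → 0 ≤ y + t * d := fun y h h' => by
        have : y + t * d = (1 - t) * y + t * (y + d) := by ring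
        rw [this]
        have : 0 ≤ 1 - t := by linarith
        positivity
      have c2 : ∀ y : ℝ, y ≤ 1 / 2 → y + d ≤ 1 / 2 → y + t * d ≤ 1 / 2 := fun y h h' => by
        have := mul_le_mul_of_nonneg_left h (by linarith : 0 ≤ 1 - t)
        have := mul_le_mul_of_nonneg_left h' ht0
        linarith
      refine ⟨⟨c1 _ h1 (by linarith), c2 _ h2 (by linarith), c1 _ h3 (by linarith),
        c2 _ h4 (by linarith)⟩, ?_, ?_⟩
      · exact sum_sq_antidiagonal ht0 ht1 (by linarith) hr h5
      · have := sum_sq_antidiagonal (d := -d) (x := -x) ht0 ht1 (by linarith) hR (h6.trans_eq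
          (by ring))
        exact this.trans_eq (by ring)
    · rintro a ⟨h1, h2⟩
      refine ⟨⟨h1, h2, by linarith, by linarith⟩, ?_, ?_⟩
      · nlinarith [sq_nonneg (a - 1 / 4)]
      · nlinarith [sq_nonneg (a - 1 / 4)]

/-! ### Collars of the boundary circles -/

namespace TileKind

noncomputable def center : TileKind → Side → Torus
  | .H1, .inner => farPoint
  | _, _ => 0

/-- Increasing `t` moves from the boundary circle into the tile. The factor `1/32` is small enough
for the collars of the two circles of `L¹` or `H¹` to stay disjoint up to `t = 1`. -/
noncomputable def radius : TileKind → Side → ℝ → ℝ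
  | .L0, _, t => 1 / 4 - t / 32
  | .L1, .outer, t => 1 / 4 - t / 32
  | .L1, .inner, t => 1 / 8 + t / 32
  | .H0, _, t => 1 / 4 + t / 32
  | .H1, _, t => 1 / 4 + t / 32

/-- The point of the collar of a boundary circle with angle `2πθ` at depth `t ∈ [0, 1]`. -/
noncomputable def collar (k : TileKind) (s : Side) (θ t : ℝ) : Torus :=
  polar (k.center s) (k.radius s t) θ

variable (k : TileKind) (s : Side)

theorem continuous_radius : Continuous (k.radius s) := by
  cases k <;> cases s <;> unfold radius <;> fun_prop

theorem continuous_collar : Continuous fun x : ℝ × ℝ => k.collar s x.1 x.2 :=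
  (continuous_polar (k.center s)).comp
    (((k.continuous_radius s).comp continuous_snd).prodMk continuous_fst)

theorem continuous_collar_left (t : ℝ) : Continuous fun θ => k.collar s θ t :=
  (k.continuous_collar s).comp (by fun_prop : Continuous fun θ : ℝ => (θ, t))

theorem collar_add_int (θ t : ℝ) (n : ℤ) : k.collar s (θ + n) t = k.collar s θ t :=
  polar_add_int _ _ _ _

theorem radius_bounds {t : ℝ} (ht : t ∈ Icc (0 : ℝ) 1) :
    1 / 8 ≤ k.radius s t ∧ k.radius s t ≤ 9 / 32 := by
  obtain ⟨h0, h1⟩ := ht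
  cases k <;> cases s <;> simp only [radius] <;> constructor <;> linarith

theorem radius_injective : Function.Injective (k.radius s) := by
  intro t t' h
  cases k <;> cases s <;> simp only [radius] at h <;> linarith

theorem collar_inj {θ t θ' t' : ℝ} (ht : t ∈ Icc (0 : ℝ) 1) (ht' : t' ∈ Icc (0 : ℝ) 1)
    (h : k.collar s θ t = k.collar s θ' t') : t = t' ∧ ∃ n : ℤ, θ' = θ + n := by
  have h1 := k.radius_bounds s ht
  have h2 := k.radius_bounds s ht'
  obtain ⟨h3, h4⟩ := polar_inj (by linarith) (by linarith) (by linarith) (by linarith) h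
  exact ⟨k.radius_injective s h3, h4⟩

theorem sqDist_collar {θ t : ℝ} (ht : t ∈ Icc (0 : ℝ) 1) :
    sqDist (k.collar s θ t) (k.center s) = k.radius s t ^ 2 := by
  have h1 := k.radius_bounds s ht
  exact sqDist_polar _ (by linarith) (by linarith) _

theorem exists_collar {p : Torus} {t : ℝ} (ht : t ∈ Icc (0 : ℝ) 1)
    (h : sqDist p (k.center s) = k.radius s t ^ 2) : ∃ θ, p = k.collar s θ t :=
  exists_polar _ _ (by linarith [k.radius_bounds s ht]) h

theorem circle_eq_sqDist : k.circle s = {p | sqDist p (k.center s) = k.radius s 0 ^ 2} := by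
  cases k <;> cases s <;> simp [circle, center, radius]

theorem circle_eq_range : k.circle s = range fun θ => k.collar s θ 0 := by
  rw [circle_eq_sqDist]
  ext p
  constructor
  · intro h
    obtain ⟨θ, hθ⟩ := k.exists_collar s (by simp) h
    exact ⟨θ, hθ.symm⟩
  · rintro ⟨θ, rfl⟩
    exact k.sqDist_collar s (by simp)

/-- The open collar of width `r` as a sublevel set. -/
noncomputable def collarOpen (k : TileKind) (s : Side) (r : ℝ) : Set Torus :=
  {p | match k, s with
    | .L0, _ => (1 / 4 - r / 32) ^ 2 < sqDist p 0
    | .L1, .outer => (1 / 4 - r / 32) ^ 2 < sqDist p 0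
    | .L1, .inner => sqDist p 0 < (1 / 8 + r / 32) ^ 2
    | .H0, _ => sqDist p 0 < (1 / 4 + r / 32) ^ 2
    | .H1, .outer => sqDist p 0 < (1 / 4 + r / 32) ^ 2
    | .H1, .inner => sqDist p farPoint < (1 / 4 + r / 32) ^ 2}

theorem isOpen_collarOpen (r : ℝ) : IsOpen (k.collarOpen s r) := by
  cases k <;> cases s <;> unfold collarOpen <;>
    first
      | exact isOpen_lt continuous_const (continuous_sqDist _)
      | exact isOpen_lt (continuous_sqDist _) continuous_const

theorem sqDist_nonneg (p c : Torus) : 0 ≤ sqDist p c := by unfold sqDist; positivity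

theorem exists_sq_inward {a r d : ℝ} (hd : 0 ≤ d) (ha : 1 / 32 ≤ a) (hr : r ≤ 1) :
    ((a - r / 32) ^ 2 < d ∧ d ≤ a ^ 2) ↔ ∃ t ∈ Ico (0 : ℝ) r, d = (a - t / 32) ^ 2 := by
  constructor
  · rintro ⟨h1, h2⟩
    have h3 : √d ≤ a := Real.sqrt_le_iff.2 ⟨by linarith, h2⟩
    have h4 : a - r / 32 < √d := Real.lt_sqrt_of_sq_lt h1
    refine ⟨32 * (a - √d), ⟨by linarith, by linarith⟩, ?_⟩
    rw [show a - 32 * (a - √d) / 32 = √d by ring, Real.sq_sqrt hd]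
  · rintro ⟨t, ⟨h0, h1⟩, rfl⟩
    exact ⟨pow_lt_pow_left₀ (by linarith) (by linarith) two_ne_zero,
      pow_le_pow_left₀ (by linarith) (by linarith) 2⟩

theorem exists_sq_outward {a r d : ℝ} (hd : 0 ≤ d) (ha : 0 ≤ a) (hr0 : 0 ≤ r) :
    (d < (a + r / 32) ^ 2 ∧ a ^ 2 ≤ d) ↔ ∃ t ∈ Ico (0 : ℝ) r, d = (a + t / 32) ^ 2 := by
  constructor
  · rintro ⟨h1, h2⟩
    have h3 : a ≤ √d := Real.le_sqrt_of_sq_le h2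
    have h4 : √d < a + r / 32 := (Real.sqrt_lt' (by by_contra h; nlinarith)).2 h1
    refine ⟨32 * (√d - a), ⟨by linarith, by linarith⟩, ?_⟩
    rw [show a + 32 * (√d - a) / 32 = √d by ring, Real.sq_sqrt hd]
  · rintro ⟨t, ⟨h0, h1⟩, rfl⟩
    exact ⟨pow_lt_pow_left₀ (by linarith) (by linarith) two_ne_zero,
      pow_le_pow_left₀ (by linarith) (by linarith) 2⟩

/-- So close to one circle the inequality of `body` that concerns the other circle holds
automatically; what is left is the monotonicity of the radius in `t`. -/
theorem mem_body_inter_collarOpen_iff {r : ℝ} (hr : r ∈ Icc (0 : ℝ) 1) (p : Torus) :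
    p ∈ k.body ∩ k.collarOpen s r ↔
      ∃ t ∈ Ico (0 : ℝ) r, sqDist p (k.center s) = k.radius s t ^ 2 := by
  obtain ⟨hr0, hr1⟩ := hr
  have hd0 := sqDist_nonneg p 0
  have hf0 := sqDist_nonneg p farPoint
  have hsum := sqDist_zero_add_farPoint p
  have i1 := exists_sq_inward (a := 1 / 4) (r := r) hd0 (by norm_num) hr1
  have o1 := exists_sq_outward (a := 1 / 4) (r := r) hd0 (by norm_num) hr0
  have o2 := exists_sq_outward (a := 1 / 8) (r := r) hd0 (by norm_num) hr0
  have o3 := exists_sq_outward (a := 1 / 4) (r := r) hf0 (by norm_num) hr0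
  have b1 : (1 / 8 : ℝ) ^ 2 ≤ (1 / 4 - r / 32) ^ 2 :=
    pow_le_pow_left₀ (by norm_num) (by linarith) 2
  have b2 : (1 / 8 + r / 32) ^ 2 ≤ (1 / 4 : ℝ) ^ 2 :=
    pow_le_pow_left₀ (by linarith) (by linarith) 2
  have b3 : (1 / 4 + r / 32) ^ 2 ≤ (9 / 32 : ℝ) ^ 2 :=
    pow_le_pow_left₀ (by linarith) (by linarith) 2
  cases k <;> cases s <;>
    simp only [body, collarOpen, center, radius, mem_inter_iff, mem_ofPred_eq]
  · rw [← i1, and_comm]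
  · rw [← i1, and_comm]
  · rw [← i1, and_assoc, and_comm (a := sqDist p 0 ≤ _)]
    exact and_iff_right_of_imp fun h => b1.trans h.1.le
  · rw [← o2, and_right_comm, and_comm (b := sqDist p 0 < _)]
    exact and_iff_left_of_imp fun h => h.1.le.trans b2
  · rw [← o1, and_comm]
  · rw [← o1, and_comm]
  · rw [← o1, and_right_comm, and_comm (b := sqDist p 0 < _)]
    refine and_iff_left_of_imp fun h => ?_
    norm_num at *; linarith
  · rw [← o3, and_assoc, and_comm (b := sqDist p farPoint < _)]
    refine and_iff_right_of_imp fun h => ?_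
    norm_num at *; linarith

theorem body_inter_collarOpen {r : ℝ} (hr : r ∈ Icc (0 : ℝ) 1) :
    k.body ∩ k.collarOpen s r = (fun x : ℝ × ℝ => k.collar s x.1 x.2) '' (univ ×ˢ Ico 0 r) := by
  ext p
  rw [mem_body_inter_collarOpen_iff k s hr]
  constructor
  · rintro ⟨t, ht, h⟩
    obtain ⟨θ, rfl⟩ := k.exists_collar s ⟨ht.1, ht.2.le.trans hr.2⟩ h
    exact ⟨(θ, t), ⟨trivial, ht⟩, rfl⟩
  · rintro ⟨⟨θ, t⟩, ⟨-, ht⟩, rfl⟩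
    exact ⟨t, ht, k.sqDist_collar s ⟨ht.1, ht.2.le.trans hr.2⟩⟩

theorem collar_one_mem_body (θ : ℝ) : k.collar s θ 1 ∈ k.body := by
  have hq := k.sqDist_collar s (θ := θ) (t := 1) (by simp)
  have hsum := sqDist_zero_add_farPoint (k.collar s θ 1)
  generalize k.collar s θ 1 = p at *
  cases k <;> cases s <;> simp only [body, center, radius, mem_ofPred_eq] at hq ⊢ <;>
    simp only [hq] at hsum ⊢ <;> norm_num at hsum ⊢ <;> linarith

theorem collar_mem_body (θ : ℝ) {t : ℝ} (ht : t ∈ Icc (0 : ℝ) 1) : k.collar s θ t ∈ k.body := by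
  rcases ht.2.eq_or_lt with rfl | h
  · exact k.collar_one_mem_body s θ
  · have : k.collar s θ t ∈ k.body ∩ k.collarOpen s 1 := by
      rw [k.body_inter_collarOpen s (by simp)]
      exact ⟨(θ, t), ⟨trivial, ht.1, h⟩, rfl⟩
    exact this.1

theorem isClosed_body : IsClosed k.body := by
  have h := fun c => continuous_sqDist c
  cases k
  · exact isClosed_le (h _) continuous_const
  · exact (isClosed_le continuous_const (h _)).inter (isClosed_le (h _) continuous_const)
  · exact isClosed_le continuous_const (h _)
  · exact (isClosed_le continuous_const (h _)).inter (isClosed_le continuous_const (h _))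

theorem isClosed_circle : IsClosed (k.circle s) := by
  rw [circle_eq_sqDist]
  exact isClosed_eq (continuous_sqDist _) continuous_const

theorem isClosed_rim : IsClosed k.rim := (k.isClosed_circle _).union (k.isClosed_circle _)

variable {k}

theorem collar_inner_of_not_twoSided (h : ¬ k.TwoSided) (s s' : Side) :
    k.collar s = k.collar s' := by
  cases k <;> simp only [TwoSided, not_true, not_false_iff] at h <;> cases s <;> cases s' <;> rfl

theorem collar_outer_ne_inner (h : k.TwoSided) {θ t θ' t' : ℝ} (ht : t ∈ Icc (0 : ℝ) 1)
    (ht' : t' ∈ Icc (0 : ℝ) 1) : k.collar .outer θ t ≠ k.collar .inner θ' t' := by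
  intro he
  have h1 := k.sqDist_collar .outer (θ := θ) ht
  have h2 := k.sqDist_collar .inner (θ := θ') ht'
  have hsum := sqDist_zero_add_farPoint (k.collar .outer θ t)
  rw [← he] at h2
  generalize k.collar .outer θ t = p at *
  obtain ⟨a0, a1⟩ := ht
  obtain ⟨b0, b1⟩ := ht'
  cases k <;> simp only [TwoSided, center, radius] at h h1 h2
  · have := h1.symm.trans h2
    nlinarith
  · rw [h1, h2] at hsum
    nlinarith

theorem disjoint_circle_outer_inner (h : k.TwoSided) :
    Disjoint (k.circle .outer) (k.circle .inner) := by
  rw [disjoint_left, circle_eq_range, circle_eq_range]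
  rintro _ ⟨θ, rfl⟩ ⟨θ', h'⟩
  exact collar_outer_ne_inner h (by simp) (by simp) h'.symm

theorem circle_eq_of_not_twoSided (h : ¬ k.TwoSided) (s s' : Side) :
    k.circle s = k.circle s' := by
  simp only [circle_eq_range, collar_inner_of_not_twoSided h s s']

variable (k)

/-- The complement of the open collars in the body of the tile. -/
def core : Set Torus := k.body \ (k.collarOpen .outer 1 ∪ k.collarOpen .inner 1)

theorem isPreconnected_core : IsPreconnected k.core := by
  cases k
  · convert isPreconnected_closedBall_torus (7 / 32) using 1
    ext p
    simp only [core, body, collarOpen, Set.mem_sdiff, mem_union, mem_ofPred_eq, or_self, not_lt]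
    constructor
    · rintro ⟨-, h⟩; norm_num at h ⊢; exact h
    · intro h; norm_num at h ⊢; constructor <;> linarith
  · convert isPreconnected_annulus_torus (r := 5 / 32) (R := 7 / 32) (by norm_num) (by norm_num)
      (by norm_num) using 1
    ext p
    simp only [core, body, collarOpen, Set.mem_sdiff, mem_union, mem_ofPred_eq, not_or, not_lt]
    constructor
    · rintro ⟨-, h, h'⟩; norm_num at h h' ⊢; exact ⟨h', h⟩
    · rintro ⟨h, h'⟩; norm_num at h h' ⊢; refine ⟨⟨?_, ?_⟩, ?_, ?_⟩ <;> linarith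
  -- With `R = 0` the condition at `farPoint` is vacuous: `H⁰` has only one disk removed.
  · convert isPreconnected_compl_balls_torus (r := 9 / 32) (R := 0) (by norm_num) (by norm_num)
      using 1
    ext p
    simp only [core, body, collarOpen, Set.mem_sdiff, mem_union, mem_ofPred_eq, or_self, not_lt]
    have := sqDist_nonneg p farPoint
    constructor
    · rintro ⟨-, h⟩; norm_num at h ⊢; exact ⟨h, this⟩
    · rintro ⟨h, -⟩; norm_num at h ⊢; constructor <;> linarith
  · convert isPreconnected_compl_balls_torus (r := 9 / 32) (R := 9 / 32) (by norm_num) (by norm_num)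
      using 1
    ext p
    simp only [core, body, collarOpen, Set.mem_sdiff, mem_union, mem_ofPred_eq, not_or, not_lt]
    constructor
    · rintro ⟨-, h, h'⟩; norm_num at h h' ⊢; exact ⟨h, h'⟩
    · rintro ⟨h, h'⟩; norm_num at h h' ⊢; refine ⟨⟨?_, ?_⟩, ?_, ?_⟩ <;> linarith

theorem collar_mem_collarOpen_iff {θ t r : ℝ} (ht : t ∈ Icc (0 : ℝ) 1) (hr : r ∈ Icc (0 : ℝ) 1) :
    k.collar s θ t ∈ k.collarOpen s r ↔ t < r := by
  constructor
  · intro h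
    have : k.collar s θ t ∈ k.body ∩ k.collarOpen s r := ⟨k.collar_mem_body s θ ht, h⟩
    rw [k.body_inter_collarOpen s hr] at this
    obtain ⟨⟨θ', t'⟩, ⟨-, h0, h1⟩, h⟩ := this
    have := (k.collar_inj s ht ⟨h0, h1.le.trans hr.2⟩ h.symm).1
    simp only at h1
    linarith
  · intro h
    have : k.collar s θ t ∈ k.body ∩ k.collarOpen s r := by
      rw [k.body_inter_collarOpen s hr]
      exact ⟨(θ, t), ⟨trivial, ht.1, h⟩, rfl⟩
    exact this.2

theorem collar_one_mem_core (θ : ℝ) : k.collar s θ 1 ∈ k.core := by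
  have hmem : (1 : ℝ) ∈ Icc (0 : ℝ) 1 := by simp
  refine ⟨k.collar_one_mem_body s θ, fun h => ?_⟩
  have h' : k.collar s θ 1 ∉ k.collarOpen s 1 := by
    rw [k.collar_mem_collarOpen_iff s hmem hmem]; exact lt_irrefl _
  have main : ∀ s', k.collar s θ 1 ∉ k.collarOpen s' 1 := fun s' h => by
    by_cases h2 : k.TwoSided
    · have : k.collar s θ 1 ∈ k.body ∩ k.collarOpen s' 1 := ⟨k.collar_mem_body s θ hmem, h⟩
      rw [k.body_inter_collarOpen s' hmem] at this
      obtain ⟨⟨θ', t'⟩, ⟨-, h0, h1⟩, h3⟩ := this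
      cases s <;> cases s'
      · exact h' h
      · exact collar_outer_ne_inner h2 hmem ⟨h0, h1.le⟩ h3.symm
      · exact collar_outer_ne_inner h2 ⟨h0, h1.le⟩ hmem h3
      · exact h' h
    · rw [collar_inner_of_not_twoSided h2 s s',
        k.collar_mem_collarOpen_iff s' hmem hmem] at h
      exact lt_irrefl _ h
  exact h.elim (main _) (main _)

theorem body_subset_core_union {p : Torus} (hp : p ∈ k.body) :
    p ∈ k.core ∨ ∃ s θ, ∃ t ∈ Ico (0 : ℝ) 1, p = k.collar s θ t := by
  by_cases h : p ∈ k.collarOpen .outer 1 ∪ k.collarOpen .inner 1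
  · right
    have : ∀ s, p ∈ k.collarOpen s 1 → ∃ θ, ∃ t ∈ Ico (0 : ℝ) 1, p = k.collar s θ t := fun s hs => by
      have : p ∈ k.body ∩ k.collarOpen s 1 := ⟨hp, hs⟩
      rw [k.body_inter_collarOpen s (by simp)] at this
      obtain ⟨⟨θ, t⟩, ⟨-, ht⟩, h⟩ := this
      exact ⟨θ, t, ht, h.symm⟩
    rcases h with h | h
    exacts [⟨_, this _ h⟩, ⟨_, this _ h⟩]
  · exact Or.inl ⟨hp, h⟩

theorem collar_not_mem_core {θ t : ℝ} (ht : t ∈ Ico (0 : ℝ) 1) : k.collar s θ t ∉ k.core := by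
  rintro ⟨-, h⟩
  have := (k.collar_mem_collarOpen_iff s (θ := θ) ⟨ht.1, ht.2.le⟩ (by simp)).2 ht.2
  cases s
  exacts [h (Or.inl this), h (Or.inr this)]

theorem collar_mem_rim (θ : ℝ) : k.collar s θ 0 ∈ k.rim := by
  have : k.collar s θ 0 ∈ k.circle s := by rw [circle_eq_range]; exact ⟨θ, rfl⟩
  cases s
  exacts [Or.inl this, Or.inr this]

theorem rim_eq : k.rim = ⋃ s, k.circle s := by
  ext p
  simp only [rim, mem_union, mem_iUnion]
  constructor
  · rintro (h | h)
    exacts [⟨_, h⟩, ⟨_, h⟩]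
  · rintro ⟨_ | _, h⟩
    exacts [Or.inl h, Or.inr h]

theorem rim_subset_body : k.rim ⊆ k.body := by
  rw [rim_eq]
  simp only [circle_eq_range, iUnion_subset_iff]
  rintro s _ ⟨θ, rfl⟩
  exact k.collar_mem_body s θ (by simp)

theorem collar_mem_circle_iff {θ t : ℝ} (ht : t ∈ Icc (0 : ℝ) 1) :
    k.collar s θ t ∈ k.circle s ↔ t = 0 := by
  constructor
  · rw [circle_eq_range]
    rintro ⟨θ', h⟩
    exact (k.collar_inj s (by simp) ht h).1.symm
  · rintro rfl
    rw [circle_eq_range]; exact ⟨θ, rfl⟩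

/-- Any two boundary circles coincide or have disjoint collars. -/
theorem collar_eq_or_disjoint (s s' : Side) : k.collar s = k.collar s' ∨
    ∀ θ θ' : ℝ, ∀ t ∈ Icc (0 : ℝ) 1, ∀ t' ∈ Icc (0 : ℝ) 1, k.collar s θ t ≠ k.collar s' θ' t' := by
  by_cases h : k.TwoSided
  · cases s <;> cases s'
    · exact Or.inl rfl
    · exact Or.inr fun θ θ' t ht t' ht' => collar_outer_ne_inner h ht ht'
    · exact Or.inr fun θ θ' t ht t' ht' => (collar_outer_ne_inner h ht' ht).symm
    · exact Or.inl rfl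
  · exact Or.inl (collar_inner_of_not_twoSided h s s')

theorem collar_mem_rim_iff {θ t : ℝ} (ht : t ∈ Icc (0 : ℝ) 1) :
    k.collar s θ t ∈ k.rim ↔ t = 0 := by
  constructor
  · rw [rim_eq, mem_iUnion]
    rintro ⟨s', h⟩
    rcases k.collar_eq_or_disjoint s s' with he | hd
    · rw [he] at h
      exact (k.collar_mem_circle_iff s' ht).1 h
    · rw [circle_eq_range] at h
      obtain ⟨θ', h⟩ := h
      exact (hd θ θ' t ht 0 (by simp) h.symm).elim
  · rintro rfl
    exact k.collar_mem_rim s θ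

/-! ### Boxes -/

/-- The part of the collar over the set `I` of angles with depth in `J`. -/
def box (I J : Set ℝ) : Set Torus := (fun x : ℝ × ℝ => k.collar s x.1 x.2) '' (I ×ˢ J)

theorem isCompact_box {I J : Set ℝ} (hI : IsCompact I) (hJ : IsCompact J) :
    IsCompact (k.box s I J) :=
  (hI.prod hJ).image (k.continuous_collar s)

theorem collar_mem_box_iff {α θ t : ℝ} {J : Set ℝ} (hJ : J ⊆ Icc 0 1) (ht : t ∈ Icc (0 : ℝ) 1)
    {I : Set ℝ} (hI : I ⊆ Ico α (α + 1)) (hθ : θ ∈ Ico α (α + 1)) :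
    k.collar s θ t ∈ k.box s I J ↔ θ ∈ I ∧ t ∈ J := by
  constructor
  · rintro ⟨⟨θ', t'⟩, ⟨h1, h2⟩, h⟩
    obtain ⟨rfl, n, hn⟩ := k.collar_inj s (hJ h2) ht h
    have h3 := hI h1
    simp only at h3 hn h1 h2
    have : n = 0 := by
      have a1 : (n : ℝ) < 1 := by linarith [h3.1, hθ.2]
      have a2 : (-1 : ℝ) < n := by linarith [h3.2, hθ.1]
      have a1 : n < 1 := by exact_mod_cast a1
      have a2 : -1 < n := by exact_mod_cast a2
      omega
    subst this
    simp at hn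
    subst hn
    exact ⟨h1, h2⟩
  · rintro ⟨h1, h2⟩
    exact ⟨(θ, t), ⟨h1, h2⟩, rfl⟩

theorem exists_int_shift (α θ : ℝ) : ∃ n : ℤ, θ + n ∈ Ico α (α + 1) := by
  refine ⟨-⌊θ - α⌋, ?_, ?_⟩ <;> push_cast
  · linarith [Int.floor_le (θ - α)]
  · linarith [Int.lt_floor_add_one (θ - α)]

/-- Open boxes are relatively open in the body of the tile. -/
theorem exists_isOpen_box {α β r : ℝ} (hβ : β < α + 1) (hr0 : 0 ≤ r) (hr : r ≤ 1) :
    ∃ O, IsOpen O ∧ k.body ∩ O = k.box s (Ioo α β) (Ico 0 r) := by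
  -- Removing the compact part of the collar over `[β, α + 1]` leaves, modulo integers, exactly the
  -- angles in `(α, β)`.
  refine ⟨k.collarOpen s r ∩ (k.box s (Icc β (α + 1)) (Icc 0 1))ᶜ,
    (k.isOpen_collarOpen s r).inter (k.isCompact_box s isCompact_Icc isCompact_Icc).isClosed.isOpen_compl,
    ?_⟩
  rw [← inter_assoc, k.body_inter_collarOpen s ⟨hr0, hr⟩]
  ext p
  constructor
  · rintro ⟨⟨⟨θ, t⟩, ⟨-, ht⟩, rfl⟩, h⟩
    simp only at ht h ⊢
    obtain ⟨n, hn⟩ := exists_int_shift α θ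
    rw [← k.collar_add_int s θ t n] at h ⊢
    refine ⟨(θ + n, t), ⟨⟨?_, ?_⟩, ht⟩, rfl⟩
    · refine hn.1.lt_of_ne fun he => h ?_
      refine ⟨(θ + n + 1, t), ⟨⟨?_, ?_⟩, ht.1, ht.2.le.trans hr⟩, ?_⟩
      · simp only; linarith
      · simp only; linarith
      · simpa using k.collar_add_int s (θ + n) t 1
    · by_contra hc
      exact h ⟨(θ + n, t), ⟨⟨not_lt.1 hc, hn.2.le⟩, ht.1, ht.2.le.trans hr⟩, rfl⟩
  · rintro ⟨⟨θ, t⟩, ⟨hθ, ht⟩, rfl⟩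
    simp only at hθ ht ⊢
    refine ⟨⟨(θ, t), ⟨trivial, ht⟩, rfl⟩, ?_⟩
    rintro ⟨⟨θ', t'⟩, ⟨h1, h2⟩, h⟩
    obtain ⟨-, n, hn⟩ := k.collar_inj s h2 ⟨ht.1, ht.2.le.trans hr⟩ h
    simp only at h1 hn
    have a1 : (n : ℝ) < 0 := by linarith [h1.1, hθ.2]
    have a2 : (-1 : ℝ) < n := by linarith [h1.2, hθ.1]
    have a1 : n < 0 := by exact_mod_cast a1
    have a2 : -1 < n := by exact_mod_cast a2
    omega

end TileKind

/-! ### A characterization of the Cantor set -/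

section Cantor

variable {S : Type*} [TopologicalSpace S]

/-- A nonempty clopen set of a space without isolated points can be cut into two nonempty clopen
pieces, each of which lies on one side of a given clopen set. -/
theorem exists_clopen_splitting (hperf : ∀ x : S, ¬ IsOpen {x}) (U : ℕ → Set S)
    (hU : ∀ n, IsClopen (U n)) (hsep : ∀ x y, x ≠ y → ∃ n, x ∈ U n ∧ y ∉ U n) (n : ℕ) (A : Set S)
    (hA : IsClopen A) (hne : A.Nonempty) :
    ∃ B : Bool → Set S, (∀ b, IsClopen (B b) ∧ (B b).Nonempty ∧ (B b ⊆ U n ∨ Disjoint (B b) (U n))) ∧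
      (∀ x, x ∈ A ↔ ∃ b, x ∈ B b) ∧ Disjoint (B false) (B true) := by
  have cut : ∀ m, (A ∩ U m).Nonempty → (A \ U m).Nonempty →
      ((A ∩ U m ⊆ U n ∨ Disjoint (A ∩ U m) (U n)) ∧ (A \ U m ⊆ U n ∨ Disjoint (A \ U m) (U n))) →
      ∃ B : Bool → Set S,
        (∀ b, IsClopen (B b) ∧ (B b).Nonempty ∧ (B b ⊆ U n ∨ Disjoint (B b) (U n))) ∧
        (∀ x, x ∈ A ↔ ∃ b, x ∈ B b) ∧ Disjoint (B false) (B true) := by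
    intro m h1 h2 h3
    refine ⟨fun b => if b then A ∩ U m else A \ U m, ?_, ?_, ?_⟩
    · rintro (_ | _)
      · exact ⟨hA.diff (hU m), h2, h3.2⟩
      · exact ⟨hA.inter (hU m), h1, h3.1⟩
    · intro x
      simp only [Bool.exists_bool, Bool.false_eq_true, if_false, if_true, Set.mem_sdiff, mem_inter_iff]
      tauto
    · simp only [Bool.false_eq_true, if_false, if_true]
      exact disjoint_sdiff_inter
  by_cases hn : (A ∩ U n).Nonempty ∧ (A \ U n).Nonempty
  · exact cut n hn.1 hn.2 ⟨Or.inl inter_subset_right, Or.inr disjoint_sdiff_left⟩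
  · have hAn : A ⊆ U n ∨ Disjoint A (U n) := by
      by_cases h : (A ∩ U n).Nonempty
      · left
        intro x hx
        by_contra hc
        exact hn ⟨h, x, hx, hc⟩
      · right
        rwa [disjoint_iff_inter_eq_empty, ← not_nonempty_iff_eq_empty]
    -- Now `A` lies on one side of `U n`, so any cut will do: `A` is not a single point, and some `U
    -- m` separates two of its points.
    obtain ⟨x, hx⟩ := hne
    obtain ⟨y, hy, hyx⟩ : ∃ y ∈ A, y ≠ x := by
      by_contra! h
      refine hperf x ?_
      convert hA.isOpen using 1
      ext z
      exact ⟨fun hz => by rw [mem_singleton_iff.1 hz]; exact hx, fun hz => h z hz⟩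
    obtain ⟨m, hm, hm'⟩ := hsep y x hyx
    refine cut m ⟨y, hy, hm⟩ ⟨x, hx, hm'⟩ ⟨?_, ?_⟩
    · exact hAn.imp (fun h => inter_subset_left.trans h) fun h => h.mono_left inter_subset_left
    · exact hAn.imp (fun h => sdiff_subset.trans h) fun h => h.mono_left sdiff_subset

/-- Brouwer's characterization of the Cantor set. -/
theorem nonempty_homeomorph_cantor [CompactSpace S] [Nonempty S]
    (hperf : ∀ x : S, ¬ IsOpen {x}) (U : ℕ → Set S)
    (hU : ∀ n, IsClopen (U n)) (hsep : ∀ x y, x ≠ y → ∃ n, x ∈ U n ∧ y ∉ U n) :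
    Nonempty (S ≃ₜ (ℕ → Bool)) := by
  choose! B hB1 hB2 hB3 using exists_clopen_splitting hperf U hU hsep
  -- `C n x` is the cell with address `x`, depending only on the first `n` letters. A cell of level
  -- `n + 1` lies on one side of `U n`, so an infinite address determines at most one point;
  -- compactness provides one.
  let C : ℕ → (ℕ → Bool) → Set S := fun n x => Nat.rec univ (fun m A => B m A (x m)) n
  have C0 : ∀ x, C 0 x = univ := fun x => rfl
  have CS : ∀ n x, C (n + 1) x = B n (C n x) (x n) := fun n x => rfl
  have hC : ∀ n x, IsClopen (C n x) ∧ (C n x).Nonempty := by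
    intro n x
    induction n with
    | zero => exact ⟨isClopen_univ, univ_nonempty⟩
    | succ n ih => exact ⟨(hB1 n _ ih.1 ih.2 _).1, (hB1 n _ ih.1 ih.2 _).2.1⟩
  have hanti : ∀ n x, C (n + 1) x ⊆ C n x := fun n x s hs =>
    (hB2 n _ (hC n x).1 (hC n x).2 s).2 ⟨_, hs⟩
  have hcongr : ∀ n x y, (∀ i < n, x i = y i) → C n x = C n y := by
    intro n x y
    induction n with
    | zero => exact fun _ => rfl
    | succ n ih =>
      intro h
      rw [CS, CS, ih fun i hi => h i (hi.trans n.lt_succ_self), h n n.lt_succ_self]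
  have hagree : ∀ n x y s, s ∈ C n x → s ∈ C n y → ∀ i < n, x i = y i := by
    intro n x y s
    induction n with
    | zero => exact fun _ _ i hi => absurd hi (Nat.not_lt_zero i)
    | succ n ih =>
      intro hx hy i hi
      have h := ih (hanti n x hx) (hanti n y hy)
      rcases Nat.lt_succ_iff_lt_or_eq.1 hi with hi | rfl
      · exact h i hi
      · rw [CS] at hx hy
        rw [hcongr i x y h] at hx
        have hd := hB3 i _ (hC i y).1 (hC i y).2
        cases hxi : x i <;> cases hyi : y i <;> rw [hxi] at hx <;> rw [hyi] at hy
        · exact (disjoint_left.1 hd hx hy).elim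
        · exact (disjoint_left.1 hd hy hx).elim
  have hcode : ∀ s, ∃ x, ∀ n, s ∈ C n x := by
    intro s
    have step : ∀ n (x : ℕ → Bool), s ∈ C n x → ∃ b, s ∈ B n (C n x) b := fun n x hx =>
      (hB2 n _ (hC n x).1 (hC n x).2 s).1 hx
    choose! β hβ using step
    -- The address of `s` is found letter by letter: `y n` is right in its first `n` letters, and `y
    -- (n + 1)` keeps them.
    let y : ℕ → (ℕ → Bool) := fun n => Nat.rec (fun _ => false)
      (fun m z => fun i => if i < m then z i else β m z) n
    have yS : ∀ n i, y (n + 1) i = if i < n then y n i else β n (y n) := fun n i => rfl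
    have hy : ∀ n, s ∈ C n (y n) := by
      intro n
      induction n with
      | zero => trivial
      | succ n ih =>
        rw [CS, hcongr n (y (n + 1)) (y n) fun i hi => by rw [yS, if_pos hi], yS,
          if_neg (lt_irrefl n)]
        exact hβ n _ ih
    have hst : ∀ i n, i < n → y n i = y (i + 1) i := by
      intro i n hin
      induction n with
      | zero => exact absurd hin (Nat.not_lt_zero i)
      | succ n ih =>
        rcases Nat.lt_succ_iff_lt_or_eq.1 hin with h | rfl
        · rw [yS, if_pos h, ih h]
        · rfl
    refine ⟨fun i => y (i + 1) i, fun n => ?_⟩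
    rw [hcongr n _ (y n) fun i hi => (hst i n hi).symm]
    exact hy n
  choose c hc using hcode
  have hcont : Continuous c := by
    rw [continuous_pi_iff]
    intro i
    rw [continuous_iff_continuousAt]
    intro s
    have : C (i + 1) (c s) ∈ 𝓝 s := (hC (i + 1) _).1.isOpen.mem_nhds (hc s (i + 1))
    refine (continuousAt_const (y := c s i)).congr ?_
    filter_upwards [this] with t ht
    exact hagree (i + 1) _ _ t ht (hc t (i + 1)) i i.lt_succ_self
  have hinj : Function.Injective c := by
    intro s t hst
    by_contra hne
    obtain ⟨n, h1, h2⟩ := hsep s t hne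
    have hs := hc s (n + 1)
    have ht := hc t (n + 1)
    rw [← hst] at ht
    rcases (hB1 n _ (hC n (c s)).1 (hC n (c s)).2 (c s n)).2.2 with h | h
    · exact h2 (h ht)
    · exact disjoint_left.1 h hs h1
  have hsurj : Function.Surjective c := by
    intro x
    obtain ⟨s, hs⟩ := IsCompact.nonempty_iInter_of_sequence_nonempty_isCompact_isClosed
      (fun n => C n x) (fun n => hanti n x) (fun n => (hC n x).2) (hC 0 x).1.isClosed.isCompact
      fun n => (hC n x).1.isClosed
    rw [mem_iInter] at hs
    exact ⟨s, funext fun i => hagree (i + 1) _ _ s (hc s (i + 1)) (hs (i + 1)) i i.lt_succ_self⟩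
  exact ⟨Continuous.homeoOfEquivCompactToT2 (f := Equiv.ofBijective c ⟨hinj, hsurj⟩) hcont⟩

/-- A continuous image of a compact second countable space is a Cantor set if its points
are separated by clopen sets and it has no isolated points. -/
theorem isCantorSet_range {X E : Type} [TopologicalSpace X] [CompactSpace X] [T2Space X]
    [TotallyDisconnectedSpace X] [SecondCountableTopology X] [Nonempty X] [TopologicalSpace E] {Φ : X → E} (hΦ : Continuous Φ)
    (hsep : ∀ x y : E, x ≠ y → ∃ V, IsClopen V ∧ x ∈ V ∧ y ∉ V)
    (hperf : ∀ x : X, ∀ V, IsOpen V → Φ x ∈ V → ∃ y, Φ y ∈ V ∧ Φ y ≠ Φ x) :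
    IsCantorSet (range Φ) := by
  have : CompactSpace (range Φ) := isCompact_iff_compactSpace.1 (isCompact_range hΦ)
  have : Nonempty (range Φ) := inferInstance
  -- The Stone space `X` has countably many clopen sets, and taking preimages embeds the clopen sets
  -- of the image among them. So the image has a sequence of clopen sets separating its points.
  have : Countable (Clopens X) := Clopens.countable_iff_secondCountable.2 inferInstance
  let pb : Clopens (range Φ) → Clopens X := fun V =>
    ⟨rangeFactorization Φ ⁻¹' V, V.isClopen.preimage hΦ.rangeFactorization⟩
  have hpb : Function.Injective pb := by
    intro V W h
    have h' : rangeFactorization Φ ⁻¹' (V : Set (range Φ)) = rangeFactorization Φ ⁻¹' W :=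
      congrArg (fun Z : Clopens X => (Z : Set X)) h
    exact Clopens.ext ((rangeFactorization_surjective.preimage_injective) h')
  have : Countable (Clopens (range Φ)) := hpb.countable
  obtain ⟨U, hU⟩ := exists_surjective_nat (Clopens (range Φ))
  refine nonempty_homeomorph_cantor ?_ (fun n => (U n : Set (range Φ))) (fun n => (U n).isClopen) ?_
  · rintro ⟨_, x, rfl⟩ ho
    obtain ⟨V, hV, hV'⟩ := isOpen_induced_iff.1 ho
    have hx : Φ x ∈ V := by
      have : (⟨Φ x, x, rfl⟩ : range Φ) ∈ Subtype.val ⁻¹' V := by rw [hV']; rfl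
      exact this
    obtain ⟨y, hy, hne⟩ := hperf x V hV hx
    have : (⟨Φ y, y, rfl⟩ : range Φ) ∈ Subtype.val ⁻¹' V := hy
    rw [hV'] at this
    exact hne (congrArg Subtype.val (mem_singleton_iff.1 this))
  · intro x y hxy
    obtain ⟨V, hV, h1, h2⟩ := hsep x y fun h => hxy (Subtype.ext h)
    obtain ⟨n, hn⟩ := hU ⟨Subtype.val ⁻¹' V, hV.preimage continuous_subtype_val⟩
    exact ⟨n, by simp only [hn]; exact h1, by simp only [hn]; exact h2⟩

end Cantor

/-! ### Perfectness of the Cantor space and Cantor functions -/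

/-- Changing the `n`-th letter only gives points different from `x` that tend to `x`. -/
theorem nhdsNE_neBot_cantor (x : ℕ → Bool) : (𝓝[≠] x).NeBot := by
  have h : Tendsto (fun n => Function.update x n (!x n)) atTop (𝓝[≠] x) := by
    refine tendsto_nhdsWithin_iff.2 ⟨tendsto_pi_nhds.2 fun i => ?_, Eventually.of_forall fun n hn => ?_⟩
    · refine tendsto_const_nhds.congr' ?_
      filter_upwards [eventually_gt_atTop i] with n hn
      rw [Function.update_of_ne hn.ne]
    · have := congrFun (mem_singleton_iff.1 hn) n
      simp at this
  exact h.neBot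

/-- The Cantor function of a Cantor subset of the line. -/
theorem exists_staircase {ρ : (ℕ → Bool) → ℝ} (hρ : Continuous ρ) (hi : Function.Injective ρ) :
    ∃ G : ℝ → ℝ, Continuous G ∧ Monotone G ∧
      ∀ x y, x < y → (G x = G y ↔ Disjoint (Ioo x y) (range ρ)) := by
  -- As a compact nondiscrete group, `(ℤ/2)^ℕ` has a Haar measure which is finite, has no atoms and
  -- is positive on nonempty open sets. `G` is the distribution function of its image on the line:
  -- no atoms means continuity, and full support means that `G` increases across every interval
  -- meeting the Cantor set.
  let Γ := ℕ → ZMod 2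
  let : MeasurableSpace Γ := borel Γ
  have : BorelSpace Γ := ⟨rfl⟩
  let e : Γ → (ℕ → Bool) := fun x n => decide (x n = 1)
  have he : Continuous e := continuous_pi fun n =>
    (continuous_of_discreteTopology (f := fun z : ZMod 2 => decide (z = 1))).comp (continuous_apply n)
  have hei : Function.Injective e := by
    intro x y h
    funext n
    have := congrFun h n
    simp only [e, decide_eq_decide] at this
    generalize x n = a at *; generalize y n = b at *
    revert a b; decide
  have hes : Function.Surjective e := fun z =>
    ⟨fun n => if z n then 1 else 0, funext fun n => by cases h : z n <;> simp [e, h]⟩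
  have : (𝓝[≠] (0 : Γ)).NeBot := by
    have h : Tendsto (fun n : ℕ => (Pi.single n 1 : Γ)) atTop (𝓝[≠] 0) := by
      refine tendsto_nhdsWithin_iff.2
        ⟨tendsto_pi_nhds.2 fun i => ?_, Eventually.of_forall fun n hn => ?_⟩
      · refine tendsto_const_nhds.congr' ?_
        filter_upwards [eventually_gt_atTop i] with n hn
        rw [Pi.single_eq_of_ne hn.ne, Pi.zero_apply]
      · have := congrFun (mem_singleton_iff.1 hn) n
        simp at this
    exact h.neBot
  let μ : MeasureTheory.Measure Γ := MeasureTheory.Measure.addHaar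
  have : μ.IsAddHaarMeasure := inferInstance
  have : MeasureTheory.IsFiniteMeasure μ := ⟨isCompact_univ.measure_lt_top⟩
  have hg : Continuous (ρ ∘ e) := hρ.comp he
  have hgi : Function.Injective (ρ ∘ e) := hi.comp hei
  have hrange : range (ρ ∘ e) = range ρ := hes.range_comp ρ
  let m : MeasureTheory.Measure ℝ := μ.map (ρ ∘ e)
  have : MeasureTheory.IsFiniteMeasure m := inferInstance
  have : MeasureTheory.NullSingletonClass m := ⟨fun x => by
    rw [MeasureTheory.Measure.map_apply hg.measurable (measurableSet_singleton x)]
    exact (subsingleton_singleton.preimage hgi).measure_zero μ⟩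
  have hint : ∀ a b, IntervalIntegrable (fun _ => (1 : ℝ)) m a b := fun a b =>
    intervalIntegrable_const
  have hsub : ∀ x y, (∫ _ in (0 : ℝ)..y, (1 : ℝ) ∂m) - ∫ _ in (0 : ℝ)..x, (1 : ℝ) ∂m =
      ∫ _ in x..y, (1 : ℝ) ∂m := fun x y =>
    intervalIntegral.integral_interval_sub_left (hint _ _) (hint _ _)
  have hval : ∀ x y, x ≤ y → ∫ _ in x..y, (1 : ℝ) ∂m = m.real (Ioc x y) := fun x y h => by
    rw [intervalIntegral.integral_of_le h]
    simp
  refine ⟨fun x => ∫ _ in (0 : ℝ)..x, (1 : ℝ) ∂m,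
    intervalIntegral.continuous_primitive hint 0, fun x y h => ?_, fun x y h => ?_⟩
  · have := hsub x y
    rw [hval x y h] at this
    have h0 : 0 ≤ m.real (Ioc x y) := MeasureTheory.measureReal_nonneg
    simp only; linarith
  · have h1 := hsub x y
    rw [hval x y h.le] at h1
    have h2 : m.real (Ioc x y) = 0 ↔ m (Ioo x y) = 0 := by
      rw [MeasureTheory.measureReal_eq_zero_iff, MeasureTheory.measure_congr
        (MeasureTheory.Ioo_ae_eq_Ioc (μ := m)).symm]
    have h3 : m (Ioo x y) = 0 ↔ Disjoint (Ioo x y) (range ρ) := by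
      rw [MeasureTheory.Measure.map_apply hg.measurable measurableSet_Ioo,
        (isOpen_Ioo.preimage hg).measure_eq_zero_iff μ, preimage_eq_empty_iff, hrange]
    rw [← h3, ← h2, ← h1, sub_eq_zero, eq_comm]

/-! ### Parametrizations of open intervals -/

/-- A continuous injection of the line into itself is strictly monotone, and its limits are the
bounds of its range. -/
theorem homeomorph_Ioo_ends {a b : ℝ} (l : ℝ ≃ₜ Ioo a b) :
    (StrictMono (fun t => (l t : ℝ)) ∧ Tendsto (fun t => (l t : ℝ)) atBot (𝓝 a) ∧
      Tendsto (fun t => (l t : ℝ)) atTop (𝓝 b)) ∨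
    (StrictAnti (fun t => (l t : ℝ)) ∧ Tendsto (fun t => (l t : ℝ)) atBot (𝓝 b) ∧
      Tendsto (fun t => (l t : ℝ)) atTop (𝓝 a)) := by
  have hc : Continuous fun t => (l t : ℝ) := continuous_subtype_val.comp l.continuous
  have hi : Function.Injective fun t => (l t : ℝ) := Subtype.val_injective.comp l.injective
  have hr : range (fun t => (l t : ℝ)) = Ioo a b := by
    have : (fun t => (l t : ℝ)) = Subtype.val ∘ l := rfl
    rw [this, l.surjective.range_comp, Subtype.range_coe]
  have hab : a < b := by
    have := (l 0).2
    exact this.1.trans this.2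
  have hL : IsLUB (range fun t => (l t : ℝ)) b := by rw [hr]; exact isLUB_Ioo hab
  have hG : IsGLB (range fun t => (l t : ℝ)) a := by rw [hr]; exact isGLB_Ioo hab
  rcases hc.strictMono_of_inj hi with h | h
  · exact Or.inl ⟨h, tendsto_atBot_isGLB h.monotone hG, tendsto_atTop_isLUB h.monotone hL⟩
  · exact Or.inr ⟨h, tendsto_atBot_isLUB h.antitone hL, tendsto_atTop_isGLB h.antitone hG⟩

theorem nonempty_homeomorph_Ioo {a b : ℝ} (h : a < b) : Nonempty (ℝ ≃ₜ Ioo a b) := by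
  let f := OpenPartialHomeomorph.univBall ((a + b) / 2) ((b - a) / 2)
  have hs : f.source = univ := OpenPartialHomeomorph.univBall_source _ _
  have ht : f.target = Ioo a b := by
    rw [OpenPartialHomeomorph.univBall_target _ (by linarith), Real.ball_eq_Ioo]
    congr 1 <;> ring
  exact ⟨(Homeomorph.Set.univ ℝ).symm.trans ((Homeomorph.setCongr hs.symm).trans
    (f.toHomeomorphSourceTarget.trans (Homeomorph.setCongr ht)))⟩

/-! ### Ends -/

section Ends

variable {X : Type} [TopologicalSpace X]

/-- The filter `l` converges to the end `e`. -/
def EndLim (l : Filter X) (e : Ends X) : Prop := ∀ K : Compacts X, e.comp K ∈ l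

theorem convergesToEnd_iff {α : Type} {g : α → X} {l : Filter α} {e : Ends X} :
    ConvergesToEnd g l e ↔ EndLim (map g l) e := Iff.rfl

theorem EndLim.mono {l l' : Filter X} {e : Ends X} (h : EndLim l e) (hl : l' ≤ l) : EndLim l' e :=
  fun K => hl (h K)

namespace Ends

theorem comp_subset (e : Ends X) (K : Compacts X) : e.comp K ⊆ (K : Set X)ᶜ := by
  obtain ⟨x, -, h⟩ := e.isComp K
  rw [h]
  exact connectedComponentIn_subset _ _

theorem isPreconnected_comp (e : Ends X) (K : Compacts X) : IsPreconnected (e.comp K) := by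
  obtain ⟨x, -, h⟩ := e.isComp K
  rw [h]
  exact isPreconnected_connectedComponentIn

/-- A connected subset of the complement of `K` that meets `e.comp K` is contained in it. -/
theorem subset_comp (e : Ends X) {K : Compacts X} {Z : Set X} (hZ : IsPreconnected Z)
    (hZK : Z ⊆ (K : Set X)ᶜ) (h : (e.comp K ∩ Z).Nonempty) : Z ⊆ e.comp K := by
  obtain ⟨x, hx, hC⟩ := e.isComp K
  obtain ⟨y, hy, hyZ⟩ := h
  rw [hC] at hy ⊢
  rw [connectedComponentIn_eq hy]
  exact hZ.subset_connectedComponentIn hyZ hZK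

theorem comp_eq_of_nonempty (e e' : Ends X) {K : Compacts X} (h : (e.comp K ∩ e'.comp K).Nonempty) :
    e.comp K = e'.comp K :=
  Subset.antisymm (e'.subset_comp (e.isPreconnected_comp K) (e.comp_subset K) (inter_comm _ _ ▸ h))
    (e.subset_comp (e'.isPreconnected_comp K) (e'.comp_subset K) h)

theorem comp_eq_of_connected (e e' : Ends X) {K : Compacts X} {Z : Set X} (hZ : IsPreconnected Z)
    (hZK : Z ⊆ (K : Set X)ᶜ) (h : (e.comp K ∩ Z).Nonempty) (h' : (e'.comp K ∩ Z).Nonempty) :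
    e.comp K = e'.comp K := by
  obtain ⟨x, hx, hxZ⟩ := h'
  exact e.comp_eq_of_nonempty e' ⟨x, e.subset_comp hZ hZK h hxZ, hx⟩

/-- For fixed `K` these sets are open by definition of the topology and form a partition as `C`
varies, so each of them is also closed. -/
theorem isClopen_comp_eq (K : Compacts X) (C : Set X) : IsClopen {e : Ends X | e.comp K = C} := by
  have ho : ∀ C, IsOpen {e : Ends X | e.comp K = C} := fun C =>
    isOpen_generateFrom_of_mem ⟨K, C, rfl⟩
  refine ⟨⟨?_⟩, ho C⟩
  have : {e : Ends X | e.comp K = C}ᶜ = ⋃ C' ∈ {C' | C' ≠ C}, {e : Ends X | e.comp K = C'} := by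
    ext e; simp
  rw [this]
  exact isOpen_biUnion fun C' _ => ho C'

theorem exists_clopen (e e' : Ends X) (h : e ≠ e') : ∃ V, IsClopen V ∧ e ∈ V ∧ e' ∉ V := by
  obtain ⟨K, hK⟩ : ∃ K, e'.comp K ≠ e.comp K := by
    by_contra! h'
    exact h (Ends.ext (funext fun K => (h' K).symm))
  exact ⟨_, isClopen_comp_eq K (e.comp K), rfl, hK⟩

instance : T2Space (Ends X) := ⟨fun e e' h => by
  obtain ⟨V, hV, h1, h2⟩ := exists_clopen e e' h
  exact ⟨V, Vᶜ, hV.isOpen, hV.compl.isOpen, h1, h2, disjoint_compl_right⟩⟩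

theorem tendsto_iff {Y : Type*} {l : Filter Y} {f : Y → Ends X} {e : Ends X} :
    Tendsto f l (𝓝 e) ↔ ∀ K, ∀ᶠ z in l, (f z).comp K = e.comp K := by
  constructor
  · intro h K
    exact h ((isClopen_comp_eq K _).isOpen.mem_nhds rfl)
  · intro h
    rw [tendsto_nhds_generateFrom_iff]
    rintro _ ⟨K, C, rfl⟩ hC
    filter_upwards [h K] with z hz
    show (f z).comp K = C
    rw [hz]; exact hC

theorem continuousAt_iff {Y : Type*} [TopologicalSpace Y] {f : Y → Ends X} {y : Y} :
    ContinuousAt f y ↔ ∀ K, ∀ᶠ z in 𝓝 y, (f z).comp K = (f y).comp K := tendsto_iff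

/-- The connected set `Z K` selects a component of the complement of `K`; the selections are
compatible because two members of the proper filter `l` always meet. -/
theorem exists_endLim {l : Filter X} [l.NeBot]
    (h : ∀ K : Compacts X, ∃ Z ∈ l, IsPreconnected Z ∧ Z ⊆ (K : Set X)ᶜ) : ∃ e, EndLim l e := by
  choose Z hZ hc hK using h
  have hne : ∀ K, (Z K).Nonempty := fun K => l.nonempty_of_mem (hZ K)
  choose z hz using hne
  have hsub : ∀ K, Z K ⊆ connectedComponentIn (K : Set X)ᶜ (z K) := fun K =>
    (hc K).subset_connectedComponentIn (hz K) (hK K)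
  refine ⟨⟨fun K => connectedComponentIn (K : Set X)ᶜ (z K), fun K => ⟨z K, hK K (hz K), rfl⟩, ?_⟩,
    fun K => mem_of_superset (hZ K) (hsub K)⟩
  intro K L hKL
  obtain ⟨y, hy1, hy2⟩ := l.nonempty_of_mem (inter_mem (hZ K) (hZ L))
  rw [connectedComponentIn_eq (hsub K hy1)]
  exact isPreconnected_connectedComponentIn.subset_connectedComponentIn (hsub L hy2)
    ((connectedComponentIn_subset _ _).trans (compl_subset_compl.2 hKL))

theorem eq_of_endLim {l : Filter X} [l.NeBot] {e e' : Ends X} (h : EndLim l e) (h' : EndLim l e') :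
    e = e' :=
  Ends.ext (funext fun K =>
    e.comp_eq_of_nonempty e' (l.nonempty_of_mem (inter_mem (h K) (h' K))))

/-- If the complement of `K` is cut into two open pieces, ends in different pieces are separated
by `K`. -/
theorem comp_ne_of_separation {l l' : Filter X} [l.NeBot] [l'.NeBot] {e e' : Ends X}
    (h : EndLim l e) (h' : EndLim l' e') {K : Compacts X} {A B : Set X} (hA : IsOpen A) (hB : IsOpen B)
    (hAB : Disjoint A B) (hK : (K : Set X)ᶜ ⊆ A ∪ B) (hl : A ∈ l) (hl' : B ∈ l') :
    e.comp K ≠ e'.comp K := by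
  intro he
  obtain ⟨x, hx, hxA⟩ := l.nonempty_of_mem (inter_mem (h K) hl)
  obtain ⟨y, hy, hyB⟩ := l'.nonempty_of_mem (inter_mem (h' K) hl')
  rw [← he] at hy
  obtain ⟨z, -, hz1, hz2⟩ := e.isPreconnected_comp K A B hA hB ((e.comp_subset K).trans hK)
    ⟨x, hx, hxA⟩ ⟨y, hy, hyB⟩
  exact disjoint_left.1 hAB hz1 hz2

end Ends

end Ends

/-! ### Cantor subsets of the rim of a tile -/

theorem isCompact_of_isCantorSet {X : Type} [TopologicalSpace X] {S : Set X} (h : IsCantorSet S) :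
    IsCompact S := by
  obtain ⟨f⟩ := h
  rw [isCompact_iff_compactSpace]
  exact f.symm.compactSpace

theorem infinite_inter_of_isCantorSet {X : Type} [TopologicalSpace X] {S O : Set X}
    (h : IsCantorSet S) (hO : IsOpen O) {x : X} (hx : x ∈ S) (hxO : x ∈ O) : (S ∩ O).Infinite := by
  obtain ⟨f⟩ := h
  have := nhdsNE_neBot_cantor (f ⟨x, hx⟩)
  have hmem : f.symm ⁻¹' (Subtype.val ⁻¹' O) ∈ 𝓝 (f ⟨x, hx⟩) :=
    ((hO.preimage continuous_subtype_val).preimage f.symm.continuous).mem_nhds (by simpa using hxO)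
  have hinf := infinite_of_mem_nhds _ hmem
  refine (hinf.image (f := fun z => (f.symm z : X))
    (Subtype.val_injective.comp f.symm.injective).injOn).mono ?_
  rintro _ ⟨z, hz, rfl⟩
  exact ⟨(f.symm z).2, hz⟩

theorem subsingleton_of_subset_isCantorSet {X : Type} [TopologicalSpace X] {S Z : Set X}
    (h : IsCantorSet S) (hZ : IsPreconnected Z) (hZS : Z ⊆ S) : Z.Subsingleton := by
  obtain ⟨f⟩ := h
  have : IsPreconnected (f '' (Subtype.val ⁻¹' Z)) := by
    refine IsPreconnected.image ?_ _ f.continuous.continuousOn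
    rwa [← IsInducing.subtypeVal.isPreconnected_image, Subtype.image_preimage_coe,
      inter_eq_right.2 hZS]
  have := this.subsingleton
  intro x hx y hy
  have := this ⟨⟨x, hZS hx⟩, hx, rfl⟩ ⟨⟨y, hZS hy⟩, hy, rfl⟩
  exact congrArg Subtype.val (f.injective this)

namespace TileKind

/-- The part of a boundary circle over a set of angles. -/
def arc (k : TileKind) (s : Side) (I : Set ℝ) : Set Torus := (fun θ => k.collar s θ 0) '' I

/-- The angles of the points of a boundary circle belonging to `K`. -/
def angles (k : TileKind) (K : Set Torus) (s : Side) : Set ℝ := {θ | k.collar s θ 0 ∈ K}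

/-- The interval `(a, b)` parametrizes a component of the complement of `K` in a boundary circle. -/
structure IsGap (k : TileKind) (K : Set Torus) (s : Side) (a b : ℝ) : Prop where
  lt : a < b
  lt_add_one : b < a + 1
  left_mem : a ∈ k.angles K s
  right_mem : b ∈ k.angles K s
  disj : ∀ x ∈ Ioo a b, x ∉ k.angles K s

variable {k : TileKind} {s : Side}

theorem mem_arc_of_mem_rim {I J : Set ℝ} (hJ : J ⊆ Icc 0 1) {p : Torus} (hp : p ∈ k.rim)
    (h : p ∈ k.box s I J) : p ∈ k.arc s I := by
  obtain ⟨⟨θ, t⟩, ⟨h1, h2⟩, rfl⟩ := h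
  have := (k.collar_mem_rim_iff s (hJ h2)).1 hp
  simp only at this ⊢
  subst this
  exact ⟨θ, h1, rfl⟩

theorem arc_subset_box {I J : Set ℝ} (h0 : (0 : ℝ) ∈ J) : k.arc s I ⊆ k.box s I J := by
  rintro _ ⟨θ, h, rfl⟩
  exact ⟨(θ, 0), ⟨h, h0⟩, rfl⟩

theorem arc_mono {I J : Set ℝ} (h : I ⊆ J) : k.arc s I ⊆ k.arc s J := image_mono h

theorem arc_subset_circle (I : Set ℝ) : k.arc s I ⊆ k.circle s := by
  rw [circle_eq_range]; exact image_subset_range _ _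

theorem arc_univ : k.arc s univ = k.circle s := by rw [arc, image_univ, circle_eq_range]

theorem circle_subset_rim : k.circle s ⊆ k.rim := by
  cases s
  exacts [subset_union_left, subset_union_right]

theorem mem_arc_iff {α θ : ℝ} {I : Set ℝ} (hI : I ⊆ Ico α (α + 1)) (hθ : θ ∈ Ico α (α + 1)) :
    k.collar s θ 0 ∈ k.arc s I ↔ θ ∈ I := by
  constructor
  · intro h
    exact ((k.collar_mem_box_iff s (J := {0}) (by simp) (by simp) hI hθ).1
      (arc_subset_box (mem_singleton _) h)).1
  · intro h
    exact ⟨θ, h, rfl⟩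

theorem isCompact_arc {I : Set ℝ} (h : IsCompact I) : IsCompact (k.arc s I) :=
  h.image (k.continuous_collar_left s 0)

theorem isPreconnected_arc {I : Set ℝ} (h : IsPreconnected I) : IsPreconnected (k.arc s I) :=
  h.image _ (k.continuous_collar_left s 0).continuousOn

theorem circle_eq_or_disjoint (s s' : Side) : k.circle s = k.circle s' ∨
    Disjoint (k.circle s) (k.circle s') := by
  rcases k.collar_eq_or_disjoint s s' with h | h
  · left
    simp only [circle_eq_range, h]
  · right
    simp only [circle_eq_range, disjoint_left]
    rintro _ ⟨θ, rfl⟩ ⟨θ', h'⟩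
    exact h θ θ' 0 (by simp) 0 (by simp) h'.symm

section

variable {K : Set Torus}

theorem angles_add_int {θ : ℝ} (n : ℤ) : θ + n ∈ k.angles K s ↔ θ ∈ k.angles K s := by
  show _ ∈ K ↔ _ ∈ K
  rw [collar_add_int]

theorem IsGap.add_int {a b : ℝ} (h : k.IsGap K s a b) (n : ℤ) : k.IsGap K s (a + n) (b + n) := by
  refine ⟨by linarith [h.lt], by linarith [h.lt_add_one], (angles_add_int n).2 h.left_mem,
    (angles_add_int n).2 h.right_mem, fun x hx hxa => ?_⟩
  refine h.disj (x - n) ⟨by linarith [hx.1], by linarith [hx.2]⟩ ((angles_add_int n).1 ?_)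
  simpa using hxa

theorem arc_add_int (a b : ℝ) (n : ℤ) : k.arc s (Ioo (a + n) (b + n)) = k.arc s (Ioo a b) := by
  ext p
  constructor
  · rintro ⟨θ, hθ, rfl⟩
    refine ⟨θ - n, ⟨by linarith [hθ.1], by linarith [hθ.2]⟩, ?_⟩
    simp only
    rw [← collar_add_int k s (θ - n) 0 n, sub_add_cancel]
  · rintro ⟨θ, hθ, rfl⟩
    exact ⟨θ + n, ⟨by linarith [hθ.1], by linarith [hθ.2]⟩, collar_add_int k s θ 0 n⟩

theorem IsGap.arc_subset {a b : ℝ} (h : k.IsGap K s a b) : k.arc s (Ioo a b) ⊆ k.rim \ K := by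
  rintro _ ⟨θ, hθ, rfl⟩
  exact ⟨k.collar_mem_rim s θ, h.disj θ hθ⟩

theorem IsGap.arc_eq {a b : ℝ} (h : k.IsGap K s a b) :
    k.arc s (Ioo a b) = k.arc s (Icc a b) \ K := by
  ext p
  constructor
  · intro hp
    exact ⟨arc_mono Ioo_subset_Icc_self hp, (h.arc_subset hp).2⟩
  · rintro ⟨⟨θ, hθ, rfl⟩, hK⟩
    refine ⟨θ, ⟨hθ.1.lt_of_ne ?_, hθ.2.lt_of_ne ?_⟩, rfl⟩
    · rintro rfl; exact hK h.left_mem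
    · rintro rfl; exact hK h.right_mem

/-- The components of the complement of `K` in the rim are the arcs over the gaps. -/
theorem IsGap.connectedComponentIn_eq {a b x : ℝ} (h : k.IsGap K s a b) (hx : x ∈ Ioo a b) :
    connectedComponentIn (k.rim \ K) (k.collar s x 0) = k.arc s (Ioo a b) := by
  have hxm : k.collar s x 0 ∈ k.arc s (Ioo a b) := ⟨x, hx, rfl⟩
  refine Subset.antisymm ?_
    ((isPreconnected_arc isPreconnected_Ioo).subset_connectedComponentIn hxm h.arc_subset)
  -- The open and the closed arc of a gap have the same points off `K`. Hence the open arc is both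
  -- open (cut out by `O`) and closed in `k.rim \ K`.
  obtain ⟨O, hO, hO'⟩ := k.exists_isOpen_box s (r := 1) h.lt_add_one zero_le_one le_rfl
  have hsub : connectedComponentIn (k.rim \ K) (k.collar s x 0) ⊆ k.rim \ K :=
    connectedComponentIn_subset _ _
  have hOrim : ∀ p ∈ k.rim, p ∈ O → p ∈ k.arc s (Ioo a b) := fun p hp hpO => by
    have : p ∈ k.body ∩ O := ⟨k.rim_subset_body hp, hpO⟩
    rw [hO'] at this
    exact mem_arc_of_mem_rim Ico_subset_Icc_self hp this
  have hOarc : k.arc s (Ioo a b) ⊆ O := fun p hp => by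
    have : p ∈ k.body ∩ O := by
      rw [hO']
      exact arc_subset_box (by simp) hp
    exact this.2
  have hcl : IsClosed (k.arc s (Icc a b)) := (isCompact_arc isCompact_Icc).isClosed
  suffices h1 : connectedComponentIn (k.rim \ K) (k.collar s x 0) ⊆ O ∨
      connectedComponentIn (k.rim \ K) (k.collar s x 0) ⊆ (k.arc s (Icc a b))ᶜ by
    rcases h1 with h1 | h1
    · exact fun p hp => hOrim p (hsub hp).1 (h1 hp)
    · exact absurd (arc_mono Ioo_subset_Icc_self hxm)
        (h1 (mem_connectedComponentIn (h.arc_subset hxm)))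
  refine isPreconnected_iff_subset_of_disjoint.1 isPreconnected_connectedComponentIn O
    (k.arc s (Icc a b))ᶜ hO hcl.isOpen_compl ?_ ?_
  · intro p hp
    by_cases hc : p ∈ k.arc s (Icc a b)
    · left
      apply hOarc
      rw [h.arc_eq]
      exact ⟨hc, (hsub hp).2⟩
    · exact Or.inr hc
  · ext p
    simp only [mem_inter_iff, mem_compl_iff, mem_empty_iff_false, iff_false, not_and, not_not]
    exact fun hp hpO => arc_mono Ioo_subset_Icc_self (hOrim p (hsub hp).1 hpO)

theorem IsGap.isBoundaryComponent {a b : ℝ} (h : k.IsGap K s a b) :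
    k.IsBoundaryComponent K (k.arc s (Ioo a b)) := by
  have hx : (a + b) / 2 ∈ Ioo a b := ⟨by linarith [h.lt], by linarith [h.lt]⟩
  exact ⟨_, h.arc_subset ⟨_, hx, rfl⟩, (h.connectedComponentIn_eq hx).symm⟩

theorem IsBoundaryComponent.eq_of_mem {A B : Set Torus} (hA : k.IsBoundaryComponent K A)
    (hB : k.IsBoundaryComponent K B) {p : Torus} (hpA : p ∈ A) (hpB : p ∈ B) : A = B := by
  obtain ⟨x, -, rfl⟩ := hA
  obtain ⟨y, -, rfl⟩ := hB
  rw [_root_.connectedComponentIn_eq hpA, _root_.connectedComponentIn_eq hpB]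

theorem IsBoundaryComponent.subset {A : Set Torus} (hA : k.IsBoundaryComponent K A) :
    A ⊆ k.rim \ K := by
  obtain ⟨x, -, rfl⟩ := hA
  exact connectedComponentIn_subset _ _

theorem IsBoundaryComponent.nonempty {A : Set Torus} (hA : k.IsBoundaryComponent K A) :
    A.Nonempty := by
  obtain ⟨x, h, rfl⟩ := hA
  exact ⟨x, mem_connectedComponentIn h⟩

/-- On the compact interval `Icc a b`, shorter than one turn, the map is a closed embedding; then
restrict. -/
theorem isEmbedding_collar {a b : ℝ} (h : b < a + 1) :
    IsEmbedding fun θ : Ioo a b => k.collar s θ 0 := by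
  have hinj : Function.Injective fun θ : Icc a b => k.collar s θ 0 := by
    rintro ⟨θ, h1⟩ ⟨θ', h2⟩ he
    have he' : k.collar s θ' 0 = k.collar s θ 0 := he.symm
    have hsub : ({θ'} : Set ℝ) ⊆ Ico a (a + 1) :=
      singleton_subset_iff.2 ⟨h2.1, h2.2.trans_lt h⟩
    have := (mem_arc_iff (k := k) (s := s) hsub ⟨h1.1, h1.2.trans_lt h⟩).1
      ⟨θ', mem_singleton _, he'⟩
    exact Subtype.ext (mem_singleton_iff.1 this)
  have hc : Continuous fun θ : Icc a b => k.collar s θ 0 :=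
    (k.continuous_collar_left s 0).comp continuous_subtype_val
  have h1 := (hc.isClosedEmbedding hinj).isEmbedding
  have h2 := IsEmbedding.inclusion (Ioo_subset_Icc_self (a := a) (b := b))
  have h3 := h1.comp h2
  have e : (fun θ : Ioo a b => k.collar s θ 0) =
      (fun θ : Icc a b => k.collar s θ 0) ∘ inclusion Ioo_subset_Icc_self := by
    funext θ
    simp only [Function.comp_apply]
  rw [e]
  exact h3

theorem range_collar_Ioo (a b : ℝ) :
    range (fun θ : Ioo a b => k.collar s θ 0) = k.arc s (Ioo a b) := by
  rw [arc, image_eq_range]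

/-- The parametrization of an arc over a short interval. -/
noncomputable def arcHomeomorph (k : TileKind) (s : Side) {a b : ℝ} (h : b < a + 1) :
    Ioo a b ≃ₜ k.arc s (Ioo a b) :=
  (isEmbedding_collar h).toHomeomorph.trans (Homeomorph.setCongr (range_collar_Ioo a b))

theorem arcHomeomorph_apply {a b : ℝ} (h : b < a + 1) (x : Ioo a b) :
    (k.arcHomeomorph s h x : Torus) = k.collar s x 0 := rfl

/-- A homeomorphism from the line to an arc in terms of angles. -/
theorem exists_angle {a b : ℝ} (h : b < a + 1) (l : ℝ ≃ₜ k.arc s (Ioo a b)) :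
    ∃ m : ℝ ≃ₜ Ioo a b, ∀ t, (l t : Torus) = k.collar s (m t) 0 := by
  refine ⟨l.trans (k.arcHomeomorph s h).symm, fun t => ?_⟩
  rw [← arcHomeomorph_apply h]
  simp

theorem arc_ends {a b : ℝ} (h : b < a + 1) (l : ℝ ≃ₜ k.arc s (Ioo a b)) :
    (Tendsto (fun t => (l t : Torus)) atBot (𝓝 (k.collar s a 0)) ∧
      Tendsto (fun t => (l t : Torus)) atTop (𝓝 (k.collar s b 0))) ∨
    (Tendsto (fun t => (l t : Torus)) atBot (𝓝 (k.collar s b 0)) ∧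
      Tendsto (fun t => (l t : Torus)) atTop (𝓝 (k.collar s a 0))) := by
  obtain ⟨m, hm⟩ := exists_angle h l
  simp only [hm]
  have hc := k.continuous_collar_left s 0
  rcases homeomorph_Ioo_ends m with ⟨-, h1, h2⟩ | ⟨-, h1, h2⟩
  · exact Or.inl ⟨(hc.tendsto a).comp h1, (hc.tendsto b).comp h2⟩
  · exact Or.inr ⟨(hc.tendsto b).comp h1, (hc.tendsto a).comp h2⟩

/-- Both ends of an arc are limits of suitable parametrizations by the line. -/
theorem exists_arc_param {a b : ℝ} (hab : a < b) (h : b < a + 1) :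
    ∃ l : ℝ ≃ₜ k.arc s (Ioo a b), Tendsto (fun t => (l t : Torus)) atBot (𝓝 (k.collar s a 0)) ∧
      Tendsto (fun t => (l t : Torus)) atTop (𝓝 (k.collar s b 0)) := by
  obtain ⟨m⟩ := nonempty_homeomorph_Ioo hab
  let l : ℝ ≃ₜ k.arc s (Ioo a b) := m.trans (k.arcHomeomorph s h)
  rcases arc_ends h l with h1 | h1
  · exact ⟨l, h1⟩
  · refine ⟨(Homeomorph.neg ℝ).trans l, ?_, ?_⟩
    · exact h1.2.comp tendsto_neg_atBot_atTop
    · exact h1.1.comp tendsto_neg_atTop_atBot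

/-! ### Connected pieces of a tile -/

variable (hK : K ⊆ k.rim)
include hK

/-- `K` only meets depth `0`. The part of the box at depth in `(0, r)` is connected and disjoint
from `K`, and everything else lies in its closure. -/
theorem isPreconnected_box_diff {I J : Set ℝ} {r : ℝ} (hI : IsPreconnected I) (hr : r ≤ 1)
    (h0 : 0 < r) (hJ : Ioo 0 r ⊆ J) (hJ' : J ⊆ Icc 0 r) : IsPreconnected (k.box s I J \ K) := by
  have h1 : IsPreconnected (k.box s I (Ioo 0 r)) :=
    (hI.prod isPreconnected_Ioo).image _ (k.continuous_collar s).continuousOn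
  refine h1.subset_closure ?_ ?_
  · rintro _ ⟨⟨θ, t⟩, ⟨h2, h3⟩, rfl⟩
    refine ⟨⟨(θ, t), ⟨h2, hJ h3⟩, rfl⟩, fun h => ?_⟩
    have := (k.collar_mem_rim_iff s ⟨h3.1.le, h3.2.le.trans hr⟩).1 (hK h)
    exact h3.1.ne' this
  · refine sdiff_subset.trans ?_
    have h2 := image_closure_subset_closure_image (s := I ×ˢ Ioo 0 r) (k.continuous_collar s)
    refine Subset.trans (image_mono ?_) h2
    rw [closure_prod_eq, closure_Ioo h0.ne]
    exact prod_mono subset_closure hJ'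

theorem core_diff : k.core \ K = k.core := by
  ext p
  refine ⟨fun h => h.1, fun h => ⟨h, fun hp => ?_⟩⟩
  have := hK hp
  rw [rim_eq, mem_iUnion] at this
  obtain ⟨s, hs⟩ := this
  rw [circle_eq_range] at hs
  obtain ⟨θ, rfl⟩ := hs
  exact k.collar_not_mem_core s (by simp) h

theorem collar_one_notMem (θ : ℝ) : k.collar s θ 1 ∉ K := fun h => by
  have := (k.collar_mem_rim_iff s (by simp)).1 (hK h)
  exact one_ne_zero this

theorem isPreconnected_collar_union_core (s : Side) {J : Set ℝ} (hJ : IsPreconnected (k.box s univ J \ K))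
    (h1 : (1 : ℝ) ∈ J) {Z : Set Torus} (hZ : IsPreconnected Z) (hcore : k.core ⊆ Z) :
    IsPreconnected (Z ∪ (k.box s univ J \ K)) :=
  IsPreconnected.union (k.collar s 0 1) (hcore (k.collar_one_mem_core s 0))
    ⟨⟨(0, 1), ⟨trivial, h1⟩, rfl⟩, collar_one_notMem hK 0⟩ hZ hJ

theorem isPreconnected_body_diff : IsPreconnected (k.body \ K) := by
  have h : ∀ s, IsPreconnected (k.box s univ (Icc 0 1) \ K) := fun s =>
    isPreconnected_box_diff hK isPreconnected_univ le_rfl one_pos Ioo_subset_Icc_self Subset.rfl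
  have h1 := isPreconnected_collar_union_core hK .outer (h _) (by simp) k.isPreconnected_core
    Subset.rfl
  have h2 := isPreconnected_collar_union_core hK .inner (h _) (by simp) h1 subset_union_left
  convert h2 using 1
  ext p
  constructor
  · rintro ⟨hp, hpK⟩
    rcases k.body_subset_core_union hp with h | ⟨s, θ, t, ht, rfl⟩
    · exact Or.inl (Or.inl h)
    · have : k.collar s θ t ∈ k.box s univ (Icc 0 1) := ⟨(θ, t), ⟨trivial, ht.1, ht.2.le⟩, rfl⟩
      cases s
      · exact Or.inl (Or.inr ⟨this, hpK⟩)
      · exact Or.inr ⟨this, hpK⟩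
  · have hbox : ∀ s, k.box s univ (Icc 0 1) ⊆ k.body := by
      rintro s _ ⟨⟨θ, t⟩, ⟨-, ht⟩, rfl⟩
      exact k.collar_mem_body s θ ht
    rintro ((h | h) | h)
    · rw [← core_diff hK] at h
      exact ⟨h.1.1, h.2⟩
    · exact ⟨hbox _ h.1, h.2⟩
    · exact ⟨hbox _ h.1, h.2⟩

/-! ### Gaps of Cantor sets -/

variable (hC : ∀ s, IsCantorSet (K ∩ k.circle s))
include hC

theorem isClosed_cantor : IsClosed K := by
  have h : K = ⋃ s ∈ ({.outer, .inner} : Set Side), K ∩ k.circle s := by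
    ext p
    simp only [mem_insert_iff, mem_singleton_iff, mem_iUnion, mem_inter_iff, exists_prop,
      exists_eq_or_imp, exists_eq_left]
    constructor
    · intro hp
      rcases hK hp with h | h
      exacts [Or.inl ⟨hp, h⟩, Or.inr ⟨hp, h⟩]
    · rintro (h | h) <;> exact h.1
  rw [h]
  exact (toFinite _).isClosed_biUnion fun s _ => (isCompact_of_isCantorSet (hC s)).isClosed

theorem isClosed_angles (s : Side) : IsClosed (k.angles K s) :=
  (isClosed_cantor hK hC).preimage (k.continuous_collar_left s 0)

omit hK in
-- Otherwise `K` would contain an arc, which is a nontrivial connected subset of a Cantor set.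
theorem exists_notMem_angles {x y : ℝ} (h : x < y) : ∃ z ∈ Ioo x y, z ∉ k.angles K s := by
  by_contra! hc
  -- Shortened to less than one turn, so that different angles give different points.
  obtain ⟨y', h1, h2⟩ : ∃ y', x < y' ∧ y' < y ∧ y' < x + 1 := by
    obtain ⟨y', h1, h2⟩ := exists_between (lt_min h (lt_add_one x))
    exact ⟨y', h1, h2.trans_le (min_le_left _ _), h2.trans_le (min_le_right _ _)⟩
  have hsub := subsingleton_of_subset_isCantorSet (hC s)
    (isPreconnected_arc (k := k) (s := s) (isPreconnected_Ioo (a := x) (b := y'))) (by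
      rintro _ ⟨θ, hθ, rfl⟩
      exact ⟨hc θ ⟨hθ.1, hθ.2.trans h2.1⟩, arc_subset_circle univ ⟨θ, trivial, rfl⟩⟩)
  obtain ⟨u, hu1, hu2⟩ := exists_between h1
  obtain ⟨v, hv1, hv2⟩ := exists_between hu2
  have := hsub ⟨u, ⟨hu1, hu2⟩, rfl⟩ ⟨v, ⟨hu1.trans hv1, hv2⟩, rfl⟩
  have := (mem_arc_iff (k := k) (s := s) (α := x) (I := {v})
      (by rintro _ rfl; exact ⟨(hu1.trans hv1).le, hv2.trans h2.2⟩) ⟨hu1.le, hu2.trans h2.2⟩).1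
      ⟨v, rfl, this.symm⟩
  exact hv1.ne this

theorem infinite_inter_arc {x δ : ℝ} (hx : x ∈ k.angles K s) (hδ : 0 < δ) :
    (K ∩ k.arc s (Ioo (x - δ) (x + δ))).Infinite := by
  have hε : 0 < min δ (1 / 4) := lt_min hδ (by norm_num)
  have hε' : min δ (1 / 4) ≤ 1 / 4 := min_le_right _ _
  obtain ⟨O, hO, hO'⟩ := k.exists_isOpen_box s (α := x - min δ (1 / 4)) (β := x + min δ (1 / 4))
    (r := 1) (by linarith) zero_le_one le_rfl
  have hxO : k.collar s x 0 ∈ O := by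
    have : k.collar s x 0 ∈ k.body ∩ O := by
      rw [hO']
      exact ⟨(x, 0), ⟨⟨by linarith, by linarith⟩, by simp⟩, rfl⟩
    exact this.2
  refine (infinite_inter_of_isCantorSet (hC s) hO
    ⟨hx, arc_subset_circle univ ⟨x, trivial, rfl⟩⟩ hxO).mono ?_
  rintro p ⟨⟨hp, -⟩, hpO⟩
  refine ⟨hp, ?_⟩
  have : p ∈ k.body ∩ O := ⟨k.rim_subset_body (hK hp), hpO⟩
  rw [hO'] at this
  refine arc_mono ?_ (mem_arc_of_mem_rim Ico_subset_Icc_self (hK hp) this)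
  exact Ioo_subset_Ioo (by linarith [min_le_left δ (1 / 4)]) (by linarith [min_le_left δ (1 / 4)])

theorem exists_ne_mem_angles {x δ : ℝ} (hx : x ∈ k.angles K s) (hδ : 0 < δ) :
    ∃ y ∈ k.angles K s, y ≠ x ∧ y ∈ Ioo (x - δ) (x + δ) := by
  obtain ⟨p, ⟨hp, θ, hθ, rfl⟩, hne⟩ := (infinite_inter_arc hK hC hx hδ).exists_notMem_finite
    (finite_singleton (k.collar s x 0))
  exact ⟨θ, hp, fun h => hne (by rw [h]; rfl), hθ⟩

/-- The ends of the gap are the nearest angles of `K` on both sides of `x`, which exist because the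
angles form a closed set invariant under integer translations. The gap is shorter than one turn
because `K` has a second point on this circle. -/
theorem exists_gap {x : ℝ} (hx : x ∉ k.angles K s) : ∃ a b, k.IsGap K s a b ∧ x ∈ Ioo a b := by
  have hcl := isClosed_angles hK hC s
  obtain ⟨p, hp⟩ : (K ∩ k.circle s).Nonempty := by
    obtain ⟨f⟩ := hC s
    exact ⟨_, (f.symm fun _ => true).2⟩
  have hinf := infinite_inter_of_isCantorSet (hC s) isOpen_univ hp trivial
  obtain ⟨hpK, hpc⟩ := hp
  rw [circle_eq_range] at hpc
  obtain ⟨θ, rfl⟩ := hpc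
  have hne : ∀ y, ∃ z ∈ Ico y (y + 1), z ∈ k.angles K s := fun y => by
    obtain ⟨n, hn⟩ := exists_int_shift y θ
    exact ⟨_, hn, (angles_add_int n).2 hpK⟩
  set L := k.angles K s ∩ Iic x
  set R := k.angles K s ∩ Ici x
  have hL : L.Nonempty := by
    obtain ⟨z, hz, hz'⟩ := hne (x - 1)
    exact ⟨z, hz', by show z ≤ x; linarith [hz.2]⟩
  have hR : R.Nonempty := by
    obtain ⟨z, hz, hz'⟩ := hne x
    exact ⟨z, hz', hz.1⟩
  have hLb : BddAbove L := ⟨x, fun z hz => hz.2⟩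
  have hRb : BddBelow R := ⟨x, fun z hz => hz.2⟩
  have ha := (hcl.inter isClosed_Iic).csSup_mem hL hLb
  have hb := (hcl.inter isClosed_Ici).csInf_mem hR hRb
  set a := sSup L
  set b := sInf R
  have hax : a < x := lt_of_le_of_ne ha.2 fun h => hx (h ▸ ha.1)
  have hxb : x < b := lt_of_le_of_ne hb.2 fun h => hx (h ▸ hb.1)
  have hdisj : ∀ z ∈ Ioo a b, z ∉ k.angles K s := by
    intro z hz hzA
    rcases le_total z x with h | h
    · exact (le_csSup hLb (⟨hzA, h⟩ : z ∈ L)).not_gt hz.1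
    · exact (csInf_le hRb (⟨hzA, h⟩ : z ∈ R)).not_gt hz.2
  refine ⟨a, b, ⟨hax.trans hxb, ?_, ha.1, hb.1, hdisj⟩, hax, hxb⟩
  obtain ⟨q, ⟨⟨hq, hqc⟩, -⟩, hqa⟩ := hinf.exists_notMem_finite
    (finite_singleton (k.collar s a 0))
  rw [circle_eq_range] at hqc
  obtain ⟨φ, rfl⟩ := hqc
  obtain ⟨n, hn⟩ := exists_int_shift a φ
  have hφ : φ + n ∈ k.angles K s := (angles_add_int n).2 hq
  have hne : a ≠ φ + n := fun h => hqa (by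
    show k.collar s φ 0 = _
    rw [h, collar_add_int])
  by_contra! hc
  exact hdisj _ ⟨hn.1.lt_of_ne hne, hn.2.trans_le hc⟩ hφ

theorem isBoundaryComponent_iff {A : Set Torus} :
    k.IsBoundaryComponent K A ↔ ∃ s a b, k.IsGap K s a b ∧ A = k.arc s (Ioo a b) := by
  constructor
  · rintro ⟨p, hp, rfl⟩
    have := hp.1
    rw [rim_eq, mem_iUnion] at this
    obtain ⟨s, hs⟩ := this
    rw [circle_eq_range] at hs
    obtain ⟨x, rfl⟩ := hs
    obtain ⟨a, b, h, hx⟩ := exists_gap hK hC (show x ∉ k.angles K s from hp.2)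
    exact ⟨s, a, b, h, h.connectedComponentIn_eq hx⟩
  · rintro ⟨s, a, b, h, rfl⟩
    exact h.isBoundaryComponent

theorem IsBoundaryComponent.subset_circle_iff {A : Set Torus} (hA : k.IsBoundaryComponent K A)
    {s : Side} : A ⊆ k.circle s ↔ (A ∩ k.circle s).Nonempty := by
  constructor
  · intro h
    rw [inter_eq_left.2 h]
    exact hA.nonempty
  · rintro ⟨p, hp, hps⟩
    obtain ⟨s', a, b, h, rfl⟩ := (isBoundaryComponent_iff hK hC).1 hA
    rcases k.circle_eq_or_disjoint s s' with h' | h'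
    · rw [h']; exact arc_subset_circle _
    · exact (disjoint_left.1 h' hps (arc_subset_circle _ hp)).elim

theorem IsBoundaryComponent.exists_side {A : Set Torus} (hA : k.IsBoundaryComponent K A) :
    ∃ s, A ⊆ k.circle s := by
  obtain ⟨s', a, b, h, rfl⟩ := (isBoundaryComponent_iff hK hC).1 hA
  exact ⟨s', arc_subset_circle _⟩

/-- A boundary component contained in a given circle comes from a gap of this circle. -/
theorem IsBoundaryComponent.exists_isGap {A : Set Torus} (hA : k.IsBoundaryComponent K A) {s : Side}
    (hs : A ⊆ k.circle s) : ∃ a b, k.IsGap K s a b ∧ A = k.arc s (Ioo a b) := by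
  obtain ⟨p, hp⟩ := hA.nonempty
  have hp' := hs hp
  rw [circle_eq_range] at hp'
  obtain ⟨x, rfl⟩ := hp'
  obtain ⟨a, b, h, hx⟩ := exists_gap hK hC (show x ∉ k.angles K s from (hA.subset hp).2)
  exact ⟨a, b, h, hA.eq_of_mem h.isBoundaryComponent hp ⟨x, hx, rfl⟩⟩

/-! ### Isolating intervals -/

omit hK in
-- The ends of the interval are chosen off `K`, so the frontier of the box over it avoids `K`.
theorem exists_isolating_Icc {x : ℝ} {Q : Set Torus} (hQ : IsClosed Q) (hxQ : k.collar s x 0 ∉ Q) :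
    ∃ α β, α < x ∧ x < β ∧ β < α + 1 ∧ α ∉ k.angles K s ∧ β ∉ k.angles K s ∧
      Disjoint (k.arc s (Icc α β)) Q := by
  have hU : {θ | k.collar s θ 0 ∉ Q} ∈ 𝓝 x :=
    (hQ.isOpen_compl.preimage (k.continuous_collar_left s 0)).mem_nhds hxQ
  obtain ⟨δ, hδ, hball⟩ := Metric.mem_nhds_iff.1 hU
  have hε : 0 < min δ (1 / 2) := lt_min hδ (by norm_num)
  obtain ⟨α, hα, hα'⟩ := exists_notMem_angles (s := s) hC (sub_lt_self x hε)
  obtain ⟨β, hβ, hβ'⟩ := exists_notMem_angles (s := s) hC (lt_add_of_pos_right x hε)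
  refine ⟨α, β, hα.2, hβ.1, ?_, hα', hβ', ?_⟩
  · linarith [hα.1, hβ.2, min_le_right δ (1 / 2)]
  · rw [disjoint_left]
    rintro _ ⟨θ, hθ, rfl⟩
    refine hball ?_
    rw [Metric.mem_ball, Real.dist_eq, abs_lt]
    constructor <;> linarith [hα.1, hβ.2, min_le_left δ (1 / 2), hθ.1, hθ.2]

omit hK in
-- One end of the interval is the angle of `l t₀`, inside the gap; the other one lies beyond the
-- limit `κ`, off `K`. The parameter `t₀` remains free so that the boxes on both sides of a glued
-- arc can be cut at the same point of the arc.
theorem exists_isolating_Icc_of_arc {a b : ℝ} (hg : k.IsGap K s a b) (l : ℝ ≃ₜ k.arc s (Ioo a b))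
    {κ : Torus} (hl : Tendsto (fun t => (l t : Torus)) atTop (𝓝 κ)) {Q : Set Torus}
    (hQ : IsClosed Q) (hκQ : κ ∉ Q) : ∃ T, ∀ t₀ ≥ T, ∃ α β, β < α + 1 ∧ α ∉ k.angles K s ∧
      β ∉ k.angles K s ∧ κ ∈ k.arc s (Ioo α β) ∧ Disjoint (k.arc s (Icc α β)) Q ∧
      ∀ t, ((l t : Torus) ∈ k.arc s (Ioo α β) ↔ t₀ < t) ∧
        ((l t : Torus) ∈ k.arc s (Icc α β) ↔ t₀ ≤ t) := by
  obtain ⟨m, hm⟩ := exists_angle hg.lt_add_one l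
  have hc := k.continuous_collar_left s 0
  simp only [hm] at hl ⊢
  rcases homeomorph_Ioo_ends m with ⟨hmono, -, h2⟩ | ⟨hanti, -, h2⟩
  · obtain rfl : κ = k.collar s b 0 := tendsto_nhds_unique hl ((hc.tendsto b).comp h2)
    obtain ⟨α, β, h3, h4, h5, h6, h7, h8⟩ := exists_isolating_Icc hC hQ hκQ
    obtain ⟨β', hβ', hβ''⟩ := exists_notMem_angles (s := s) hC (lt_min h4 hg.lt_add_one)
    obtain ⟨T, hT⟩ := (h2.eventually (lt_mem_nhds h3)).exists
    refine ⟨T, fun t₀ ht₀ => ⟨m t₀, β', ?_, hg.disj _ (m t₀).2, hβ'', ?_, ?_, fun t => ⟨?_, ?_⟩⟩⟩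
    · linarith [hβ'.2, min_le_right β (a + 1), (m t₀).2.1]
    · exact ⟨b, ⟨(m t₀).2.2, hβ'.1⟩, rfl⟩
    · refine h8.mono_left (arc_mono (Icc_subset_Icc ?_ (hβ'.2.le.trans (min_le_left _ _))))
      exact hT.le.trans (hmono.monotone ht₀)
    · rw [mem_arc_iff (α := a) (fun z hz => ⟨((m t₀).2.1.trans hz.1).le,
        hz.2.trans (hβ'.2.trans_le (min_le_right _ _))⟩)
        ⟨(m t).2.1.le, (m t).2.2.trans hg.lt_add_one⟩, mem_Ioo]
      exact (and_iff_left ((m t).2.2.trans hβ'.1)).trans hmono.lt_iff_lt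
    · rw [mem_arc_iff (α := a) (fun z hz => ⟨((m t₀).2.1.trans_le hz.1).le,
        hz.2.trans_lt (hβ'.2.trans_le (min_le_right _ _))⟩)
        ⟨(m t).2.1.le, (m t).2.2.trans hg.lt_add_one⟩, mem_Icc]
      exact (and_iff_left ((m t).2.2.trans hβ'.1).le).trans hmono.le_iff_le
  · obtain rfl : κ = k.collar s a 0 := tendsto_nhds_unique hl ((hc.tendsto a).comp h2)
    obtain ⟨α, β, h3, h4, h5, h6, h7, h8⟩ := exists_isolating_Icc hC hQ hκQ
    -- In the decreasing case the fundamental domain `[b - 1, b)` contains both the new left end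
    -- `α'`, which lies before `a`, and the gap.
    have hb1 : b - 1 < a := by linarith [hg.lt_add_one]
    obtain ⟨α', hα', hα''⟩ := exists_notMem_angles (s := s) hC (max_lt h3 hb1)
    have e1 : b - 1 < α' := (le_max_right _ _).trans_lt hα'.1
    obtain ⟨T, hT⟩ := (h2.eventually (gt_mem_nhds h4)).exists
    have hms : ∀ t, (m t : ℝ) ∈ Ico (b - 1) (b - 1 + 1) := fun t =>
      ⟨hb1.le.trans (m t).2.1.le, by linarith [(m t).2.2]⟩
    refine ⟨T, fun t₀ ht₀ => ⟨α', m t₀, ?_, hα'', hg.disj _ (m t₀).2, ?_, ?_, fun t => ⟨?_, ?_⟩⟩⟩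
    · linarith [(m t₀).2.2]
    · exact ⟨a, ⟨hα'.2, (m t₀).2.1⟩, rfl⟩
    · refine h8.mono_left (arc_mono (Icc_subset_Icc ((le_max_left _ _).trans hα'.1.le) ?_))
      exact (hanti.antitone ht₀).trans hT.le
    · rw [mem_arc_iff (α := b - 1) (fun z hz => ⟨e1.le.trans hz.1.le,
        hz.2.trans (hms t₀).2⟩) (hms t), mem_Ioo]
      exact (and_iff_right (hα'.2.trans (m t).2.1)).trans hanti.lt_iff_gt
    · rw [mem_arc_iff (α := b - 1) (fun z hz => ⟨e1.le.trans hz.1,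
        hz.2.trans_lt (hms t₀).2⟩) (hms t), mem_Icc]
      exact (and_iff_right (hα'.2.trans (m t).2.1).le).trans hanti.le_iff_ge

end

end TileKind

/-! ### The gluing -/

theorem Edge.ext_of_child {F : Set (ℕ → Bool)} {e e' : Edge F} (h : e.child = e'.child) : e = e' := by
  obtain ⟨v, b, hm⟩ := e
  obtain ⟨v', b', hm'⟩ := e'
  have := congrArg Subtype.val h
  simp only [Edge.child, List.cons.injEq] at this
  obtain ⟨rfl, rfl⟩ := this
  rfl

theorem Edge.ext_of_parent {F : Set (ℕ → Bool)} {e e' : Edge F} (h : e.parent = e'.parent)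
    (hd : e.dir = e'.dir) : e = e' := by
  obtain ⟨v, b, hm⟩ := e
  obtain ⟨v', b', hm'⟩ := e'
  have := congrArg Subtype.val h
  simp only [Edge.parent] at this hd
  subst this hd
  rfl

theorem Edge.child_ne_parent {F : Set (ℕ → Bool)} (e : Edge F) : e.child ≠ e.parent := fun h => by
  have := congrArg (fun v : Vertex F => v.1.length) h
  simp [Edge.child, Edge.parent] at this

namespace Realization

variable {F : Set (ℕ → Bool)} {ν : Vertex F → Bool} (D : Realization F ν)

theorem isBoundaryComponent_iff (v : Vertex F) {A : Set Torus} :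
    (tileKind F ν v).IsBoundaryComponent (D.K v) A ↔
      ∃ s a b, (tileKind F ν v).IsGap (D.K v) s a b ∧ A = (tileKind F ν v).arc s (Ioo a b) :=
  TileKind.isBoundaryComponent_iff (D.K_subset v) (D.K_cantor v)

theorem sameSide_self (v : Vertex F) {A : Set Torus}
    (hA : (tileKind F ν v).IsBoundaryComponent (D.K v) A) : (tileKind F ν v).SameSide A A := by
  obtain ⟨s, hs⟩ := hA.exists_side (D.K_subset v) (D.K_cantor v)
  exact ⟨s, hs, hs⟩

theorem edge_eq_of_mem_atParent {e e' : Edge F} (h : e.parent = e'.parent) {p : Torus}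
    (hp : p ∈ D.atParent e) (hp' : p ∈ D.atParent e') : e = e' := by
  by_contra hne
  refine D.not_sameSide e e' hne h ?_
  have h' := D.isComp_atParent e'
  rw [← h] at h'
  rw [← (D.isComp_atParent e).eq_of_mem h' hp hp']
  exact D.sameSide_self _ (D.isComp_atParent e)

theorem notMem_atParent_of_mem_atChild {e e' : Edge F} (h : e.child = e'.parent) {p : Torus}
    (hp : p ∈ D.atChild e) : p ∉ D.atParent e' := fun hp' => by
  refine D.child_ne_parent e e' h ?_
  have h' := D.isComp_atParent e'
  rw [← h] at h'
  exact (D.isComp_atChild e).eq_of_mem h' hp hp'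

/-- A point of the compact tile outside of `K` as a point of the tile. -/
def mkTile (v : Vertex F) (p : Torus) (h : p ∈ (tileKind F ν v).body ∧ p ∉ D.K v) : D.Tile v :=
  Subtype.mk p h

theorem continuous_val (v : Vertex F) : Continuous fun p : D.Tile v => p.1 := continuous_subtype_val

theorem tile_ext {v : Vertex F} {p q : D.Tile v} (h : p.1 = q.1) : p = q := Subtype.ext h

instance (v : Vertex F) : T2Space (D.Tile v) :=
  inferInstanceAs (T2Space {p : Torus // p ∈ (tileKind F ν v).body ∧ p ∉ D.K v})

theorem glueRel_left_unique {a b c : Σ v, D.Tile v} (h : D.GlueRel a c) (h' : D.GlueRel b c) :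
    a = b := by
  obtain ⟨v, p⟩ := a
  obtain ⟨w, q⟩ := b
  obtain ⟨u, r⟩ := c
  obtain ⟨e, h1, h2, x, h3, h4⟩ := h
  obtain ⟨e', h1', h2', x', h3', h4'⟩ := h'
  simp only at h1 h2 h3 h4 h1' h2' h3' h4'
  obtain rfl : e = e' := D.edge_eq_of_mem_atParent (h2.symm.trans h2') (h4 ▸ (D.glue e x).2)
    (h4' ▸ (D.glue e' x').2)
  subst h1 h1'
  obtain rfl : x = x' := (D.glue e).injective (Subtype.ext (h4.symm.trans h4'))
  rw [D.tile_ext (h3.trans h3'.symm)]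

theorem glueRel_right_unique {a b c : Σ v, D.Tile v} (h : D.GlueRel a b) (h' : D.GlueRel a c) :
    b = c := by
  obtain ⟨v, p⟩ := a
  obtain ⟨w, q⟩ := b
  obtain ⟨u, r⟩ := c
  obtain ⟨e, h1, h2, x, h3, h4⟩ := h
  obtain ⟨e', h1', h2', x', h3', h4'⟩ := h'
  simp only at h1 h2 h3 h4 h1' h2' h3' h4'
  obtain rfl : e = e' := Edge.ext_of_child (h1.symm.trans h1')
  subst h2 h2'
  obtain rfl : x = x' := Subtype.ext (h3.symm.trans h3')
  rw [D.tile_ext (h4.trans h4'.symm)]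

/-- A tile uses different, hence disjoint, components for the edge to its parent and for the edges
to its children, so no point is glued in both directions. -/
theorem glueRel_not_trans {a b c : Σ v, D.Tile v} (h : D.GlueRel a b) (h' : D.GlueRel b c) :
    False := by
  obtain ⟨e, h1, h2, x, h3, h4⟩ := h
  obtain ⟨e', h1', h2', x', h3', h4'⟩ := h'
  exact D.notMem_atParent_of_mem_atChild (h1'.symm.trans h2) (p := b.2.1) (h3' ▸ x'.2)
    (h4 ▸ (D.glue e x).2)

/-- `GlueRel` is a partial injection that cannot be composed with itself, so the classes of the
generated equivalence relation have at most two elements. -/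
theorem mk_eq_iff {a b : Σ v, D.Tile v} :
    (Quot.mk D.GlueRel a : D.W) = Quot.mk D.GlueRel b ↔ a = b ∨ D.GlueRel a b ∨ D.GlueRel b a := by
  constructor
  · intro h
    have h' := Quot.eqvGen_exact h
    clear h
    induction h' with
    | rel x y h => exact Or.inr (Or.inl h)
    | refl x => exact Or.inl rfl
    | symm x y _ ih =>
      rcases ih with rfl | h | h
      exacts [Or.inl rfl, Or.inr (Or.inr h), Or.inr (Or.inl h)]
    | trans x y z _ _ ih1 ih2 =>
      rcases ih1 with rfl | h | h
      · exact ih2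
      · rcases ih2 with rfl | h' | h'
        · exact Or.inr (Or.inl h)
        · exact (D.glueRel_not_trans h h').elim
        · exact Or.inl (D.glueRel_left_unique h h')
      · rcases ih2 with rfl | h' | h'
        · exact Or.inr (Or.inr h)
        · exact Or.inl (D.glueRel_right_unique h h')
        · exact (D.glueRel_not_trans h' h).elim
  · rintro (rfl | h | h)
    exacts [rfl, Quot.sound h, (Quot.sound h).symm]

theorem incl_eq_iff {v w : Vertex F} {p : D.Tile v} {q : D.Tile w} :
    D.incl v p = D.incl w q ↔ (⟨v, p⟩ : Σ v, D.Tile v) = ⟨w, q⟩ ∨ D.GlueRel ⟨v, p⟩ ⟨w, q⟩ ∨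
      D.GlueRel ⟨w, q⟩ ⟨v, p⟩ := D.mk_eq_iff

theorem incl_injective (v : Vertex F) : Function.Injective (D.incl v) := by
  intro p q h
  rcases D.incl_eq_iff.1 h with h | ⟨e, h1, h2, -⟩ | ⟨e, h1, h2, -⟩
  · simpa using h
  · exact (e.child_ne_parent (h1.symm.trans h2)).elim
  · exact (e.child_ne_parent (h1.symm.trans h2)).elim

theorem exists_incl (x : D.W) : ∃ v p, D.incl v p = x := by
  induction x using Quot.ind with
  | _ a => exact ⟨a.1, a.2, rfl⟩

theorem isOpen_iff {U : Set D.W} : IsOpen U ↔ ∀ v, IsOpen (D.incl v ⁻¹' U) := by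
  exact (isOpen_coinduced (f := Quot.mk D.GlueRel)).trans isOpen_sigma_iff

theorem isClosed_iff {U : Set D.W} : IsClosed U ↔ ∀ v, IsClosed (D.incl v ⁻¹' U) := by
  simp only [← isOpen_compl_iff, D.isOpen_iff, preimage_compl]

theorem incl_glue (e : Edge F) (x : D.atChild e) {p : D.Tile e.child} {q : D.Tile e.parent}
    (hp : p.1 = x) (hq : q.1 = D.glue e x) : D.incl e.child p = D.incl e.parent q :=
  D.incl_eq_iff.2 (Or.inr (Or.inl ⟨e, rfl, rfl, x, hp, hq⟩))

/-! ### Subsets of the surface given by subsets of the tiles -/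

/-- A family of subsets of the tiles compatible with the gluing maps. -/
def Compatible (P : Vertex F → Set Torus) : Prop :=
  ∀ e (x : D.atChild e), (x : Torus) ∈ P e.child ↔ (D.glue e x : Torus) ∈ P e.parent

/-- The subset of the surface consisting of given subsets of the tiles. -/
def assemble (P : Vertex F → Set Torus) : Set D.W := {x | ∃ v p, p.1 ∈ P v ∧ D.incl v p = x}

variable {D} in
theorem Compatible.mem_assemble {P : Vertex F → Set Torus} (hP : D.Compatible P) {v : Vertex F}
    {p : D.Tile v} : D.incl v p ∈ D.assemble P ↔ p.1 ∈ P v := by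
  constructor
  · rintro ⟨w, q, hq, h⟩
    rcases D.incl_eq_iff.1 h with h | ⟨e, h1, h2, x, h3, h4⟩ | ⟨e, h1, h2, x, h3, h4⟩
    · obtain ⟨rfl, h⟩ := Sigma.mk.inj h
      rw [← eq_of_heq h]; exact hq
    · simp only at h1 h2 h3 h4
      rw [h4, h2, ← hP, ← h3, ← h1]
      exact hq
    · simp only at h1 h2 h3 h4
      rw [h3, h1, hP, ← h4, ← h2]
      exact hq
  · exact fun h => ⟨v, p, h, rfl⟩

variable {D} in
theorem Compatible.isOpen_assemble {P : Vertex F → Set Torus} (hP : D.Compatible P)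
    (ho : ∀ v, IsOpen {p : D.Tile v | p.1 ∈ P v}) : IsOpen (D.assemble P) := by
  refine D.isOpen_iff.2 fun v => ?_
  convert ho v using 1
  ext p
  exact hP.mem_assemble

variable {D} in
theorem Compatible.compl {P : Vertex F → Set Torus} (hP : D.Compatible P) :
    D.Compatible fun v => (P v)ᶜ := fun e x => not_congr (hP e x)

/-! ### The tiles are closed in the surface -/

/-- The inclusion of a boundary component in its tile. -/
def arcIncl (v : Vertex F) {A : Set Torus} (hA : (tileKind F ν v).IsBoundaryComponent (D.K v) A)
    (x : A) : D.Tile v :=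
  D.mkTile v x ⟨(tileKind F ν v).rim_subset_body (hA.subset x.2).1, (hA.subset x.2).2⟩

theorem isClosed_component (v : Vertex F) {A : Set Torus}
    (hA : (tileKind F ν v).IsBoundaryComponent (D.K v) A) : IsClosed {p : D.Tile v | p.1 ∈ A} := by
  obtain ⟨s, a, b, h, rfl⟩ := (D.isBoundaryComponent_iff v).1 hA
  convert (TileKind.isCompact_arc (k := tileKind F ν v) (s := s)
    (isCompact_Icc (a := a) (b := b))).isClosed.preimage (D.continuous_val v) using 1
  ext p
  rw [h.arc_eq]
  exact and_iff_left p.2.2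

theorem isClosedEmbedding_arcIncl (v : Vertex F) {A : Set Torus}
    (hA : (tileKind F ν v).IsBoundaryComponent (D.K v) A) : IsClosedEmbedding (D.arcIncl v hA) := by
  have h : IsEmbedding fun p : D.Tile v => p.1 := IsEmbedding.subtypeVal
  refine ⟨IsEmbedding.of_comp (Continuous.subtype_mk continuous_subtype_val _) h.continuous
    IsEmbedding.subtypeVal, ?_⟩
  convert D.isClosed_component v hA using 1
  ext p
  constructor
  · rintro ⟨x, rfl⟩; exact x.2
  · intro hp; exact ⟨⟨p.1, hp⟩, D.tile_ext rfl⟩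

/-- The trace of the image of `Z` on another tile is empty unless the tiles are adjacent; then it is
the image under the gluing homeomorphism of the part of `Z` on the common arc, and boundary
components are closed in their tiles. -/
theorem isClosedMap_incl (v : Vertex F) : IsClosedMap (D.incl v) := by
  intro Z hZ
  refine D.isClosed_iff.2 fun w => ?_
  have hset : D.incl w ⁻¹' (D.incl v '' Z) =
      {q | ∃ p ∈ Z, (⟨v, p⟩ : Σ v, D.Tile v) = ⟨w, q⟩} ∪
      ({q | ∃ p ∈ Z, D.GlueRel ⟨v, p⟩ ⟨w, q⟩} ∪ {q | ∃ p ∈ Z, D.GlueRel ⟨w, q⟩ ⟨v, p⟩}) := by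
    ext q
    simp only [mem_preimage, mem_image, D.incl_eq_iff, mem_union, mem_ofPred_eq, ← exists_or,
      ← and_or_left]
  rw [hset]
  refine IsClosed.union ?_ (IsClosed.union ?_ ?_)
  · by_cases h : v = w
    · subst h
      convert hZ using 1
      ext q
      simp
    · convert isClosed_empty using 1
      ext q
      simp only [mem_ofPred_eq, mem_empty_iff_false, iff_false, not_exists, not_and]
      exact fun p _ h' => h (Sigma.mk.inj h').1
  · by_cases h : ∃ e : Edge F, v = e.child ∧ w = e.parent
    · obtain ⟨e, rfl, rfl⟩ := h
      have hc := D.isClosedEmbedding_arcIncl _ (D.isComp_atChild e)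
      have hp := D.isClosedEmbedding_arcIncl _ (D.isComp_atParent e)
      convert hp.isClosedMap _ ((D.glue e).isClosedMap _ (hZ.preimage hc.continuous)) using 1
      ext q
      constructor
      · rintro ⟨p, hp, e', h1, h2, x, h3, h4⟩
        obtain rfl : e = e' := Edge.ext_of_child h1
        refine ⟨D.glue e x, ⟨x, ?_, rfl⟩, D.tile_ext h4.symm⟩
        rw [mem_preimage, show D.arcIncl _ (D.isComp_atChild e) x = p from D.tile_ext h3.symm]
        exact hp
      · rintro ⟨_, ⟨x, hx, rfl⟩, rfl⟩
        exact ⟨_, hx, e, rfl, rfl, x, rfl, rfl⟩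
    · convert isClosed_empty using 1
      ext q
      simp only [mem_ofPred_eq, mem_empty_iff_false, iff_false, not_exists, not_and]
      rintro p - ⟨e, h1, h2, -⟩
      exact h ⟨e, h1, h2⟩
  · by_cases h : ∃ e : Edge F, w = e.child ∧ v = e.parent
    · obtain ⟨e, rfl, rfl⟩ := h
      have hc := D.isClosedEmbedding_arcIncl _ (D.isComp_atChild e)
      have hp := D.isClosedEmbedding_arcIncl _ (D.isComp_atParent e)
      convert hc.isClosedMap _ ((D.glue e).symm.isClosedMap _ (hZ.preimage hp.continuous)) using 1
      ext q
      constructor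
      · rintro ⟨p, hp, e', h1, h2, x, h3, h4⟩
        obtain rfl : e = e' := Edge.ext_of_child h1
        refine ⟨x, ⟨D.glue e x, ?_, by simp⟩, D.tile_ext h3.symm⟩
        rw [mem_preimage, show D.arcIncl _ (D.isComp_atParent e) (D.glue e x) = p from
          D.tile_ext h4.symm]
        exact hp
      · rintro ⟨_, ⟨x, hx, rfl⟩, rfl⟩
        exact ⟨_, hx, e, rfl, rfl, (D.glue e).symm x, rfl, by simp [arcIncl, mkTile]⟩
    · convert isClosed_empty using 1
      ext q
      simp only [mem_ofPred_eq, mem_empty_iff_false, iff_false, not_exists, not_and]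
      rintro p - ⟨e, h1, h2, -⟩
      exact h ⟨e, h1, h2⟩

theorem isClosedEmbedding_incl (v : Vertex F) : IsClosedEmbedding (D.incl v) :=
  IsClosedEmbedding.of_continuous_injective_isClosedMap (D.incl v).continuous (D.incl_injective v)
    (D.isClosedMap_incl v)

/-- The trace on a tile of a compact subset of the surface is compact. -/
theorem isClosed_trace_compact (v : Vertex F) (C : Compacts D.W) :
    IsClosed ((fun p : D.Tile v => p.1) '' (D.incl v ⁻¹' C)) :=
  (((D.isClosedEmbedding_incl v).isCompact_preimage C.isCompact).image (D.continuous_val v)).isClosed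

/-! ### Compact sets meet finitely many tiles -/

/-- The tiles that can meet the tile of `w`. -/
def neighbors (w : Vertex F) : Set (Vertex F) :=
  {u | u.1 ∈ ({w.1, w.1.tail, true :: w.1, false :: w.1} : Set (List Bool))}

theorem finite_neighbors (w : Vertex F) : (neighbors w).Finite :=
  Finite.preimage Subtype.val_injective.injOn (toFinite _)

theorem mem_neighbors_of_incl_eq {u w : Vertex F} {p : D.Tile u} {q : D.Tile w}
    (h : D.incl u p = D.incl w q) : u ∈ neighbors w := by
  rcases D.incl_eq_iff.1 h with h | ⟨e, h1, h2, -⟩ | ⟨e, h1, h2, -⟩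
  · obtain ⟨rfl, -⟩ := Sigma.mk.inj h
    exact Or.inl rfl
  · simp only at h1 h2
    subst h1 h2
    cases h : e.dir
    · exact Or.inr (Or.inr (Or.inr (by simp [Edge.child, Edge.parent, h])))
    · exact Or.inr (Or.inr (Or.inl (by simp [Edge.child, Edge.parent, h])))
  · simp only at h1 h2
    subst h1 h2
    exact Or.inr (Or.inl rfl)

/-- Choose a point of `C` in each tile that meets `C`. A tile meets only finitely many others, so it
contains finitely many of the chosen points; hence every set of chosen points is closed, and in the
compact set `C` there are finitely many. Each point lies in finitely many tiles. -/
theorem finite_tiles (C : Compacts D.W) : {v | ∃ p, D.incl v p ∈ C}.Finite := by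
  set S := {v | ∃ p, D.incl v p ∈ C} with hS
  have hS' : ∀ v : S, ∃ p, D.incl v p ∈ C := fun v => v.2
  choose x hx using hS'
  let y : S → D.W := fun v => D.incl v (x v)
  have hclosed : ∀ R : Set S, IsClosed (y '' R) := by
    intro R
    refine D.isClosed_iff.2 fun w => Set.Finite.isClosed ?_
    have hsub : D.incl w ⁻¹' (y '' R) ⊆
        ⋃ u ∈ (Subtype.val ⁻¹' neighbors w : Set S), D.incl w ⁻¹' {y u} := by
      rintro q ⟨u, -, hu⟩
      exact mem_biUnion (D.mem_neighbors_of_incl_eq hu : (u : Vertex F) ∈ neighbors w) hu.symm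
    refine (Set.Finite.biUnion ((finite_neighbors w).preimage Subtype.val_injective.injOn)
      fun u _ => ?_).subset hsub
    exact (finite_singleton _).preimage (D.incl_injective w).injOn
  have hfin : (range y).Finite := by
    have hc : IsCompact (range y) := C.isCompact.of_isClosed_subset (image_univ ▸ hclosed univ) (by
      rintro _ ⟨v, rfl⟩; exact hx v)
    refine hc.finite ⟨discreteTopology_iff_forall_isClosed.2 fun Z => ?_⟩
    have hZ : Z = Subtype.val ⁻¹' (y '' (y ⁻¹' (Subtype.val '' Z))) := by
      ext ⟨_, v, rfl⟩
      constructor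
      · intro h
        exact ⟨v, ⟨_, h, rfl⟩, rfl⟩
      · rintro ⟨u, ⟨z, hz, hzu⟩, hu⟩
        rwa [Subtype.ext (hzu.trans hu) (a2 := ⟨y v, v, rfl⟩)] at hz
    rw [hZ]
    exact (hclosed _).preimage continuous_subtype_val
  have hfib : ∀ z ∈ range y, {u : Vertex F | ∃ p, D.incl u p = z}.Finite := by
    rintro _ ⟨v, rfl⟩
    exact (finite_neighbors v.1).subset fun u ⟨p, hp⟩ => D.mem_neighbors_of_incl_eq hp
  refine (hfin.biUnion hfib).subset fun v hv => ?_
  exact mem_biUnion (mem_range_self (⟨v, hv⟩ : S)) ⟨_, rfl⟩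

/-! ### The ends defined by the points removed from the tiles -/

theorem isPreconnected_incl_image (v : Vertex F) {P : Set Torus} (hP : IsPreconnected P)
    (hsub : P ⊆ (tileKind F ν v).body \ D.K v) :
    IsPreconnected (D.incl v '' {p | p.1 ∈ P}) := by
  refine IsPreconnected.image ?_ _ (D.incl v).continuous.continuousOn
  have h : IsInducing fun p : D.Tile v => p.1 := IsInducing.subtypeVal
  rw [← h.isPreconnected_image]
  convert hP using 1
  ext p
  constructor
  · rintro ⟨q, hq, rfl⟩; exact hq
  · intro hp; exact ⟨D.mkTile v p (hsub hp), hp, rfl⟩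

theorem isPreconnected_range_incl (v : Vertex F) : IsPreconnected (range (D.incl v)) := by
  convert D.isPreconnected_incl_image v (TileKind.isPreconnected_body_diff (D.K_subset v)) Subset.rfl
    using 1
  rw [← image_univ]
  congr 1
  ext p
  exact ⟨fun _ => p.2, fun _ => trivial⟩

/-- The trace on the surface of the neighborhoods of the point `κ` in the tile. -/
def ptFilter (v : Vertex F) (κ : Torus) : Filter D.W :=
  map (D.incl v) (comap (fun p : D.Tile v => p.1) (𝓝 κ))

theorem exists_collar_of_mem_K {v : Vertex F} {κ : Torus} (h : κ ∈ D.K v) :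
    ∃ s x, κ = (tileKind F ν v).collar s x 0 := by
  have := D.K_subset v h
  rw [TileKind.rim_eq, mem_iUnion] at this
  obtain ⟨s, hs⟩ := this
  rw [TileKind.circle_eq_range] at hs
  obtain ⟨x, rfl⟩ := hs
  exact ⟨s, x, rfl⟩

/-- Small half-disk boxes around `κ` stay connected when `K` is removed, because `K` only occupies
part of their bottom edge. -/
theorem exists_connected_nhds {v : Vertex F} {κ : Torus} (h : κ ∈ D.K v) {N : Set Torus}
    (hN : N ∈ 𝓝 κ) : ∃ O, IsOpen O ∧ κ ∈ O ∧ (tileKind F ν v).body ∩ O ⊆ N ∧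
      IsPreconnected (((tileKind F ν v).body ∩ O) \ D.K v) := by
  obtain ⟨s, x, rfl⟩ := D.exists_collar_of_mem_K h
  have hc := (((tileKind F ν v).continuous_collar s).tendsto (x, 0)) hN
  rw [mem_map, Metric.mem_nhds_iff] at hc
  obtain ⟨δ, hδ, hball⟩ := hc
  have hε : 0 < min δ (1 / 4) := lt_min hδ (by norm_num)
  have hε1 : min δ (1 / 4) ≤ 1 / 4 := min_le_right _ _
  obtain ⟨O, hO, hO'⟩ := (tileKind F ν v).exists_isOpen_box s (α := x - min δ (1 / 4))
    (β := x + min δ (1 / 4)) (r := min δ (1 / 4)) (by linarith) hε.le (by linarith)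
  refine ⟨O, hO, ?_, ?_, ?_⟩
  · have : (tileKind F ν v).collar s x 0 ∈ (tileKind F ν v).body ∩ O := by
      rw [hO']
      exact ⟨(x, 0), ⟨⟨by linarith, by linarith⟩, ⟨le_rfl, hε⟩⟩, rfl⟩
    exact this.2
  · rw [hO']
    rintro _ ⟨⟨θ, t⟩, ⟨h1, h2⟩, rfl⟩
    refine hball ?_
    rw [Metric.mem_ball, Prod.dist_eq, max_lt_iff, Real.dist_eq, Real.dist_eq, abs_lt, abs_lt]
    have := min_le_left δ (1 / 4)
    simp only at h1 h2
    exact ⟨⟨by linarith [h1.1], by linarith [h1.2]⟩, by linarith [h2.1], by linarith [h2.2]⟩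
  · rw [hO']
    exact TileKind.isPreconnected_box_diff (D.K_subset v) isPreconnected_Ioo (by linarith) hε
      Ioo_subset_Ico_self Ico_subset_Icc_self

theorem ptFilter_neBot {v : Vertex F} {κ : Torus} (h : κ ∈ D.K v) : (D.ptFilter v κ).NeBot := by
  refine NeBot.map ?_ _
  rw [comap_neBot_iff]
  intro N hN
  obtain ⟨s, x, rfl⟩ := D.exists_collar_of_mem_K h
  -- The point `κ` is approached along the radial segment of the collar, which at positive depth
  -- avoids `K`.
  have hc : Tendsto (fun t => (tileKind F ν v).collar s x t) (𝓝[>] 0)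
      (𝓝 ((tileKind F ν v).collar s x 0)) :=
    ((((tileKind F ν v).continuous_collar s).comp (by fun_prop : Continuous fun t : ℝ =>
      (x, t))).tendsto 0).mono_left nhdsWithin_le_nhds
  obtain ⟨t, ht, h0, h1⟩ := ((hc.eventually_mem hN).and (Ioo_mem_nhdsGT one_pos)).exists
  refine ⟨D.mkTile v _ ⟨(tileKind F ν v).collar_mem_body s x ⟨h0.le, h1.le⟩, fun hK => ?_⟩, ht⟩
  exact h0.ne' (((tileKind F ν v).collar_mem_rim_iff s ⟨h0.le, h1.le⟩).1 (D.K_subset v hK))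

theorem image_mem_ptFilter {v : Vertex F} {κ : Torus} {O : Set Torus} (hO : O ∈ 𝓝 κ) :
    D.incl v '' {p | p.1 ∈ ((tileKind F ν v).body ∩ O) \ D.K v} ∈ D.ptFilter v κ := by
  refine image_mem_map ?_
  refine mem_of_superset (preimage_mem_comap hO) fun p hp => ?_
  exact ⟨⟨p.2.1, hp⟩, p.2.2⟩

/-- Neighborhoods of the ends defined by the removed points. -/
theorem exists_connected_mem_ptFilter {v : Vertex F} {κ : Torus} (h : κ ∈ D.K v) (C : Compacts D.W) :
    ∃ O, IsOpen O ∧ κ ∈ O ∧ ∃ Z, IsPreconnected Z ∧ Z ⊆ (C : Set D.W)ᶜ ∧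
      ∀ κ' ∈ O, Z ∈ D.ptFilter v κ' := by
  obtain ⟨O, hO, hκ, hsub, hconn⟩ := D.exists_connected_nhds h
    ((D.isClosed_trace_compact v C).isOpen_compl.mem_nhds (x := κ) (by
      rintro ⟨p, -, rfl⟩; exact p.2.2 h))
  refine ⟨O, hO, hκ, _, D.isPreconnected_incl_image v hconn (sdiff_subset_sdiff_left inter_subset_left),
    ?_, fun κ' h' => D.image_mem_ptFilter (hO.mem_nhds h')⟩
  rintro _ ⟨p, hp, rfl⟩ hC
  exact hsub hp.1 ⟨p, hC, rfl⟩

theorem exists_ptEnd (v : Vertex F) (κ : D.K v) : ∃ e, EndLim (D.ptFilter v κ) e := by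
  have := D.ptFilter_neBot κ.2
  refine Ends.exists_endLim fun C => ?_
  obtain ⟨O, -, hκ, Z, h1, h2, h3⟩ := D.exists_connected_mem_ptFilter κ.2 C
  exact ⟨Z, h3 κ hκ, h1, h2⟩

/-- The end of the surface defined by a point removed from a tile. -/
noncomputable def ptEnd (v : Vertex F) (κ : D.K v) : Ends D.W := (D.exists_ptEnd v κ).choose

theorem endLim_ptEnd (v : Vertex F) (κ : D.K v) : EndLim (D.ptFilter v κ) (D.ptEnd v κ) :=
  (D.exists_ptEnd v κ).choose_spec

/-- The same connected set avoiding `C` is a neighborhood of the ends of all removed points close to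
`κ`. -/
theorem continuous_ptEnd (v : Vertex F) : Continuous (D.ptEnd v) := by
  rw [continuous_iff_continuousAt]
  intro κ
  rw [Ends.continuousAt_iff]
  intro C
  obtain ⟨O, hO, hκ, Z, h1, h2, h3⟩ := D.exists_connected_mem_ptFilter κ.2 C
  filter_upwards [(hO.preimage continuous_subtype_val).mem_nhds hκ] with κ' h'
  have hne : ∀ κ' : D.K v, (κ' : Torus) ∈ O → ((D.ptEnd v κ').comp C ∩ Z).Nonempty := fun κ' h' => by
    have := D.ptFilter_neBot κ'.2
    exact (D.ptFilter v κ').nonempty_of_mem (inter_mem (D.endLim_ptEnd v κ' C) (h3 κ' h'))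
  exact Ends.comp_eq_of_connected _ _ h1 h2 (hne κ' h') (hne κ hκ)

/-- A path in the tile converging to `κ` converges to the end defined by `κ`. -/
theorem convergesToEnd_ptEnd {v : Vertex F} (κ : D.K v) {α : Type} {l : Filter α}
    {g : α → D.Tile v} (hg : Tendsto (fun t => (g t).1) l (𝓝 κ)) :
    ConvergesToEnd (fun t => D.incl v (g t)) l (D.ptEnd v κ) := by
  rw [convergesToEnd_iff]
  refine (D.endLim_ptEnd v κ).mono ?_
  exact tendsto_map.comp (tendsto_comap_iff.2 hg)

/-! ### The ends of the rays -/

theorem rayEdge_parent (f : F) (n : ℕ) : (rayEdge f n).parent = rayVertexF f n := rfl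

theorem rayEdge_child (f : F) (n : ℕ) : (rayEdge f n).child = rayVertexF f (n + 1) := rfl

theorem range_incl_inter_nonempty (e : Edge F) :
    (range (D.incl e.parent) ∩ range (D.incl e.child)).Nonempty := by
  obtain ⟨x, hx⟩ := (D.isComp_atChild e).nonempty
  refine ⟨D.incl e.child (D.arcIncl _ (D.isComp_atChild e) ⟨x, hx⟩), ⟨D.arcIncl _ (D.isComp_atParent e)
    (D.glue e ⟨x, hx⟩), ?_⟩, ⟨_, rfl⟩⟩
  exact (D.incl_glue e ⟨x, hx⟩ rfl rfl).symm

/-- The filter generated by the unions of the tiles of the tails of a ray. -/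
def rayFilter (f : F) : Filter D.W :=
  atTop.bind fun n => 𝓟 (range (D.incl (rayVertexF f n)))

theorem mem_rayFilter {f : F} {S : Set D.W} :
    S ∈ D.rayFilter f ↔ ∀ᶠ n in atTop, range (D.incl (rayVertexF f n)) ⊆ S := Iff.rfl

theorem range_incl_nonempty (v : Vertex F) : (range (D.incl v)).Nonempty := by
  let θ := (tileKind F ν v).collar .outer 0 1
  exact ⟨_, D.mkTile v θ ⟨(tileKind F ν v).collar_one_mem_body _ _,
    TileKind.collar_one_notMem (D.K_subset v) 0⟩, rfl⟩

instance rayFilter_neBot (f : F) : (D.rayFilter f).NeBot := by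
  rw [← forall_mem_nonempty_iff_neBot]
  intro S hS
  obtain ⟨n, hn⟩ := (D.mem_rayFilter.1 hS).exists
  exact (D.range_incl_nonempty _).mono hn

theorem rayVertexF_injective (f : F) : Function.Injective (rayVertexF f) := by
  have hlen : ∀ n, (rayVertex f n).length = n := fun n => by
    induction n with
    | zero => rfl
    | succ n ih => simp [rayVertex, ih]
  intro m n h
  have := congrArg (fun v : Vertex F => v.1.length) h
  simpa [rayVertexF, hlen] using this

theorem eventually_ray_disjoint (f : F) (C : Compacts D.W) :
    ∃ N, ∀ n ≥ N, range (D.incl (rayVertexF f n)) ⊆ (C : Set D.W)ᶜ := by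
  have h := (D.finite_tiles C).preimage (rayVertexF_injective f).injOn
  obtain ⟨N, hN⟩ := h.bddAbove
  refine ⟨N + 1, fun n hn => ?_⟩
  rintro _ ⟨p, rfl⟩ hC
  have : n ≤ N := hN (show n ∈ rayVertexF f ⁻¹' {v | ∃ p, D.incl v p ∈ C} from ⟨p, hC⟩)
  omega

theorem isPreconnected_ray_tail (f : F) (N : ℕ) :
    IsPreconnected (⋃ n, range (D.incl (rayVertexF f (N + n)))) := by
  refine IsPreconnected.iUnion_of_chain (fun n => D.isPreconnected_range_incl _) fun n => ?_
  exact D.range_incl_inter_nonempty (rayEdge f (N + n))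

/-- The tail of a ray of tiles is connected, since consecutive tiles meet, and it avoids any given
compact set when it starts late enough. -/
theorem exists_rayEnd (f : F) : ∃ e, EndLim (D.rayFilter f) e := by
  refine Ends.exists_endLim fun C => ?_
  obtain ⟨N, hN⟩ := D.eventually_ray_disjoint f C
  refine ⟨_, ?_, D.isPreconnected_ray_tail f N, iUnion_subset fun n => hN _ (by omega)⟩
  rw [mem_rayFilter]
  filter_upwards [eventually_ge_atTop N] with n hn
  obtain ⟨m, rfl⟩ := Nat.exists_eq_add_of_le hn
  exact subset_iUnion (fun n => range (D.incl (rayVertexF f (N + n)))) m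

/-- The end of the surface defined by a point of `F`. -/
noncomputable def rayEnd (f : F) : Ends D.W := (D.exists_rayEnd f).choose

theorem endLim_rayEnd (f : F) : EndLim (D.rayFilter f) (D.rayEnd f) := (D.exists_rayEnd f).choose_spec

theorem isEndOfRay_rayEnd (f : F) : D.IsEndOfRay f (D.rayEnd f) := fun C =>
  D.mem_rayFilter.1 (D.endLim_rayEnd f C)

end Realization

/-! ### Isolating boxes and the limit points of boundary components -/

namespace TileKind

variable {k : TileKind} {s : Side} {K : Set Torus}

/-- A box around the point `κ` of `K`, the frontier of which avoids `K`. -/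
structure IsIsolatingBox (k : TileKind) (K B B' : Set Torus) (κ : Torus) : Prop where
  subset : B ⊆ B'
  isOpen : ∃ O, IsOpen O ∧ k.body ∩ O = B
  isCompact : IsCompact B'
  disjoint : Disjoint (B' \ B) K
  mem : κ ∈ B

theorem mem_box_iff_of_mem_rim {I J : Set ℝ} (hJ : J ⊆ Icc 0 1) (h0 : (0 : ℝ) ∈ J) {p : Torus}
    (hp : p ∈ k.rim) : p ∈ k.box s I J ↔ p ∈ k.arc s I :=
  ⟨mem_arc_of_mem_rim hJ hp, fun h => arc_subset_box h0 h⟩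

/-- `K` lies on the rim, so it could meet the frontier of the box only at the two points of the
circle with angles `α` and `β`. -/
theorem isIsolatingBox (hK : K ⊆ k.rim) {α β : ℝ} (hα : α ∉ k.angles K s) (hβ : β ∉ k.angles K s)
    (hαβ : β < α + 1) {κ : Torus} (hκ : κ ∈ k.arc s (Ioo α β)) :
    k.IsIsolatingBox K (k.box s (Ioo α β) (Ico 0 1)) (k.box s (Icc α β) (Icc 0 1)) κ := by
  refine ⟨image_mono (prod_mono Ioo_subset_Icc_self Ico_subset_Icc_self),
    k.exists_isOpen_box s hαβ zero_le_one le_rfl, k.isCompact_box s isCompact_Icc isCompact_Icc, ?_,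
    arc_subset_box (by simp) hκ⟩
  rw [disjoint_left]
  rintro p ⟨h1, h2⟩ hp
  rw [mem_box_iff_of_mem_rim Subset.rfl (by simp) (hK hp)] at h1
  rw [mem_box_iff_of_mem_rim Ico_subset_Icc_self (by simp) (hK hp)] at h2
  obtain ⟨θ, hθ, rfl⟩ := h1
  refine h2 ⟨θ, ⟨hθ.1.lt_of_ne ?_, hθ.2.lt_of_ne ?_⟩, rfl⟩
  · rintro rfl; exact hα hp
  · rintro rfl; exact hβ hp

variable (hK : K ⊆ k.rim) (hC : ∀ s, IsCantorSet (K ∩ k.circle s))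
include hK hC

/-- The common end of two gaps would be an isolated point of the Cantor set. -/
theorem not_adjacent_gaps {a b c : ℝ} (h : k.IsGap K s a b) : ¬ k.IsGap K s b c := fun h' => by
  obtain ⟨y, hy, hne, hy'⟩ := exists_ne_mem_angles hK hC h.right_mem
    (lt_min (sub_pos.2 h.lt) (sub_pos.2 h'.lt))
  rcases hne.lt_or_gt with hlt | hlt
  · exact h.disj y ⟨by linarith [hy'.1, min_le_left (b - a) (c - b)], hlt⟩ hy
  · exact h'.disj y ⟨hlt, by linarith [hy'.2, min_le_right (b - a) (c - b)]⟩ hy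

/-- Different boundary components have no common ends. -/
theorem IsBoundaryComponent.eq_of_mem_closure {A B : Set Torus} (hA : k.IsBoundaryComponent K A)
    (hB : k.IsBoundaryComponent K B) {κ : Torus} (hκ : κ ∈ K) (h1 : κ ∈ closure A)
    (h2 : κ ∈ closure B) : A = B := by
  have key : ∀ {A : Set Torus}, k.IsBoundaryComponent K A → κ ∈ closure A →
      ∃ s a b, k.IsGap K s a b ∧ A = k.arc s (Ioo a b) ∧
        (κ = k.collar s a 0 ∨ κ = k.collar s b 0) := by
    intro A hA h
    obtain ⟨s, a, b, hg, rfl⟩ := (isBoundaryComponent_iff hK hC).1 hA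
    refine ⟨s, a, b, hg, rfl, ?_⟩
    have h' : κ ∈ k.arc s (Icc a b) := closure_minimal (arc_mono Ioo_subset_Icc_self)
      (isCompact_arc isCompact_Icc).isClosed h
    obtain ⟨θ, hθ, rfl⟩ := h'
    by_contra! hc
    exact hg.disj θ ⟨hθ.1.lt_of_ne fun h => hc.1 (by rw [h]), hθ.2.lt_of_ne fun h =>
      hc.2 (by rw [h])⟩ hκ
  obtain ⟨s, a, b, hg, rfl, hab⟩ := key hA h1
  obtain ⟨s', a', b', hg', rfl, hab'⟩ := key hB h2
  have hs : k.collar s = k.collar s' := by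
    refine (k.collar_eq_or_disjoint s s').resolve_right fun h => ?_
    rcases hab with rfl | rfl <;> rcases hab' with h' | h' <;>
      exact h _ _ 0 (by simp) 0 (by simp) h'
  have harc : ∀ I, k.arc s' I = k.arc s I := fun I => by simp only [arc, hs]
  have hgap : ∀ {a b}, k.IsGap K s' a b → k.IsGap K s a b := fun h => by
    have : k.angles K s' = k.angles K s := by simp only [angles, hs]
    obtain ⟨h1, h2, h3, h4, h5⟩ := h
    rw [this] at h3 h4 h5
    exact ⟨h1, h2, h3, h4, h5⟩
  have hg' := hgap hg'
  rw [← hs] at hab'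
  rw [harc]
  have h0 : (0 : ℝ) ∈ Icc (0 : ℝ) 1 := by simp
  have fin : ∀ {a b c d x : ℝ}, k.IsGap K s a b → k.IsGap K s c d → x ∈ Ioo a b → x ∈ Ioo c d →
      k.arc s (Ioo a b) = k.arc s (Ioo c d) := fun g g' h h' =>
    g.isBoundaryComponent.eq_of_mem g'.isBoundaryComponent ⟨_, h, rfl⟩ ⟨_, h', rfl⟩
  -- If `κ` is the left end of both gaps, or the right end of both, then after an integer
  -- translation they overlap and so coincide. If it is the right end of one and the left end of the
  -- other, the gaps are adjacent, which is impossible.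
  rcases hab with rfl | rfl <;> rcases hab' with h' | h'
  · obtain ⟨-, n, hn⟩ := k.collar_inj s h0 h0 h'.symm
    have hg2 := hg'.add_int n
    rw [← arc_add_int a' b' n]
    rw [← hn] at hg2 ⊢
    obtain ⟨x, h1, h2⟩ := exists_between (lt_min hg.lt hg2.lt)
    exact fin hg hg2 ⟨h1, h2.trans_le (min_le_left _ _)⟩ ⟨h1, h2.trans_le (min_le_right _ _)⟩
  · obtain ⟨-, n, hn⟩ := k.collar_inj s h0 h0 h'.symm
    have hg2 := hg'.add_int n
    rw [← hn] at hg2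
    exact (not_adjacent_gaps hK hC hg2 hg).elim
  · obtain ⟨-, n, hn⟩ := k.collar_inj s h0 h0 h'.symm
    have hg2 := hg'.add_int n
    rw [← hn] at hg2
    exact (not_adjacent_gaps hK hC hg hg2).elim
  · obtain ⟨-, n, hn⟩ := k.collar_inj s h0 h0 h'.symm
    have hg2 := hg'.add_int n
    rw [← arc_add_int a' b' n]
    rw [← hn] at hg2 ⊢
    obtain ⟨x, h1, h2⟩ := exists_between (max_lt hg.lt hg2.lt)
    exact fin hg hg2 ⟨(le_max_left _ _).trans_lt h1, h2⟩ ⟨(le_max_right _ _).trans_lt h1, h2⟩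

/-- A point of `K` adherent to a boundary component is the limit of a parametrization. -/
theorem IsBoundaryComponent.exists_param {A : Set Torus} (hA : k.IsBoundaryComponent K A)
    {κ : Torus} (hκ : κ ∈ K) (h : κ ∈ closure A) :
    ∃ l : ℝ ≃ₜ A, Tendsto (fun t => (l t : Torus)) atTop (𝓝 κ) := by
  obtain ⟨s, a, b, hg, rfl⟩ := (isBoundaryComponent_iff hK hC).1 hA
  have h' : κ ∈ k.arc s (Icc a b) := closure_minimal (arc_mono Ioo_subset_Icc_self)
    (isCompact_arc isCompact_Icc).isClosed h
  obtain ⟨θ, hθ, rfl⟩ := h'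
  obtain ⟨l, h1, h2⟩ := exists_arc_param (k := k) (s := s) hg.lt hg.lt_add_one
  rcases hθ.1.eq_or_lt with rfl | h3
  · exact ⟨(Homeomorph.neg ℝ).trans l, h1.comp tendsto_neg_atTop_atBot⟩
  · rcases hθ.2.eq_or_lt with rfl | h4
    · exact ⟨l, h2⟩
    · exact (hg.disj θ ⟨h3, h4⟩ hκ).elim

/-- Any parametrization of a boundary component converges to two different points of `K`. -/
theorem IsBoundaryComponent.exists_limits {A : Set Torus} (hA : k.IsBoundaryComponent K A)
    (l : ℝ ≃ₜ A) : ∃ κ₀ ∈ K, ∃ κ₁ ∈ K, κ₀ ≠ κ₁ ∧ Tendsto (fun t => (l t : Torus)) atBot (𝓝 κ₀) ∧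
      Tendsto (fun t => (l t : Torus)) atTop (𝓝 κ₁) := by
  obtain ⟨s, a, b, hg, rfl⟩ := (isBoundaryComponent_iff hK hC).1 hA
  have hne : k.collar s a 0 ≠ k.collar s b 0 := fun h => by
    have := (mem_arc_iff (k := k) (s := s) (α := a) (I := {b})
      (singleton_subset_iff.2 ⟨hg.lt.le, hg.lt_add_one⟩) ⟨le_rfl, by linarith⟩).1
      ⟨b, mem_singleton _, h.symm⟩
    exact hg.lt.ne (mem_singleton_iff.1 this)
  rcases arc_ends hg.lt_add_one l with h | h
  · exact ⟨_, hg.left_mem, _, hg.right_mem, hne, h⟩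
  · exact ⟨_, hg.right_mem, _, hg.left_mem, hne.symm, h⟩

end TileKind

/-! ### Which removed points define the same end -/

namespace Realization

variable {F : Set (ℕ → Bool)} {ν : Vertex F → Bool} (D : Realization F ν)

/-- The boundary components of a tile which are glued. -/
def gluedArcs (v : Vertex F) : Set (Set Torus) :=
  {A | ∃ e : Edge F, (e.child = v ∧ A = D.atChild e) ∨ (e.parent = v ∧ A = D.atParent e)}

theorem finite_gluedArcs (v : Vertex F) : (D.gluedArcs v).Finite := by
  have h1 : {e : Edge F | e.child = v}.Finite :=
    Set.Subsingleton.finite fun e he e' he' => Edge.ext_of_child (he.trans he'.symm)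
  have h2 : {e : Edge F | e.parent = v}.Finite :=
    Set.Finite.of_finite_image (f := Edge.dir) (toFinite _)
      fun e he e' he' h => Edge.ext_of_parent (he.trans he'.symm) h
  refine ((h1.image D.atChild).union (h2.image D.atParent)).subset ?_
  rintro A ⟨e, ⟨h, rfl⟩ | ⟨h, rfl⟩⟩
  exacts [Or.inl ⟨e, h, rfl⟩, Or.inr ⟨e, h, rfl⟩]

theorem isBoundaryComponent_of_mem_gluedArcs {v : Vertex F} {A : Set Torus} (h : A ∈ D.gluedArcs v) :
    (tileKind F ν v).IsBoundaryComponent (D.K v) A := by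
  obtain ⟨e, ⟨rfl, rfl⟩ | ⟨rfl, rfl⟩⟩ := h
  exacts [D.isComp_atChild e, D.isComp_atParent e]

/-- The points `κ` and `κ'` of the tiles of the child and of the parent are the limits of a ray
in the arc along which these tiles are glued. -/
def GluedEnds (e : Edge F) (κ κ' : Torus) : Prop :=
  ∃ l : ℝ ≃ₜ D.atChild e, Tendsto (fun t => (l t : Torus)) atTop (𝓝 κ) ∧
    Tendsto (fun t => (D.glue e (l t) : Torus)) atTop (𝓝 κ')

/-- The points `κ` and `κ'` define the same end because the tiles are glued along an arc ending
at these points. -/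
def Matched (v : Vertex F) (κ : Torus) (w : Vertex F) (κ' : Torus) : Prop :=
  ∃ e : Edge F, (v = e.child ∧ w = e.parent ∧ D.GluedEnds e κ κ') ∨
    (v = e.parent ∧ w = e.child ∧ D.GluedEnds e κ' κ)

/-- The path `l` in the glued arc is a single path in `W`, seen from both tiles, and it converges to
both ends. -/
theorem GluedEnds.ptEnd_eq {e : Edge F} {κ : D.K e.child} {κ' : D.K e.parent}
    (h : D.GluedEnds e κ κ') : D.ptEnd e.child κ = D.ptEnd e.parent κ' := by
  obtain ⟨l, h1, h2⟩ := h
  have c1 := D.convergesToEnd_ptEnd κ (g := fun t => D.arcIncl _ (D.isComp_atChild e) (l t)) h1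
  have c2 := D.convergesToEnd_ptEnd κ'
    (g := fun t => D.arcIncl _ (D.isComp_atParent e) (D.glue e (l t))) h2
  have hfun : (fun t => D.incl e.child (D.arcIncl _ (D.isComp_atChild e) (l t))) =
      fun t => D.incl e.parent (D.arcIncl _ (D.isComp_atParent e) (D.glue e (l t))) :=
    funext fun t => D.incl_glue e (l t) rfl rfl
  rw [← hfun] at c2
  exact Ends.eq_of_endLim (convergesToEnd_iff.1 c1) (convergesToEnd_iff.1 c2)

/-- Families of boxes isolating an end. -/
structure IsIsolation (A B : Vertex F → Set Torus) (v : Vertex F) (κ : Torus) : Prop where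
  compatible : D.Compatible A
  compatible' : D.Compatible B
  subset : ∀ w, A w ⊆ B w
  isOpen : ∀ w, ∃ O, IsOpen O ∧ (tileKind F ν w).body ∩ O = A w
  isCompact : ∀ w, IsCompact (B w)
  disjoint : ∀ w, Disjoint (B w \ A w) (D.K w)
  finite : {w | (B w).Nonempty}.Finite
  mem : κ ∈ A v

variable {D} in
-- The differences `B w \ A w` avoid the removed points and finitely many are nonempty, so their
-- union in `W` is compact. Its complement is covered by two disjoint open sets, the one assembled
-- from `A`, near `κ`, and the complement of the one assembled from `B`, in which `l` lies.
theorem IsIsolation.ne {A B : Vertex F → Set Torus} {v : Vertex F} {κ : D.K v}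
    (h : D.IsIsolation A B v κ) {l : Filter D.W} [l.NeBot] {e : Ends D.W} (hl : EndLim l e)
    (hB : D.assemble (fun w => (B w)ᶜ) ∈ l) : D.ptEnd v κ ≠ e := by
  have hAo : ∀ w, IsOpen {p : D.Tile w | p.1 ∈ A w} := fun w => by
    obtain ⟨O, hO, hO'⟩ := h.isOpen w
    convert hO.preimage (D.continuous_val w) using 1
    ext p
    rw [← hO']
    exact and_iff_right p.2.1
  have hemb : ∀ w, IsInducing fun p : D.Tile w => p.1 := fun w => IsInducing.subtypeVal
  have hcomp : ∀ w, IsCompact {p : D.Tile w | p.1 ∈ B w \ A w} := fun w => by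
    rw [(hemb w).isCompact_iff]
    obtain ⟨O, hO, hO'⟩ := h.isOpen w
    convert ((h.isCompact w).inter_right (tileKind F ν w).isClosed_body).inter_right
      hO.isClosed_compl using 1
    ext p
    constructor
    · rintro ⟨q, hq, rfl⟩
      refine ⟨⟨hq.1, q.2.1⟩, fun hqO => hq.2 ?_⟩
      rw [← hO']
      exact ⟨q.2.1, hqO⟩
    · rintro ⟨⟨h1, h2⟩, h3⟩
      have h4 : p ∉ A w := fun hp => h3 (hO'.symm ▸ hp : p ∈ (tileKind F ν w).body ∩ O).2
      exact ⟨D.mkTile w p ⟨h2, disjoint_left.1 (h.disjoint w) ⟨h1, h4⟩⟩, ⟨h1, h4⟩, rfl⟩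
  let C : Compacts D.W := ⟨⋃ w ∈ {w | (B w).Nonempty}, D.incl w '' {p | p.1 ∈ B w \ A w},
    h.finite.isCompact_biUnion fun w _ => (hcomp w).image (D.incl w).continuous⟩
  have hne := D.ptFilter_neBot κ.2
  intro he
  refine Ends.comp_ne_of_separation (D.endLim_ptEnd v κ) hl (K := C) (h.compatible.isOpen_assemble hAo)
    (h.compatible'.compl.isOpen_assemble fun w =>
      ((h.isCompact w).isClosed.preimage (D.continuous_val w)).isOpen_compl) ?_ ?_ ?_ hB (by rw [he])
  · rw [disjoint_left]
    intro x h1 h2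
    obtain ⟨w, p, rfl⟩ := D.exists_incl x
    rw [h.compatible.mem_assemble] at h1
    rw [h.compatible'.compl.mem_assemble] at h2
    exact h2 (h.subset w h1)
  · intro x hx
    obtain ⟨w, p, rfl⟩ := D.exists_incl x
    by_cases h1 : p.1 ∈ A w
    · exact Or.inl (h.compatible.mem_assemble.2 h1)
    · by_cases h2 : p.1 ∈ B w
      · exact (hx (mem_biUnion (show w ∈ {w | (B w).Nonempty} from ⟨_, h2⟩)
          ⟨p, ⟨h2, h1⟩, rfl⟩)).elim
      · exact Or.inr (h.compatible'.compl.mem_assemble.2 h2)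
  · obtain ⟨O, hO, hO'⟩ := h.isOpen v
    have hκO : (κ : Torus) ∈ O := (hO'.symm ▸ h.mem : (κ : Torus) ∈ (tileKind F ν v).body ∩ O).2
    refine mem_of_superset (D.image_mem_ptFilter (hO.mem_nhds hκO)) ?_
    rintro _ ⟨p, hp, rfl⟩
    rw [h.compatible.mem_assemble, ← hO']
    exact hp.1

/-- An end defined by a removed point that is not the end of a glued arc has a neighborhood
contained in a single tile. -/
theorem exists_isolation_of_notMem {v : Vertex F} {κ : Torus} (hκ : κ ∈ D.K v)
    (hκ' : ∀ A ∈ D.gluedArcs v, κ ∉ closure A) (R : Vertex F → Set Torus)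
    (hR : ∀ w, IsClosed (R w)) (hRK : ∀ w, R w ⊆ D.K w) (hκR : κ ∉ R v) :
    ∃ A B, D.IsIsolation A B v κ ∧ ∀ w, Disjoint (B w) (R w) := by
  classical
  -- A box avoiding the glued arcs is a compatible family with all other tiles left empty.
  set Q := (⋃ A ∈ D.gluedArcs v, closure A) ∪ R v with hQdef
  have hQ : IsClosed Q :=
    ((D.finite_gluedArcs v).isClosed_biUnion fun _ _ => isClosed_closure).union (hR v)
  have hκQ : κ ∉ Q := by
    rintro (h | h)
    · obtain ⟨A, hA, h⟩ := mem_iUnion₂.1 h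
      exact hκ' A hA h
    · exact hκR h
  obtain ⟨s, x, rfl⟩ := D.exists_collar_of_mem_K hκ
  obtain ⟨α, β, h1, h2, h3, h4, h5, h6⟩ := TileKind.exists_isolating_Icc (D.K_cantor v) hQ hκQ
  have hbox := TileKind.isIsolatingBox (D.K_subset v) h4 h5 h3 ⟨x, ⟨h1, h2⟩, rfl⟩
  set B := (tileKind F ν v).box s (Ioo α β) (Ico 0 1)
  set B' := (tileKind F ν v).box s (Icc α β) (Icc 0 1) with hB'
  have hBQ : ∀ p ∈ (tileKind F ν v).rim, p ∈ B' → p ∉ Q := fun p hp hpB =>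
    disjoint_left.1 h6 ((TileKind.mem_box_iff_of_mem_rim Subset.rfl (by simp) hp).1 hpB)
  have hglued : ∀ A ∈ D.gluedArcs v, ∀ p ∈ A, p ∉ B' := fun A hA p hp hpB =>
    hBQ p ((D.isBoundaryComponent_of_mem_gluedArcs hA).subset hp).1 hpB
      (Or.inl (mem_biUnion hA (subset_closure hp)))
  have hcompat : ∀ P ⊆ B', D.Compatible fun w => if w = v then P else ∅ := by
    intro P hP e x
    have c1 : (x : Torus) ∉ (if e.child = v then P else ∅) := by
      split_ifs with h
      · exact fun hx => hglued _ ⟨e, Or.inl ⟨h, rfl⟩⟩ x x.2 (hP hx)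
      · exact notMem_empty _
    have c2 : (D.glue e x : Torus) ∉ (if e.parent = v then P else ∅) := by
      split_ifs with h
      · exact fun hx => hglued _ ⟨e, Or.inr ⟨h, rfl⟩⟩ _ (D.glue e x).2 (hP hx)
      · exact notMem_empty _
    exact iff_of_false c1 c2
  refine ⟨fun w => if w = v then B else ∅, fun w => if w = v then B' else ∅,
    ⟨hcompat B hbox.subset, hcompat B' Subset.rfl, fun w => ?_, fun w => ?_, fun w => ?_, fun w => ?_,
      (finite_singleton v).subset fun w hw => ?_, ?_⟩, fun w => ?_⟩
  · split_ifs
    exacts [hbox.subset, Subset.rfl]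
  · split_ifs with h
    · rw [h]; exact hbox.isOpen
    · exact ⟨∅, isOpen_empty, inter_empty _⟩
  · split_ifs
    exacts [hbox.isCompact, isCompact_empty]
  · split_ifs with h
    · rw [h]; exact hbox.disjoint
    · simp
  · by_contra h
    simp only [mem_ofPred_eq, if_neg (show w ≠ v from h)] at hw
    exact not_nonempty_empty hw
  · simp only [if_pos]; exact hbox.mem
  · dsimp only
    split_ifs with h
    · rw [h, disjoint_left]
      exact fun p hp hpR => hBQ p (D.K_subset v (hRK v hpR)) hp (Or.inr hpR)
    · exact empty_disjoint _

/-- An end defined by the ends of a glued arc has a neighborhood contained in two tiles. -/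
theorem exists_isolation_of_gluedEnds {e : Edge F} {κ κ' : Torus} (hκ : κ ∈ D.K e.child)
    (hκ' : κ' ∈ D.K e.parent) (h : D.GluedEnds e κ κ') (R : Vertex F → Set Torus)
    (hR : ∀ w, IsClosed (R w)) (hRK : ∀ w, R w ⊆ D.K w) (hκR : κ ∉ R e.child)
    (hκR' : κ' ∉ R e.parent) :
    ∃ A B, D.IsIsolation A B e.child κ ∧ ∀ w, Disjoint (B w) (R w) := by
  classical
  obtain ⟨l, hl, hl'⟩ := h
  -- the data on each of the two sides
  have side : ∀ (v : Vertex F) (E : Set Torus), E ∈ D.gluedArcs v → ∀ (l : ℝ ≃ₜ E) (κ : Torus),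
      κ ∈ D.K v → Tendsto (fun t => (l t : Torus)) atTop (𝓝 κ) → κ ∉ R v →
      ∃ T, ∀ t₀ ≥ T, ∃ B B', (tileKind F ν v).IsIsolatingBox (D.K v) B B' κ ∧ Disjoint B' (R v) ∧
        (∀ A ∈ D.gluedArcs v, A ≠ E → Disjoint A B') ∧
        ∀ t, ((l t : Torus) ∈ B ↔ t₀ < t) ∧ ((l t : Torus) ∈ B' ↔ t₀ ≤ t) := by
    intro v E hE l κ hκ hl hκR
    have hEc := D.isBoundaryComponent_of_mem_gluedArcs hE
    obtain ⟨s, a, b, hg, rfl⟩ := (D.isBoundaryComponent_iff v).1 hEc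
    set Q := (⋃ A ∈ D.gluedArcs v \ {(tileKind F ν v).arc s (Ioo a b)}, closure A) ∪ R v
    have hQ : IsClosed Q :=
      ((D.finite_gluedArcs v).sdiff.isClosed_biUnion fun _ _ => isClosed_closure).union (hR v)
    have hκQ : κ ∉ Q := by
      rintro (h | h)
      · obtain ⟨A, hA, h⟩ := mem_iUnion₂.1 h
        refine hA.2 ((D.isBoundaryComponent_of_mem_gluedArcs hA.1).eq_of_mem_closure (D.K_subset v)
          (D.K_cantor v) hEc hκ h ?_)
        exact mem_closure_of_tendsto hl (Eventually.of_forall fun t => (l t).2)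
      · exact hκR h
    obtain ⟨T, hT⟩ := TileKind.exists_isolating_Icc_of_arc (D.K_cantor v) hg l hl hQ hκQ
    refine ⟨T, fun t₀ ht₀ => ?_⟩
    obtain ⟨α, β, h1, h2, h3, h4, h5, h6⟩ := hT t₀ ht₀
    have hrim : ∀ p ∈ (tileKind F ν v).rim, p ∈ (tileKind F ν v).box s (Icc α β) (Icc 0 1) →
        p ∉ Q := fun p hp hpB =>
      disjoint_left.1 h5 ((TileKind.mem_box_iff_of_mem_rim Subset.rfl (by simp) hp).1 hpB)
    refine ⟨_, _, TileKind.isIsolatingBox (D.K_subset v) h2 h3 h1 h4, ?_, ?_, fun t => ?_⟩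
    · rw [disjoint_left]
      exact fun p hp hpR => hrim p (D.K_subset v (hRK v hpR)) hp (Or.inr hpR)
    · intro A hA hne
      rw [disjoint_left]
      exact fun p hp hpB => hrim p ((D.isBoundaryComponent_of_mem_gluedArcs hA).subset hp).1 hpB
        (Or.inl (mem_biUnion (show A ∈ D.gluedArcs v \ {_} from ⟨hA, hne⟩) (subset_closure hp)))
    · have hlt := (hEc.subset (l t).2).1
      rw [TileKind.mem_box_iff_of_mem_rim Ico_subset_Icc_self (by simp) hlt,
        TileKind.mem_box_iff_of_mem_rim Subset.rfl (by simp) hlt]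
      exact h6 t
  obtain ⟨T, hT⟩ := side e.child (D.atChild e) ⟨e, Or.inl ⟨rfl, rfl⟩⟩ l κ hκ hl hκR
  obtain ⟨T', hT'⟩ := side e.parent (D.atParent e) ⟨e, Or.inr ⟨rfl, rfl⟩⟩ (l.trans (D.glue e)) κ' hκ'
    hl' hκR'
  -- Both boxes are cut at the same parameter of the arc, so they meet it in the same ray, up to the
  -- gluing map; this is the compatibility along `e`. Along any other edge the arcs miss both boxes.
  obtain ⟨B, B', hB, hBR, hBA, hBl⟩ := hT (max T T') (le_max_left _ _)
  obtain ⟨P, P', hP, hPR, hPA, hPl⟩ := hT' (max T T') (le_max_right _ _)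
  have hne := e.child_ne_parent
  have hcompat : ∀ S S' : Set Torus, S ⊆ B' → S' ⊆ P' →
      (∀ x : D.atChild e, (x : Torus) ∈ S ↔ (D.glue e x : Torus) ∈ S') →
      D.Compatible fun w => if w = e.child then S else if w = e.parent then S' else ∅ := by
    intro S S' hS hS' hSS' e' x
    by_cases he : e' = e
    · subst he
      simp only [if_pos, if_neg hne.symm]
      exact hSS' x
    have c1 : (x : Torus) ∉ if e'.child = e.child then S else if e'.child = e.parent then S' else ∅ := by
      rw [if_neg fun h => he (Edge.ext_of_child h)]
      split_ifs with h
      · refine fun hx => disjoint_left.1 (hPA (D.atChild e') ⟨e', Or.inl ⟨h, rfl⟩⟩ ?_) x.2 (hS' hx)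
        exact D.child_ne_parent e' e h
      · exact notMem_empty _
    have c2 : (D.glue e' x : Torus) ∉
        if e'.parent = e.child then S else if e'.parent = e.parent then S' else ∅ := by
      split_ifs with h h
      · refine fun hx => disjoint_left.1 (hBA (D.atParent e') ⟨e', Or.inr ⟨h, rfl⟩⟩ ?_)
          (D.glue e' x).2 (hS hx)
        exact (D.child_ne_parent e e' h.symm).symm
      · refine fun hx => disjoint_left.1 (hPA (D.atParent e') ⟨e', Or.inr ⟨h, rfl⟩⟩ ?_)
          (D.glue e' x).2 (hS' hx)
        exact fun h' => he (D.edge_eq_of_mem_atParent h (D.glue e' x).2 (h' ▸ (D.glue e' x).2))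
      · exact notMem_empty _
    exact iff_of_false c1 c2
  have hx : ∀ x : D.atChild e, ∃ t, l t = x := l.surjective
  refine ⟨fun w => if w = e.child then B else if w = e.parent then P else ∅,
    fun w => if w = e.child then B' else if w = e.parent then P' else ∅,
    ⟨hcompat B P hB.subset hP.subset fun x => ?_, hcompat B' P' Subset.rfl Subset.rfl fun x => ?_,
      fun w => ?_, fun w => ?_, fun w => ?_, fun w => ?_,
      ((toFinite {e.child, e.parent}).subset fun w hw => ?_), ?_⟩, fun w => ?_⟩
  · obtain ⟨t, rfl⟩ := hx x
    exact (hBl t).1.trans (hPl t).1.symm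
  · obtain ⟨t, rfl⟩ := hx x
    exact (hBl t).2.trans (hPl t).2.symm
  · split_ifs
    exacts [hB.subset, hP.subset, Subset.rfl]
  · split_ifs with h h
    · rw [h]; exact hB.isOpen
    · rw [h]; exact hP.isOpen
    · exact ⟨∅, isOpen_empty, inter_empty _⟩
  · split_ifs
    exacts [hB.isCompact, hP.isCompact, isCompact_empty]
  · split_ifs with h h
    · rw [h]; exact hB.disjoint
    · rw [h]; exact hP.disjoint
    · simp
  · by_contra h
    simp only [mem_insert_iff, mem_singleton_iff, not_or] at h
    simp only [mem_ofPred_eq, if_neg h.1, if_neg h.2] at hw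
    exact not_nonempty_empty hw
  · simp only [if_pos]; exact hB.mem
  · dsimp only
    split_ifs with h h
    · rw [h]; exact hBR
    · rw [h]; exact hPR
    · exact empty_disjoint _

/-- The other end of the gluing along an arc. -/
theorem exists_gluedEnds {v : Vertex F} {κ : Torus} (hκ : κ ∈ D.K v) {A : Set Torus}
    (hA : A ∈ D.gluedArcs v) (h : κ ∈ closure A) :
    ∃ e, (e.child = v ∧ A = D.atChild e ∧ ∃ κ' ∈ D.K e.parent, D.GluedEnds e κ κ') ∨
      (e.parent = v ∧ A = D.atParent e ∧ ∃ κ' ∈ D.K e.child, D.GluedEnds e κ' κ) := by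
  obtain ⟨l, hl⟩ := (D.isBoundaryComponent_of_mem_gluedArcs hA).exists_param (D.K_subset v)
    (D.K_cantor v) hκ h
  obtain ⟨e, ⟨rfl, rfl⟩ | ⟨rfl, rfl⟩⟩ := hA
  · refine ⟨e, Or.inl ⟨rfl, rfl, ?_⟩⟩
    obtain ⟨-, -, κ', hκ', -, -, hl'⟩ := (D.isComp_atParent e).exists_limits (D.K_subset _)
      (D.K_cantor _) (l.trans (D.glue e))
    exact ⟨κ', hκ', l, hl, hl'⟩
  · refine ⟨e, Or.inr ⟨rfl, rfl, ?_⟩⟩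
    obtain ⟨-, -, κ', hκ', -, -, hl'⟩ := (D.isComp_atChild e).exists_limits (D.K_subset _)
      (D.K_cantor _) (l.trans (D.glue e).symm)
    exact ⟨κ', hκ', l.trans (D.glue e).symm, hl', by simpa using hl⟩

/-- Separation of an end defined by a removed point. -/
theorem ptEnd_ne_of_avoiding {v : Vertex F} (κ : D.K v) (R : Vertex F → Set Torus)
    (hR : ∀ w, IsClosed (R w)) (hRK : ∀ w, R w ⊆ D.K w) (hκR : (κ : Torus) ∉ R v)
    (hM : ∀ w κ', D.Matched v κ w κ' → κ' ∉ R w) {l : Filter D.W} [l.NeBot] {e : Ends D.W}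
    (hl : EndLim l e)
    (hlR : ∀ B : Vertex F → Set Torus, D.Compatible B → (∀ w, IsClosed (B w)) →
      (∀ w, Disjoint (B w) (R w)) → {w | (B w).Nonempty}.Finite →
      D.assemble (fun w => (B w)ᶜ) ∈ l) : D.ptEnd v κ ≠ e := by
  by_cases h : ∃ A ∈ D.gluedArcs v, (κ : Torus) ∈ closure A
  · obtain ⟨A, hA, h⟩ := h
    have fin : ∀ (e₀ : Edge F) (κ₁ : D.K e₀.child) (κ₂ : D.K e₀.parent), D.GluedEnds e₀ κ₁ κ₂ →
        (κ₁ : Torus) ∉ R e₀.child → (κ₂ : Torus) ∉ R e₀.parent → D.ptEnd e₀.child κ₁ ≠ e := by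
      intro e₀ κ₁ κ₂ hg h1 h2
      obtain ⟨A, B, hI, hB⟩ := D.exists_isolation_of_gluedEnds κ₁.2 κ₂.2 hg R hR hRK h1 h2
      exact hI.ne hl (hlR B hI.compatible' (fun w => (hI.isCompact w).isClosed) hB hI.finite)
    obtain ⟨e₀, ⟨rfl, -, κ', hκ', hg⟩ | ⟨rfl, -, κ', hκ', hg⟩⟩ := D.exists_gluedEnds κ.2 hA h
    · exact fin e₀ κ ⟨κ', hκ'⟩ hg hκR (hM _ _ ⟨e₀, Or.inl ⟨rfl, rfl, hg⟩⟩)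
    -- Here `κ` lies in the tile of the parent; the same end is defined by the matching point of the
    -- tile of the child.
    · have heq := GluedEnds.ptEnd_eq D (κ := ⟨κ', hκ'⟩) (κ' := κ) hg
      rw [← heq]
      exact fin e₀ ⟨κ', hκ'⟩ κ hg (hM _ _ ⟨e₀, Or.inr ⟨rfl, rfl, hg⟩⟩) hκR
  · push Not at h
    obtain ⟨A, B, hI, hB⟩ := D.exists_isolation_of_notMem κ.2 h R hR hRK hκR
    exact hI.ne hl (hlR B hI.compatible' (fun w => (hI.isCompact w).isClosed) hB hI.finite)

/-- No point has to be avoided here (`R` is empty): an isolating family is nonempty in finitely many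
tiles only, so it misses a tail of the ray. -/
theorem ptEnd_ne_rayEnd (v : Vertex F) (κ : D.K v) (f : F) : D.ptEnd v κ ≠ D.rayEnd f := by
  refine D.ptEnd_ne_of_avoiding κ (fun _ => ∅) (fun _ => isClosed_empty) (fun _ => empty_subset _)
    (notMem_empty _) (fun _ _ _ => notMem_empty _) (D.endLim_rayEnd f) fun B hB _ _ hfin => ?_
  rw [mem_rayFilter]
  have h := hfin.preimage (rayVertexF_injective f).injOn
  obtain ⟨N, hN⟩ := h.bddAbove
  filter_upwards [eventually_gt_atTop N] with n hn
  rintro _ ⟨p, rfl⟩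
  rw [hB.compl.mem_assemble]
  exact fun hp => (hN (show n ∈ rayVertexF f ⁻¹' {w | (B w).Nonempty} from ⟨_, hp⟩)).not_gt hn

/-- Two removed points define the same end only if they are ends of a glued arc. -/
theorem eq_or_matched_of_ptEnd_eq {v w : Vertex F} {κ : D.K v} {κ' : D.K w}
    (h : D.ptEnd v κ = D.ptEnd w κ') :
    (⟨v, κ⟩ : Σ v, D.K v) = ⟨w, κ'⟩ ∨ D.Matched v κ w κ' := by
  by_contra! hc
  have := D.ptFilter_neBot κ'.2
  refine D.ptEnd_ne_of_avoiding κ (fun u => {p | u = w ∧ p = κ'}) (fun u => ?_) ?_ ?_ ?_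
    (D.endLim_ptEnd w κ') (fun B hB hBc hBR _ => ?_) h
  · exact ((finite_singleton (κ' : Torus)).subset fun p hp => hp.2).isClosed
  · rintro u p ⟨rfl, rfl⟩
    exact κ'.2
  · rintro ⟨rfl, h'⟩
    exact hc.1 (by rw [Subtype.ext h'])
  · rintro u q hM ⟨rfl, rfl⟩
    exact hc.2 hM
  · have hmem : (B w)ᶜ ∈ 𝓝 (κ' : Torus) := (hBc w).isOpen_compl.mem_nhds fun h' =>
      disjoint_left.1 (hBR w) h' ⟨rfl, rfl⟩
    refine mem_of_superset (D.image_mem_ptFilter hmem) ?_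
    rintro _ ⟨p, hp, rfl⟩
    rw [hB.compl.mem_assemble]
    exact hp.1.2

end Realization

/-! ### The boundary of the surface -/

theorem convergesToEnd_unique {α X : Type} [TopologicalSpace X] {g : α → X} {l : Filter α} [l.NeBot]
    {e e' : Ends X} (h : ConvergesToEnd g l e) (h' : ConvergesToEnd g l e') : e = e' :=
  Ends.eq_of_endLim (convergesToEnd_iff.1 h) (convergesToEnd_iff.1 h')

theorem ConvergesToEnd.neg {X : Type} [TopologicalSpace X] {B : Set X} {l : ℝ ≃ₜ B} {e : Ends X}
    (h : ConvergesToEnd (fun t => (l t : X)) atBot e) :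
    ConvergesToEnd (fun t => ((Homeomorph.neg ℝ).trans l t : X)) atTop e := fun K =>
  tendsto_neg_atTop_atBot.eventually (h K)

theorem ConvergesToEnd.neg' {X : Type} [TopologicalSpace X] {B : Set X} {l : ℝ ≃ₜ B} {e : Ends X}
    (h : ConvergesToEnd (fun t => (l t : X)) atTop e) :
    ConvergesToEnd (fun t => ((Homeomorph.neg ℝ).trans l t : X)) atBot e := fun K =>
  tendsto_neg_atBot_atTop.eventually (h K)

namespace Realization

variable {F : Set (ℕ → Bool)} {ν : Vertex F → Bool} (D : Realization F ν)

theorem mem_gluedPart_iff {v : Vertex F} {p : Torus} :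
    p ∈ D.gluedPart v ↔ ∃ A ∈ D.gluedArcs v, p ∈ A := by
  constructor
  · rintro ⟨e, ⟨h, hp⟩ | ⟨h, hp⟩⟩
    exacts [⟨_, ⟨e, Or.inl ⟨h, rfl⟩⟩, hp⟩, ⟨_, ⟨e, Or.inr ⟨h, rfl⟩⟩, hp⟩]
  · rintro ⟨A, ⟨e, ⟨h, rfl⟩ | ⟨h, rfl⟩⟩, hp⟩
    exacts [⟨e, Or.inl ⟨h, hp⟩⟩, ⟨e, Or.inr ⟨h, hp⟩⟩]

theorem incl_mem_boundary_iff {v : Vertex F} {p : D.Tile v} :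
    D.incl v p ∈ D.boundary ↔ p.1 ∈ (tileKind F ν v).rim ∧ p.1 ∉ D.gluedPart v := by
  refine ⟨?_, fun h => ⟨v, p, h.1, h.2, rfl⟩⟩
  rintro ⟨w, q, h1, h2, h⟩
  rcases D.incl_eq_iff.1 h with h | ⟨e, h3, h4, x, h5, h6⟩ | ⟨e, h3, h4, x, h5, h6⟩
  · obtain ⟨rfl, h⟩ := Sigma.mk.inj h
    rw [eq_of_heq h]; exact ⟨h1, h2⟩
  · simp only at h3 h4 h5 h6
    refine (h2 ⟨e, Or.inr ⟨h4.symm, ?_⟩⟩).elim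
    rw [h6]; exact (D.glue e x).2
  · simp only at h3 h4 h5 h6
    refine (h2 ⟨e, Or.inl ⟨h3.symm, ?_⟩⟩).elim
    rw [h5]; exact x.2

/-- The subset of the surface corresponding to a subset of a tile. -/
def line (v : Vertex F) (A : Set Torus) : Set D.W := D.incl v '' {p | p.1 ∈ A}

theorem isClosed_rim_diff (v : Vertex F) {A : Set Torus}
    (hA : (tileKind F ν v).IsBoundaryComponent (D.K v) A) : IsClosed ((tileKind F ν v).rim \ A) := by
  obtain ⟨s, a, b, hg, rfl⟩ := (D.isBoundaryComponent_iff v).1 hA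
  obtain ⟨O, hO, hO'⟩ := (tileKind F ν v).exists_isOpen_box s (α := a) (β := b) (r := 1)
    hg.lt_add_one zero_le_one le_rfl
  convert (tileKind F ν v).isClosed_rim.inter hO.isClosed_compl using 1
  ext p
  refine and_congr_right fun hp => not_congr ⟨fun h => ?_, fun h => ?_⟩
  · have := TileKind.arc_subset_box (k := tileKind F ν v) (J := Ico 0 1) (by simp) h
    rw [← hO'] at this
    exact this.2
  · have : p ∈ (tileKind F ν v).body ∩ O := ⟨(tileKind F ν v).rim_subset_body hp, h⟩
    rw [hO'] at this
    exact TileKind.mem_arc_of_mem_rim Ico_subset_Icc_self hp this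

theorem isClosed_rim_diff_gluedPart (v : Vertex F) :
    IsClosed ((tileKind F ν v).rim \ D.gluedPart v) := by
  have : (tileKind F ν v).rim \ D.gluedPart v =
      (tileKind F ν v).rim ∩ ⋂ A ∈ D.gluedArcs v, (tileKind F ν v).rim \ A := by
    ext p
    simp only [Set.mem_sdiff, mem_inter_iff, mem_iInter, D.mem_gluedPart_iff, not_exists, not_and]
    exact ⟨fun h => ⟨h.1, fun A hA => ⟨h.1, h.2 A hA⟩⟩, fun h => ⟨h.1, fun A hA => (h.2 A hA).2⟩⟩
  rw [this]
  exact (tileKind F ν v).isClosed_rim.inter (isClosed_biInter fun A hA =>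
    D.isClosed_rim_diff v (D.isBoundaryComponent_of_mem_gluedArcs hA))

variable {D} in
theorem disjoint_gluedPart {v : Vertex F} {A : Set Torus}
    (hA : (tileKind F ν v).IsBoundaryComponent (D.K v) A) (hfree : A ∉ D.gluedArcs v) :
    Disjoint A (D.gluedPart v) := by
  rw [disjoint_left]
  intro p hp hp'
  obtain ⟨B, hB, hpB⟩ := D.mem_gluedPart_iff.1 hp'
  rw [hA.eq_of_mem (D.isBoundaryComponent_of_mem_gluedArcs hB) hp hpB] at hfree
  exact hfree hB

/-- The arc is closed in `W`, and so is the rest of the boundary, because the arc is relatively open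
in the rim of its tile and an unglued arc meets no other tile. -/
theorem connectedComponentIn_boundary {v : Vertex F} {A : Set Torus}
    (hA : (tileKind F ν v).IsBoundaryComponent (D.K v) A) (hfree : A ∉ D.gluedArcs v)
    {p : D.Tile v} (hp : p.1 ∈ A) : connectedComponentIn D.boundary (D.incl v p) = D.line v A := by
  have hdisj := disjoint_gluedPart hA hfree
  have hsub : D.line v A ⊆ D.boundary := by
    rintro _ ⟨q, hq, rfl⟩
    exact D.incl_mem_boundary_iff.2 ⟨(hA.subset hq).1, disjoint_left.1 hdisj hq⟩
  have hpl : D.incl v p ∈ D.line v A := ⟨p, hp, rfl⟩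
  refine Subset.antisymm ?_ (IsPreconnected.subset_connectedComponentIn ?_ hpl hsub)
  · have hcl1 : IsClosed (D.line v A) :=
      (D.isClosedEmbedding_incl v).isClosedMap _ (D.isClosed_component v hA)
    have hcl2 : IsClosed (D.boundary \ D.line v A) := by
      refine D.isClosed_iff.2 fun w => ?_
      by_cases hw : w = v
      · subst hw
        convert ((D.isClosed_rim_diff_gluedPart w).inter (D.isClosed_rim_diff w hA)).preimage
          (D.continuous_val w) using 1
        ext q
        have : D.incl w q ∈ D.line w A ↔ q.1 ∈ A := (D.incl_injective w).mem_set_image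
        simp only [mem_preimage, Set.mem_sdiff, D.incl_mem_boundary_iff, this, mem_inter_iff]
        tauto
      · convert (D.isClosed_rim_diff_gluedPart w).preimage (D.continuous_val w) using 1
        ext q
        simp only [mem_preimage, Set.mem_sdiff, D.incl_mem_boundary_iff, and_iff_left_iff_imp]
        rintro ⟨h1, h2⟩ ⟨r, hr, h⟩
        rcases D.incl_eq_iff.1 h with h | ⟨e, h3, h4, x, h5, h6⟩ | ⟨e, h3, h4, x, h5, h6⟩
        · exact hw (Sigma.mk.inj h).1.symm
        · simp only at h3 h4 h5 h6
          refine h2 ⟨e, Or.inr ⟨h4.symm, ?_⟩⟩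
          rw [h6]; exact (D.glue e x).2
        · simp only at h3 h4 h5 h6
          refine h2 ⟨e, Or.inl ⟨h3.symm, ?_⟩⟩
          rw [h5]; exact x.2
    intro x hx
    by_contra hxl
    obtain ⟨y, -, hy, hy'⟩ := isPreconnected_closed_iff.1
      (isPreconnected_connectedComponentIn (x := D.incl v p) (F := D.boundary)) _ _ hcl1 hcl2
      (fun y hy => or_iff_not_imp_left.2 fun h => ⟨connectedComponentIn_subset _ _ hy, h⟩)
      ⟨_, mem_connectedComponentIn (hsub hpl), hpl⟩
      ⟨x, hx, connectedComponentIn_subset _ _ hx, hxl⟩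
    exact hy'.2 hy
  · refine D.isPreconnected_incl_image v ?_ fun q hq => ?_
    · obtain ⟨x, -, rfl⟩ := hA
      exact isPreconnected_connectedComponentIn
    · exact ⟨(tileKind F ν v).rim_subset_body (hA.subset hq).1, (hA.subset hq).2⟩

/-- Every component of the boundary is an unglued open arc, and none is compact, since the limit
points of the arc have been removed. -/
theorem isNoncompactComponent_iff {B : Set D.W} :
    IsNoncompactComponent D.boundary B ↔ ∃ v s a b, (tileKind F ν v).IsGap (D.K v) s a b ∧
      (tileKind F ν v).arc s (Ioo a b) ∉ D.gluedArcs v ∧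
      B = D.line v ((tileKind F ν v).arc s (Ioo a b)) := by
  constructor
  · rintro ⟨⟨x, ⟨v, p, h1, h2, rfl⟩, rfl⟩, -⟩
    have hA : (tileKind F ν v).IsBoundaryComponent (D.K v)
      (connectedComponentIn ((tileKind F ν v).rim \ D.K v) p.1) := ⟨p.1, ⟨h1, p.2.2⟩, rfl⟩
    have hpA := mem_connectedComponentIn (F := (tileKind F ν v).rim \ D.K v) (x := p.1) ⟨h1, p.2.2⟩
    obtain ⟨s, a, b, hg, h⟩ := (D.isBoundaryComponent_iff v).1 hA
    rw [h] at hA hpA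
    have hfree : (tileKind F ν v).arc s (Ioo a b) ∉ D.gluedArcs v := fun h' =>
      h2 (D.mem_gluedPart_iff.2 ⟨_, h', hpA⟩)
    exact ⟨v, s, a, b, hg, hfree, D.connectedComponentIn_boundary hA hfree hpA⟩
  · rintro ⟨v, s, a, b, hg, hfree, rfl⟩
    have hA := hg.isBoundaryComponent
    obtain ⟨p, hp⟩ := hA.nonempty
    let p' := D.arcIncl v hA ⟨p, hp⟩
    refine ⟨⟨D.incl v p', D.incl_mem_boundary_iff.2 ⟨(hA.subset hp).1,
      disjoint_left.1 (disjoint_gluedPart hA hfree) hp⟩,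
      (D.connectedComponentIn_boundary hA hfree hp).symm⟩, fun hc => ?_⟩
    have h1 : IsCompact ((tileKind F ν v).arc s (Ioo a b)) := by
      convert ((D.isClosedEmbedding_incl v).isCompact_preimage hc).image (D.continuous_val v) using 1
      rw [line, preimage_image_eq _ (D.incl_injective v)]
      ext q
      constructor
      · intro hq; exact ⟨D.arcIncl v hA ⟨q, hq⟩, hq, rfl⟩
      · rintro ⟨q, hq, rfl⟩; exact hq
    obtain ⟨l, -, hl⟩ := TileKind.exists_arc_param (k := tileKind F ν v) (s := s) hg.lt hg.lt_add_one
    have := h1.isClosed.mem_of_tendsto hl (Eventually.of_forall fun t => (l t).2)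
    exact (hg.arc_subset this).2 hg.right_mem

/-- The end defined by a removed point, given by its angle. -/
noncomputable def angleEnd (v : Vertex F) (s : Side) (x : (tileKind F ν v).angles (D.K v) s) :
    Ends D.W := D.ptEnd v ⟨(tileKind F ν v).collar s x 0, x.2⟩

theorem continuous_angleEnd (v : Vertex F) (s : Side) : Continuous (D.angleEnd v s) :=
  (D.continuous_ptEnd v).comp
    ((((tileKind F ν v).continuous_collar_left s 0).comp continuous_subtype_val).subtype_mk _)

/-- A boundary component of a tile is homeomorphic to its image in the surface. -/
noncomputable def lineHomeomorph (v : Vertex F) {A : Set Torus}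
    (hA : (tileKind F ν v).IsBoundaryComponent (D.K v) A) : A ≃ₜ D.line v A :=
  (((D.isClosedEmbedding_incl v).comp (D.isClosedEmbedding_arcIncl v hA)).isEmbedding.toHomeomorph).trans
    (Homeomorph.setCongr (by
      ext x
      constructor
      · rintro ⟨p, rfl⟩; exact ⟨_, p.2, rfl⟩
      · rintro ⟨p, hp, rfl⟩; exact ⟨⟨p.1, hp⟩, rfl⟩))

theorem lineHomeomorph_apply (v : Vertex F) {A : Set Torus}
    (hA : (tileKind F ν v).IsBoundaryComponent (D.K v) A) (x : A) :
    (D.lineHomeomorph v hA x : D.W) = D.incl v (D.arcIncl v hA x) := rfl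

theorem exists_converges_line {v : Vertex F} {s : Side} {a b : ℝ}
    (hg : (tileKind F ν v).IsGap (D.K v) s a b)
    (l : ℝ ≃ₜ D.line v ((tileKind F ν v).arc s (Ioo a b))) :
    (ConvergesToEnd (fun t => (l t : D.W)) atBot (D.angleEnd v s ⟨a, hg.left_mem⟩) ∧
      ConvergesToEnd (fun t => (l t : D.W)) atTop (D.angleEnd v s ⟨b, hg.right_mem⟩)) ∨
    (ConvergesToEnd (fun t => (l t : D.W)) atBot (D.angleEnd v s ⟨b, hg.right_mem⟩) ∧
      ConvergesToEnd (fun t => (l t : D.W)) atTop (D.angleEnd v s ⟨a, hg.left_mem⟩)) := by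
  set φ := D.lineHomeomorph v hg.isBoundaryComponent
  have hl : ∀ t, (l t : D.W) = D.incl v (D.arcIncl v hg.isBoundaryComponent (φ.symm (l t))) :=
    fun t => by rw [← D.lineHomeomorph_apply, φ.apply_symm_apply]
  simp only [hl]
  rcases TileKind.arc_ends hg.lt_add_one (l.trans φ.symm) with ⟨h1, h2⟩ | ⟨h1, h2⟩
  · exact Or.inl ⟨D.convergesToEnd_ptEnd _ h1, D.convergesToEnd_ptEnd _ h2⟩
  · exact Or.inr ⟨D.convergesToEnd_ptEnd _ h1, D.convergesToEnd_ptEnd _ h2⟩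

theorem exists_line_param {v : Vertex F} {s : Side} {a b : ℝ}
    (hg : (tileKind F ν v).IsGap (D.K v) s a b) :
    ∃ l : ℝ ≃ₜ D.line v ((tileKind F ν v).arc s (Ioo a b)),
    ConvergesToEnd (fun t => (l t : D.W)) atBot (D.angleEnd v s ⟨a, hg.left_mem⟩) ∧
      ConvergesToEnd (fun t => (l t : D.W)) atTop (D.angleEnd v s ⟨b, hg.right_mem⟩) := by
  obtain ⟨l, h1, h2⟩ := TileKind.exists_arc_param (k := tileKind F ν v) (s := s) hg.lt hg.lt_add_one
  refine ⟨l.trans (D.lineHomeomorph v hg.isBoundaryComponent), ?_, ?_⟩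
  · exact D.convergesToEnd_ptEnd (g := fun t => D.arcIncl v hg.isBoundaryComponent (l t)) _ h1
  · exact D.convergesToEnd_ptEnd (g := fun t => D.arcIncl v hg.isBoundaryComponent (l t)) _ h2

theorem joinedByBoundary_iff {e e' : Ends D.W} :
    JoinedByBoundary D.boundary e e' ↔ ∃ v s a b, ∃ hg : (tileKind F ν v).IsGap (D.K v) s a b,
      (tileKind F ν v).arc s (Ioo a b) ∉ D.gluedArcs v ∧
      ((e = D.angleEnd v s ⟨a, hg.left_mem⟩ ∧ e' = D.angleEnd v s ⟨b, hg.right_mem⟩) ∨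
        (e = D.angleEnd v s ⟨b, hg.right_mem⟩ ∧ e' = D.angleEnd v s ⟨a, hg.left_mem⟩)) := by
  constructor
  · rintro ⟨B, hB, l, h1, h2⟩
    obtain ⟨v, s, a, b, hg, hfree, rfl⟩ := D.isNoncompactComponent_iff.1 hB
    refine ⟨v, s, a, b, hg, hfree, ?_⟩
    rcases D.exists_converges_line hg l with ⟨h3, h4⟩ | ⟨h3, h4⟩
    · exact Or.inl ⟨convergesToEnd_unique h1 h3, convergesToEnd_unique h2 h4⟩
    · exact Or.inr ⟨convergesToEnd_unique h1 h3, convergesToEnd_unique h2 h4⟩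
  · rintro ⟨v, s, a, b, hg, hfree, h⟩
    refine ⟨_, D.isNoncompactComponent_iff.2 ⟨v, s, a, b, hg, hfree, rfl⟩, ?_⟩
    obtain ⟨l, h1, h2⟩ := D.exists_line_param hg
    rcases h with ⟨rfl, rfl⟩ | ⟨rfl, rfl⟩
    · exact ⟨l, h1, h2⟩
    · exact ⟨_, ConvergesToEnd.neg' h2, ConvergesToEnd.neg h1⟩

theorem mem_BEnds_iff {e : Ends D.W} :
    e ∈ D.BEnds ↔ ∃ v s a b, ∃ hg : (tileKind F ν v).IsGap (D.K v) s a b,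
      (tileKind F ν v).arc s (Ioo a b) ∉ D.gluedArcs v ∧
      (e = D.angleEnd v s ⟨a, hg.left_mem⟩ ∨ e = D.angleEnd v s ⟨b, hg.right_mem⟩) := by
  constructor
  · rintro ⟨B, hB, l, h1⟩
    obtain ⟨v, s, a, b, hg, hfree, rfl⟩ := D.isNoncompactComponent_iff.1 hB
    refine ⟨v, s, a, b, hg, hfree, ?_⟩
    rcases D.exists_converges_line hg l with ⟨-, h4⟩ | ⟨-, h4⟩
    · exact Or.inr (convergesToEnd_unique h1 h4)
    · exact Or.inl (convergesToEnd_unique h1 h4)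
  · rintro ⟨v, s, a, b, hg, hfree, h⟩
    refine ⟨_, D.isNoncompactComponent_iff.2 ⟨v, s, a, b, hg, hfree, rfl⟩, ?_⟩
    obtain ⟨l, h1, h2⟩ := D.exists_line_param hg
    rcases h with rfl | rfl
    · exact ⟨_, ConvergesToEnd.neg h1⟩
    · exact ⟨l, h2⟩

end Realization

/-! ### Separating loops -/

namespace TileKind

variable {k : TileKind} {K : Set Torus}

theorem box_univ_eq {s : Side} (J : Set ℝ) : k.box s univ J = k.box s (Icc 0 1) J := by
  refine Subset.antisymm ?_ (image_mono (Set.prod_mono (subset_univ _) Subset.rfl))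
  rintro _ ⟨⟨θ, t⟩, ⟨-, ht⟩, rfl⟩
  obtain ⟨n, hn⟩ := exists_int_shift 0 θ
  exact ⟨(θ + n, t), ⟨⟨hn.1, by linarith [hn.2]⟩, ht⟩, k.collar_add_int s θ t n⟩

theorem collar_mem_box_univ_iff {s : Side} {θ t : ℝ} {J : Set ℝ} (hJ : J ⊆ Icc 0 1)
    (ht : t ∈ Icc (0 : ℝ) 1) : k.collar s θ t ∈ k.box s univ J ↔ t ∈ J := by
  refine ⟨?_, fun h => ⟨(θ, t), ⟨trivial, h⟩, rfl⟩⟩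
  rintro ⟨⟨θ', t'⟩, ⟨-, ht'⟩, h⟩
  rw [← (k.collar_inj s (hJ ht') ht h).1]
  exact ht'

theorem mem_box_univ_iff_of_mem_rim {s : Side} {J : Set ℝ} (hJ : J ⊆ Icc 0 1) (h0 : (0 : ℝ) ∈ J)
    {p : Torus} (hp : p ∈ k.rim) : p ∈ k.box s univ J ↔ p ∈ k.circle s := by
  rw [← arc_univ]
  exact ⟨mem_arc_of_mem_rim hJ hp, fun h => arc_subset_box h0 h⟩

/-- The part beyond the half collar is the union of the core, the deep half of the outer collar and
the whole inner collar; both collars meet the core at depth `1`. -/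
theorem isPreconnected_inner_part (h2 : k.TwoSided) (hK : K ⊆ k.rim) :
    IsPreconnected ((k.body \ K) \ k.box .outer univ (Icc 0 (1 / 2))) := by
  have hnotK : ∀ s θ t, t ∈ Ioc (1 / 2 : ℝ) 1 → k.collar s θ t ∉ K := fun s θ t ht h => by
    have := (k.collar_mem_rim_iff s (t := t) (θ := θ) ⟨by linarith [ht.1], ht.2⟩).1 (hK h)
    linarith [ht.1]
  have c1 : IsPreconnected (k.box .outer univ (Ioc (1 / 2) 1) \ K) := by
    have : k.box .outer univ (Ioc (1 / 2) 1) \ K = k.box .outer univ (Ioc (1 / 2) 1) := by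
      refine sdiff_eq_left.2 (disjoint_left.2 ?_)
      rintro _ ⟨⟨θ, t⟩, ⟨-, ht⟩, rfl⟩
      exact hnotK _ _ _ ht
    rw [this]
    exact (isPreconnected_univ.prod isPreconnected_Ioc).image _
      (k.continuous_collar .outer).continuousOn
  have c2 := isPreconnected_box_diff hK (s := .inner) (I := univ) (J := Icc 0 1) isPreconnected_univ
    le_rfl one_pos Ioo_subset_Icc_self Subset.rfl
  have c3 := isPreconnected_collar_union_core hK .inner c2 (by simp)
    (isPreconnected_collar_union_core hK .outer c1 (by norm_num) k.isPreconnected_core Subset.rfl)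
    subset_union_left
  convert c3 using 1
  have hIcc : Icc (0 : ℝ) (1 / 2) ⊆ Icc 0 1 := Icc_subset_Icc_right (by norm_num)
  ext p
  constructor
  · rintro ⟨⟨hb, hpK⟩, hp⟩
    rcases k.body_subset_core_union hb with h | ⟨s, θ, t, ht, rfl⟩
    · exact Or.inl (Or.inl h)
    · cases s
      · refine Or.inl (Or.inr ⟨⟨(θ, t), ⟨trivial, ?_⟩, rfl⟩, hpK⟩)
        rw [collar_mem_box_univ_iff hIcc (Ico_subset_Icc_self ht)] at hp
        refine ⟨?_, ht.2.le⟩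
        by_contra! h
        exact hp ⟨ht.1, h⟩
      · exact Or.inr ⟨⟨(θ, t), ⟨trivial, Ico_subset_Icc_self ht⟩, rfl⟩, hpK⟩
  · rintro ((h | ⟨⟨⟨θ, t⟩, ⟨-, ht⟩, rfl⟩, hpK⟩) | ⟨⟨⟨θ, t⟩, ⟨-, ht⟩, rfl⟩, hpK⟩)
    · refine ⟨⟨h.1, ?_⟩, ?_⟩
      · rw [← core_diff hK] at h
        exact h.2
      · rintro ⟨⟨θ, t⟩, ⟨-, ht⟩, rfl⟩
        exact k.collar_not_mem_core _ ⟨ht.1, by linarith [ht.2]⟩ h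
    · have ht' : t ∈ Icc (0 : ℝ) 1 := ⟨by linarith [ht.1], ht.2⟩
      refine ⟨⟨k.collar_mem_body _ _ ht', hpK⟩, fun h => ?_⟩
      have := (collar_mem_box_univ_iff hIcc ht').1 h
      linarith [this.2, ht.1]
    · refine ⟨⟨k.collar_mem_body _ _ ht, hpK⟩, ?_⟩
      rintro ⟨⟨θ', t'⟩, ⟨-, ht'⟩, h⟩
      exact collar_outer_ne_inner h2 (hIcc ht') ht h

end TileKind

namespace Realization

variable {F : Set (ℕ → Bool)} {ν : Vertex F → Bool} (D : Realization F ν)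

theorem exists_loop (v : Vertex F) :
    ∃ τ : C(Circle, D.Tile v), range τ = {p | p.1 ∈ (tileKind F ν v).box .outer univ {1 / 2}} := by
  have hmem : ∀ θ, (tileKind F ν v).collar .outer θ (1 / 2) ∈ (tileKind F ν v).body ∧
      (tileKind F ν v).collar .outer θ (1 / 2) ∉ D.K v := fun θ =>
    ⟨(tileKind F ν v).collar_mem_body _ _ (by norm_num), fun h => by
      have := ((tileKind F ν v).collar_mem_rim_iff .outer (θ := θ) (t := 1 / 2) (by norm_num)).1
        (D.K_subset v h)
      norm_num at this⟩
  let g : ℝ → D.Tile v := fun θ => D.mkTile v _ (hmem θ)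
  have hg : Continuous g := ((tileKind F ν v).continuous_collar_left .outer (1 / 2)).subtype_mk hmem
  have hper : Function.Periodic g 1 := fun θ => D.tile_ext (by
    have := (tileKind F ν v).collar_add_int .outer θ (1 / 2) 1
    rwa [Int.cast_one] at this)
  have hlift : Continuous (hper.lift : AddCircle (1 : ℝ) → D.Tile v) := continuous_quot_lift _ hg
  refine ⟨⟨hper.lift ∘ (AddCircle.homeomorphCircle one_ne_zero).symm,
    hlift.comp (Homeomorph.continuous _)⟩, ?_⟩
  rw [ContinuousMap.coe_mk, EquivLike.range_comp]
  ext p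
  constructor
  · rintro ⟨x, rfl⟩
    obtain ⟨θ, rfl⟩ := QuotientAddGroup.mk_surjective x
    exact ⟨(θ, 1 / 2), ⟨trivial, rfl⟩, rfl⟩
  · rintro ⟨⟨θ, t⟩, ⟨-, rfl⟩, h⟩
    exact ⟨(θ : AddCircle (1 : ℝ)), D.tile_ext h⟩

theorem isOpen_halfCollar (v : Vertex F) :
    IsOpen {p : D.Tile v | p.1 ∈ (tileKind F ν v).box .outer univ (Ico 0 (1 / 2))} := by
  convert ((tileKind F ν v).isOpen_collarOpen .outer (1 / 2)).preimage (D.continuous_val v) using 1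
  ext p
  have := (tileKind F ν v).body_inter_collarOpen .outer (r := 1 / 2) (by norm_num)
  rw [mem_preimage, mem_ofPred_eq, TileKind.box, ← this]
  exact and_iff_right p.2.1

theorem isClosed_halfCollar (v : Vertex F) :
    IsClosed {p : D.Tile v | p.1 ∈ (tileKind F ν v).box .outer univ (Icc 0 (1 / 2))} := by
  rw [TileKind.box_univ_eq]
  exact ((tileKind F ν v).isCompact_box _ isCompact_Icc isCompact_Icc).isClosed.preimage
    (D.continuous_val v)

theorem mem_box_Ico_or {v : Vertex F} {p : Torus}
    (h : p ∈ (tileKind F ν v).box .outer univ (Icc 0 (1 / 2))) :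
    p ∈ (tileKind F ν v).box .outer univ (Ico 0 (1 / 2)) ∨
      p ∈ (tileKind F ν v).box .outer univ {1 / 2} := by
  obtain ⟨⟨θ, t⟩, ⟨-, ht⟩, rfl⟩ := h
  rcases ht.2.eq_or_lt with h | h
  · exact Or.inr ⟨(θ, t), ⟨trivial, h⟩, rfl⟩
  · exact Or.inl ⟨(θ, t), ⟨trivial, ht.1, h⟩, rfl⟩

/-- The circle at depth `1/2` of the outer collar cuts the tile into the half collar next to the
outer circle and the connected rest, which contains the inner circle. -/
theorem isTau_of_range {v : Vertex F} (h2 : (tileKind F ν v).TwoSided) {τ : C(Circle, D.Tile v)}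
    (hτ : range τ = {p | p.1 ∈ (tileKind F ν v).box .outer univ {1 / 2}}) : D.IsTau v τ := by
  have hIcc : Icc (0 : ℝ) (1 / 2) ⊆ Icc 0 1 := Icc_subset_Icc_right (by norm_num)
  have hIco : Ico (0 : ℝ) (1 / 2) ⊆ Icc 0 1 := Ico_subset_Icc_self.trans hIcc
  have hind : IsInducing fun p : D.Tile v => p.1 := IsInducing.subtypeVal
  have himg : ∀ P : Set Torus, (fun p : D.Tile v => p.1) '' {p | p.1 ∈ P} =
      ((tileKind F ν v).body \ D.K v) ∩ P := fun P => by
    ext p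
    constructor
    · rintro ⟨q, hq, rfl⟩; exact ⟨q.2, hq⟩
    · rintro ⟨h1, h2⟩; exact ⟨D.mkTile v p h1, h2, rfl⟩
  refine ⟨fun t ht => ?_, {p | p.1 ∈ (tileKind F ν v).box .outer univ (Ico 0 (1 / 2))},
    {p | p.1 ∉ (tileKind F ν v).box .outer univ (Icc 0 (1 / 2))}, D.isOpen_halfCollar v,
    (D.isClosed_halfCollar v).isOpen_compl, ⟨?_, ?_⟩, ⟨?_, ?_⟩, ?_, ?_, fun p hp => ?_, fun p hp => ?_⟩
  · have hm : τ t ∈ {p : D.Tile v | p.1 ∈ (tileKind F ν v).box .outer univ {1 / 2}} :=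
      hτ ▸ mem_range_self t
    obtain ⟨⟨θ, r⟩, ⟨-, rfl⟩, h⟩ := hm
    rw [← h] at ht
    have := ((tileKind F ν v).collar_mem_rim_iff .outer (by norm_num)).1 ht
    norm_num at this
  · refine ⟨D.mkTile v ((tileKind F ν v).collar .outer 0 (1 / 4))
      ⟨(tileKind F ν v).collar_mem_body _ _ (by norm_num), fun h => ?_⟩,
      ⟨(0, 1 / 4), ⟨trivial, by norm_num⟩, rfl⟩⟩
    have := ((tileKind F ν v).collar_mem_rim_iff .outer (by norm_num)).1 (D.K_subset v h)
    norm_num at this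
  · rw [← hind.isPreconnected_image, himg]
    convert TileKind.isPreconnected_box_diff (D.K_subset v) (s := .outer) isPreconnected_univ
      (r := 1 / 2) (J := Ico 0 (1 / 2)) (by norm_num) (by norm_num) Ioo_subset_Ico_self
      Ico_subset_Icc_self using 1
    ext p
    constructor
    · rintro ⟨h1, h2⟩; exact ⟨h2, h1.2⟩
    · rintro ⟨h1, h2⟩
      refine ⟨⟨?_, h2⟩, h1⟩
      obtain ⟨⟨θ, t⟩, ⟨-, ht⟩, rfl⟩ := h1
      exact (tileKind F ν v).collar_mem_body _ _ (hIco ht)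
  · refine ⟨D.mkTile v ((tileKind F ν v).collar .outer 0 1)
      ⟨(tileKind F ν v).collar_one_mem_body _ _, TileKind.collar_one_notMem (D.K_subset v) 0⟩,
      fun h => ?_⟩
    have := (TileKind.collar_mem_box_univ_iff hIcc (by norm_num)).1 h
    norm_num at this
  · rw [← hind.isPreconnected_image]
    convert TileKind.isPreconnected_inner_part h2 (D.K_subset v) using 1
    exact himg ((tileKind F ν v).box .outer univ (Icc 0 (1 / 2)))ᶜ
  · rw [disjoint_left]
    exact fun p hp hp' => hp' (image_mono (Set.prod_mono Subset.rfl Ico_subset_Icc_self) hp)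
  · rw [hτ]
    ext p
    constructor
    · rintro (h | h) h'
      · obtain ⟨⟨θ, t⟩, ⟨-, rfl⟩, hp⟩ := h'
        rw [mem_ofPred_eq, ← hp] at h
        have := (TileKind.collar_mem_box_univ_iff hIco (by norm_num)).1 h
        norm_num at this
      · exact h (image_mono (Set.prod_mono Subset.rfl (by simp)) h')
    · intro h
      by_contra! h'
      simp only [mem_union, mem_ofPred_eq, not_or, not_not] at h'
      rcases mem_box_Ico_or h'.2 with h1 | h1
      exacts [h'.1 h1, h h1]
  · exact (TileKind.mem_box_univ_iff_of_mem_rim hIco (by norm_num) (TileKind.circle_subset_rim hp)).2 hp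
  · refine fun h => ?_
    have := (TileKind.mem_box_univ_iff_of_mem_rim hIcc (by norm_num)
      (TileKind.circle_subset_rim hp)).1 h
    exact disjoint_left.1 (TileKind.disjoint_circle_outer_inner h2) this hp

/-- The complement of a separating loop in the tile contains a connected set that contains all the
boundary components of a given side. -/
theorem IsTau.exists_side {v : Vertex F} {τ : C(Circle, D.Tile v)} (h : D.IsTau v τ) (s : Side) :
    ∃ Z : Set (D.Tile v), IsPreconnected Z ∧ Z ⊆ (range τ)ᶜ ∧
      ∀ p : D.Tile v, p.1 ∈ (tileKind F ν v).circle s → p ∈ Z := by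
  obtain ⟨-, U, V, -, -, hU, hV, -, hUV, h1, h2⟩ := h
  cases s
  · exact ⟨U, hU.isPreconnected, hUV ▸ subset_union_left, h1⟩
  · exact ⟨V, hV.isPreconnected, hUV ▸ subset_union_right, h2⟩

theorem mem_rim_of_incl_eq {v w : Vertex F} {p : D.Tile v} {q : D.Tile w}
    (h : D.incl v p = D.incl w q) (hvw : v ≠ w) : p.1 ∈ (tileKind F ν v).rim := by
  rcases D.incl_eq_iff.1 h with h | ⟨e, h3, h4, x, h5, h6⟩ | ⟨e, h3, h4, x, h5, h6⟩
  · exact (hvw (Sigma.mk.inj h).1).elim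
  · simp only at h3 h4 h5 h6
    subst h3
    rw [h5]; exact ((D.isComp_atChild e).subset x.2).1
  · simp only at h3 h4 h5 h6
    subst h4
    rw [h6]; exact ((D.isComp_atParent e).subset (D.glue e x).2).1

theorem disjoint_trace {v w : Vertex F} {τ : C(Circle, D.Tile v)} (h : D.IsTau v τ) (hvw : v ≠ w) :
    range (D.incl w) ⊆ (D.trace v τ : Set D.W)ᶜ := by
  rintro _ ⟨q, rfl⟩ ⟨t, ht⟩
  exact h.1 t (D.mem_rim_of_incl_eq ht hvw)

end Realization

/-! ### Rays of the tree -/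

theorem length_rayVertex (f : ℕ → Bool) (n : ℕ) : (rayVertex f n).length = n := by
  induction n with
  | zero => rfl
  | succ n ih => simp [rayVertex, ih]

theorem rayVertex_congr {f g : ℕ → Bool} {n : ℕ} (h : ∀ i < n, f i = g i) :
    rayVertex f n = rayVertex g n := by
  induction n with
  | zero => rfl
  | succ n ih =>
    rw [rayVertex, rayVertex, h n n.lt_succ_self, ih fun i hi => h i (hi.trans n.lt_succ_self)]

theorem eq_of_rayVertex_eq {f g : ℕ → Bool} {n : ℕ} (h : rayVertex f n = rayVertex g n) {i : ℕ}
    (hi : i < n) : f i = g i := by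
  induction n with
  | zero => omega
  | succ n ih =>
    obtain ⟨h1, h2⟩ := List.cons.inj h
    rcases (Nat.lt_succ_iff_lt_or_eq.1 hi) with h | rfl
    exacts [ih h2 h, h1]

theorem rayVertex_suffix (f : ℕ → Bool) {m n : ℕ} (h : m ≤ n) : rayVertex f m <:+ rayVertex f n := by
  induction n, h using Nat.le_induction with
  | base => exact List.suffix_rfl
  | succ n _ ih => exact ih.trans (List.suffix_cons _ _)

/-- An infinite path going down in `T_F` is a ray with limit in `F`. -/
theorem exists_ray_of_path {F : Set (ℕ → Bool)} (hF : IsClosed F) (N : ℕ) (w : ℕ → List Bool)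
    (b : ℕ → Bool) (hw : ∀ n, w (n + 1) = b n :: w n) (hm : ∀ n, w n ∈ treeVertices F)
    (h0 : (w 0).length = N) : ∃ f : F, ∀ n, rayVertex f.1 (N + n) = w n := by
  have h1 : ∀ n, (w n).length = N + n := fun n => by
    induction n with
    | zero => exact h0
    | succ n ih => rw [hw, List.length_cons, ih]; rfl
  have h2 : ∀ n, ∃ g ∈ F, rayVertex g (N + n) = w n := fun n => by
    obtain ⟨g, hg, m, h⟩ := hm n
    have := length_rayVertex g m
    rw [h, h1] at this
    exact ⟨g, hg, this ▸ h⟩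
  choose g hg hgw using h2
  -- The first `N` letters lead to the vertex `w 0`, the following ones are the directions of the
  -- path. `f` is a limit of the points `g n` of `F`, since `g n` agrees with it in the first `N +
  -- n` letters.
  let f : ℕ → Bool := fun i => if i < N then g 0 i else b (i - N)
  have hf : ∀ n, rayVertex f (N + n) = w n := fun n => by
    induction n with
    | zero => rw [← hgw 0]; exact rayVertex_congr fun i hi => if_pos hi
    | succ n ih =>
      rw [hw, ← ih]
      have : f (N + n) = b n := by
        simp only [f, if_neg (show ¬ N + n < N by omega), Nat.add_sub_cancel_left]
      rw [← this]; rfl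
  refine ⟨⟨f, hF.mem_of_tendsto (b := atTop) (f := g) ?_ (Eventually.of_forall hg)⟩, hf⟩
  rw [tendsto_pi_nhds]
  intro i
  refine tendsto_nhds_of_eventually_eq ?_
  filter_upwards [eventually_gt_atTop i] with n hn
  exact eq_of_rayVertex_eq ((hgw n).trans (hf n).symm) (by omega)

namespace Realization

variable {F : Set (ℕ → Bool)} {ν : Vertex F → Bool} (D : Realization F ν)

theorem twoSided_of_branching {v : Vertex F} (h : Branching F v) : (tileKind F ν v).TwoSided := by
  rw [tileKind, if_pos h]
  split_ifs <;> trivial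

theorem not_twoSided_of_not_branching {v : Vertex F} (h : ¬ Branching F v) :
    ¬ (tileKind F ν v).TwoSided := by
  rw [tileKind, if_neg h]
  split_ifs <;> exact id

theorem exists_side (v : Vertex F) {A : Set Torus}
    (hA : (tileKind F ν v).IsBoundaryComponent (D.K v) A) : ∃ s, A ⊆ (tileKind F ν v).circle s :=
  hA.exists_side (D.K_subset v) (D.K_cantor v)

/-! ### Rays are separated by loops -/

/-- The union of the tiles on the side of the outer component used by the edge `e` and of a
part `S` of the tile of the parent of `e`. -/
def outerFamily (e : Edge F) (S : Set Torus) (w : Vertex F) : Set Torus :=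
  {p | (w = e.parent ∧ p ∈ S) ∨ (w ≠ e.parent ∧ (e.child.1 <:+ w.1 ∨ (¬ e.parent.1 <:+ w.1 ∧
    ∃ g : Edge F, g.child = e.parent ∧ D.atChild g ⊆ (tileKind F ν g.child).circle .outer)))}

/-- Without the vertex `e.parent` the tree falls into the branch of `e`, that of `e'` and, unless
this vertex is the root, the branch of the root. Each branch is contained in the family or disjoint
from it, so only the edges at `e.parent` matter; there a branch belongs to the family exactly when
its arc lies in the outer circle. -/
theorem compatible_outerFamily {e e' : Edge F} (hp : e'.parent = e.parent) (hne : e ≠ e')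
    (ho : D.atParent e ⊆ (tileKind F ν e.parent).circle .outer)
    (hi : D.atParent e' ⊆ (tileKind F ν e'.parent).circle .inner)
    (h2 : (tileKind F ν e.parent).TwoSided) {S : Set Torus}
    (hS : ∀ p ∈ (tileKind F ν e.parent).rim, p ∈ S ↔ p ∈ (tileKind F ν e.parent).circle .outer) :
    D.Compatible (D.outerFamily e S) := by
  have hdir : e'.dir = !e.dir := by
    by_contra h
    exact hne (Edge.ext_of_parent hp (by revert h; cases e.dir <;> cases e'.dir <;> simp)).symm
  have hdisj := TileKind.disjoint_circle_outer_inner h2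
  intro g x
  have hxr := ((D.isComp_atChild g).subset x.2).1
  have hgr := ((D.isComp_atParent g).subset (D.glue g x).2).1
  by_cases h1 : g.child = e.parent
  · have hlen : g.child.1.length = g.parent.1.length + 1 := rfl
    have hlen' : e.child.1.length = e.parent.1.length + 1 := rfl
    have hgp : g.parent ≠ e.parent := fun h => g.child_ne_parent (h1.trans h.symm)
    have n1 : ¬ e.child.1 <:+ g.parent.1 := fun h => by
      have := h.length_le; rw [h1] at hlen; omega
    have n2 : ¬ e.parent.1 <:+ g.parent.1 := fun h => by
      have := h.length_le; rw [h1] at hlen; omega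
    have l1 : (x : Torus) ∈ D.outerFamily e S g.child ↔
        (x : Torus) ∈ (tileKind F ν g.child).circle .outer := by
      rw [← h1] at hS
      rw [← hS x hxr]
      simp [outerFamily, h1]
    have l2 : (D.glue g x : Torus) ∈ D.outerFamily e S g.parent ↔
        D.atChild g ⊆ (tileKind F ν g.child).circle .outer := by
      simp only [outerFamily, mem_ofPred_eq, hgp, false_and, false_or, ne_eq, not_false_eq_true, n1,
        n2, true_and]
      refine ⟨?_, fun h => ⟨g, h1, h⟩⟩
      rintro ⟨g', h3, h4⟩
      rw [Edge.ext_of_child (h1.trans h3.symm)]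
      exact h4
    rw [l1, l2, (D.isComp_atChild g).subset_circle_iff (D.K_subset _) (D.K_cantor _)]
    refine ⟨fun h => ⟨x, x.2, h⟩, fun h => ?_⟩
    exact ((D.isComp_atChild g).subset_circle_iff (D.K_subset _) (D.K_cantor _)).2 h x.2
  by_cases h3 : g.parent = e.parent
  · have l2 : (D.glue g x : Torus) ∈ D.outerFamily e S g.parent ↔
        (D.glue g x : Torus) ∈ (tileKind F ν e.parent).circle .outer := by
      rw [← h3] at hS ⊢
      rw [← hS _ hgr]
      simp [outerFamily, h3]
    have l1 : (x : Torus) ∈ D.outerFamily e S g.child ↔ e.child.1 <:+ g.child.1 := by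
      have n2 : e.parent.1 <:+ g.child.1 := h3 ▸ List.suffix_cons _ _
      simp [outerFamily, h1, n2]
    rw [l1, l2]
    by_cases hd : g.dir = e.dir
    · obtain rfl := Edge.ext_of_parent h3 hd
      exact iff_of_true List.suffix_rfl (ho (D.glue g x).2)
    · obtain rfl : g = e' := Edge.ext_of_parent (h3.trans hp.symm) (by
        rw [hdir]; revert hd; cases e.dir <;> cases g.dir <;> simp)
      refine iff_of_false (fun h => hd ?_) fun h => ?_
      · have hlen : e.child.1.length = g.child.1.length := by
          simp only [Edge.child, List.length_cons]
          exact congrArg (fun v : Vertex F => v.1.length + 1) hp.symm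
        exact (List.cons.inj (h.eq_of_length hlen)).1.symm
      · rw [hp] at hi
        exact disjoint_left.1 hdisj h (hi (D.glue g x).2)
  · have n1 : e.child.1 <:+ g.child.1 ↔ e.child.1 <:+ g.parent.1 := by
      refine List.suffix_cons_iff.trans (or_iff_right fun h => h3 ?_)
      exact Subtype.ext (List.cons.inj h).2.symm
    have n2 : e.parent.1 <:+ g.child.1 ↔ e.parent.1 <:+ g.parent.1 := by
      refine List.suffix_cons_iff.trans (or_iff_right fun h => h1 ?_)
      exact Subtype.ext h.symm
    simp only [outerFamily, mem_ofPred_eq, h1, h3, false_and, false_or, n1, n2, ne_eq,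
      not_false_eq_true]

/-- With `S` the open, respectively closed, half collar of the outer circle, `outerFamily` gives an
open and a closed subset of `W` that differ by the loop. The tail of the ray to `f` lies in the
first, that of `f'` outside the second. -/
theorem rayEnd_comp_ne {f f' : F} {n : ℕ} (heq : rayVertexF f n = rayVertexF f' n)
    (hne : f.1 n ≠ f'.1 n)
    (ho : D.atParent (rayEdge f n) ⊆ (tileKind F ν (rayVertexF f n)).circle .outer)
    (hi : D.atParent (rayEdge f' n) ⊆ (tileKind F ν (rayVertexF f' n)).circle .inner)
    (h2 : (tileKind F ν (rayVertexF f n)).TwoSided) :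
    ∃ τ : C(Circle, D.Tile (rayVertexF f n)), D.IsTau _ τ ∧
      (D.rayEnd f).comp (D.trace _ τ) ≠ (D.rayEnd f').comp (D.trace _ τ) := by
  obtain ⟨τ, hτ⟩ := D.exists_loop (rayVertexF f n)
  refine ⟨τ, D.isTau_of_range h2 hτ, ?_⟩
  have hIcc : Icc (0 : ℝ) (1 / 2) ⊆ Icc 0 1 := Icc_subset_Icc_right (by norm_num)
  have hIco : Ico (0 : ℝ) (1 / 2) ⊆ Icc 0 1 := Ico_subset_Icc_self.trans hIcc
  set k := tileKind F ν (rayVertexF f n) with hk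
  set e := rayEdge f n
  have hnee : e ≠ rayEdge f' n := fun h => hne (congrArg Edge.dir h)
  have hp : (rayEdge f' n).parent = e.parent := heq.symm
  have c1 : D.Compatible (D.outerFamily e (k.box .outer univ (Ico 0 (1 / 2)))) :=
    D.compatible_outerFamily hp hnee ho hi h2 fun p hp =>
      TileKind.mem_box_univ_iff_of_mem_rim hIco (by norm_num) hp
  have c2 : D.Compatible (D.outerFamily e (k.box .outer univ (Icc 0 (1 / 2)))) :=
    D.compatible_outerFamily hp hnee ho hi h2 fun p hp =>
      TileKind.mem_box_univ_iff_of_mem_rim hIcc (by norm_num) hp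
  have hpar : e.parent = rayVertexF f n := rfl
  have self : ∀ (S : Set Torus) (p : Torus), p ∈ D.outerFamily e S (rayVertexF f n) ↔ p ∈ S := by
    intro S p
    simp [outerFamily, hpar]
  have other : ∀ (S S' : Set Torus) (p : Torus) (w : Vertex F), w ≠ rayVertexF f n →
      (p ∈ D.outerFamily e S w ↔ p ∈ D.outerFamily e S' w) := by
    intro S S' p w hw
    simp [outerFamily, hpar, hw]
  have const : ∀ (S : Set Torus) (w : Vertex F), w ≠ rayVertexF f n →
      D.outerFamily e S w = univ ∨ D.outerFamily e S w = ∅ := by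
    intro S w hw
    by_cases h : (e.child.1 <:+ w.1 ∨ (¬ e.parent.1 <:+ w.1 ∧
      ∃ g : Edge F, g.child = e.parent ∧ D.atChild g ⊆ (tileKind F ν g.child).circle .outer))
    · left; ext p; simp only [outerFamily, mem_ofPred_eq, mem_univ, iff_true]; exact Or.inr ⟨hw, h⟩
    · right; ext p
      simp only [outerFamily, mem_ofPred_eq, mem_empty_iff_false, iff_false]
      rintro (h' | h')
      exacts [hw h'.1, h h'.2]
  have ray : ∀ (g : F) (m : ℕ), n < m → rayVertexF g m ≠ rayVertexF f n := fun g m hm h => by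
    have := congrArg (fun v : Vertex F => v.1.length) h
    simp only [rayVertexF, length_rayVertex] at this
    omega
  refine Ends.comp_ne_of_separation (D.endLim_rayEnd f) (D.endLim_rayEnd f')
    (A := D.assemble (D.outerFamily e (k.box .outer univ (Ico 0 (1 / 2)))))
    (B := D.assemble (fun w => (D.outerFamily e (k.box .outer univ (Icc 0 (1 / 2))) w)ᶜ))
    (c1.isOpen_assemble fun w => ?_) (c2.compl.isOpen_assemble fun w => ?_) ?_ ?_ ?_ ?_
  · by_cases hw : w = rayVertexF f n
    · subst hw
      simp only [self]
      exact D.isOpen_halfCollar _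
    · rcases const (k.box .outer univ (Ico 0 (1 / 2))) w hw with h | h <;> · rw [h]; simp
  · by_cases hw : w = rayVertexF f n
    · subst hw
      simp only [mem_compl_iff, self]
      exact (D.isClosed_halfCollar _).isOpen_compl
    · rcases const (k.box .outer univ (Icc 0 (1 / 2))) w hw with h | h <;> · rw [h]; simp
  · rw [disjoint_left]
    intro x hx hx'
    obtain ⟨w, p, rfl⟩ := D.exists_incl x
    rw [c1.mem_assemble] at hx
    rw [c2.compl.mem_assemble] at hx'
    by_cases hw : w = rayVertexF f n
    · subst hw
      rw [mem_compl_iff, self] at hx'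
      rw [self] at hx
      exact hx' (image_mono (Set.prod_mono Subset.rfl Ico_subset_Icc_self) hx)
    · exact hx' ((other _ _ _ _ hw).1 hx)
  · intro x hx
    obtain ⟨w, p, rfl⟩ := D.exists_incl x
    rw [mem_union, c1.mem_assemble, c2.compl.mem_assemble]
    by_contra! h
    by_cases hw : w = rayVertexF f n
    · subst hw
      rw [mem_compl_iff, not_not, self, self] at h
      rcases mem_box_Ico_or h.2 with h' | h'
      · exact h.1 h'
      · obtain ⟨t, ht⟩ : p ∈ range τ := hτ ▸ h'
        exact hx ⟨t, congrArg (D.incl _) ht⟩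
    · exact h.2 fun h' => h.1 ((other _ _ _ _ hw).1 h')
  · rw [mem_rayFilter]
    filter_upwards [eventually_gt_atTop n] with m hm
    rintro _ ⟨p, rfl⟩
    rw [c1.mem_assemble]
    exact Or.inr ⟨ray f m hm, Or.inl (rayVertex_suffix f.1 (m := n + 1) hm)⟩
  · rw [mem_rayFilter]
    filter_upwards [eventually_gt_atTop n] with m hm
    rintro _ ⟨p, rfl⟩
    rw [c2.compl.mem_assemble]
    have hs := rayVertex_suffix f'.1 (m := n + 1) hm
    rintro (⟨h, -⟩ | ⟨-, h | ⟨h, -⟩⟩)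
    · exact ray f' m hm h
    · have h3 := List.IsSuffix.eq_of_length
        (List.suffix_of_suffix_length_le h hs (by simp [Edge.child, e, rayEdge, length_rayVertex]))
        (by simp [Edge.child, e, rayEdge, length_rayVertex])
      exact hne (List.cons.inj h3).1
    · refine h ?_
      rw [hpar, heq]
      exact rayVertex_suffix f'.1 hm.le

/-- The rays part at a branching vertex, where the two edges use components of opposite sides;
exchanging `f` and `f'` one may assume that `f` leaves through the outer one. -/
theorem exists_tau_separating {f f' : F} (h : f ≠ f') :
    ∃ v : Vertex F, (tileKind F ν v).TwoSided ∧ ∃ τ : C(Circle, D.Tile v), D.IsTau v τ ∧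
      (D.rayEnd f).comp (D.trace v τ) ≠ (D.rayEnd f').comp (D.trace v τ) := by
  classical
  have hex : ∃ n, f.1 n ≠ f'.1 n := by
    by_contra! h'
    exact h (Subtype.ext (funext h'))
  have hn := Nat.find_spec hex
  have hmin : ∀ i < Nat.find hex, f.1 i = f'.1 i := fun i hi => not_not.1 (Nat.find_min hex hi)
  set n := Nat.find hex
  have heq : rayVertexF f n = rayVertexF f' n := Subtype.ext (rayVertex_congr hmin)
  have hbr : Branching F (rayVertexF f n) := by
    intro b
    by_cases hb : b = f.1 n
    · exact ⟨f.1, f.2, n + 1, by rw [hb]; rfl⟩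
    · have hb' : b = f'.1 n := by
        revert hb hn; cases b <;> cases f.1 n <;> cases f'.1 n <;> simp
      refine ⟨f'.1, f'.2, n + 1, ?_⟩
      rw [hb', heq]; rfl
  have h2 := twoSided_of_branching (ν := ν) hbr
  have hns := D.not_sameSide (rayEdge f n) (rayEdge f' n) (fun h => hn (congrArg Edge.dir h)) heq
  obtain ⟨s, hs⟩ := D.exists_side _ (D.isComp_atParent (rayEdge f n))
  obtain ⟨s', hs'⟩ := D.exists_side _ (D.isComp_atParent (rayEdge f' n))
  have hs'' : D.atParent (rayEdge f' n) ⊆ (tileKind F ν (rayEdge f n).parent).circle s' := by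
    rwa [show (rayEdge f n).parent = (rayEdge f' n).parent from heq]
  cases s <;> cases s'
  · exact (hns ⟨_, hs, hs''⟩).elim
  · obtain ⟨τ, h3, h4⟩ := D.rayEnd_comp_ne heq hn hs hs' h2
    exact ⟨_, h2, τ, h3, h4⟩
  · obtain ⟨τ, h3, h4⟩ := D.rayEnd_comp_ne heq.symm hn.symm hs' hs (heq ▸ h2)
    exact ⟨_, heq ▸ h2, τ, h3, h4.symm⟩
  · exact (hns ⟨_, hs, hs''⟩).elim

theorem rayEnd_injective : Function.Injective D.rayEnd := by
  intro f f' h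
  by_contra hne
  obtain ⟨v, -, τ, -, h'⟩ := D.exists_tau_separating hne
  exact h' (by rw [h])

theorem disjoint_BEndsAt {f f' : F} (h : f ≠ f') :
    Disjoint (D.BEndsAt (D.rayEnd f)) (D.BEndsAt (D.rayEnd f')) := by
  rw [disjoint_left]
  intro b hb hb'
  obtain ⟨v, h2, τ, hτ, h'⟩ := D.exists_tau_separating h
  exact h' ((hb.2 v h2 τ hτ).symm.trans (hb'.2 v h2 τ hτ))

end Realization

/-! ### Threads -/

namespace TileKind

variable {k : TileKind} {K : Set Torus}

theorem circle_eq_of_nonempty {s s' : Side} (h : (k.circle s ∩ k.circle s').Nonempty) :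
    k.circle s = k.circle s' :=
  (circle_eq_or_disjoint s s').resolve_right (not_disjoint_iff_nonempty_inter.2 h)

theorem collar_eq_of_circle_eq {s s' : Side} (h : k.circle s = k.circle s') :
    k.collar s = k.collar s' := by
  refine (k.collar_eq_or_disjoint s s').resolve_right fun h' => ?_
  have : k.collar s 0 0 ∈ k.circle s' := by
    rw [← h, circle_eq_range]; exact ⟨0, rfl⟩
  rw [circle_eq_range] at this
  obtain ⟨θ, hθ⟩ := this
  exact h' 0 θ 0 (by simp) 0 (by simp) hθ.symm

theorem IsGap.congr {s s' : Side} (h : k.circle s = k.circle s') {a b : ℝ}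
    (hg : k.IsGap K s a b) : k.IsGap K s' a b := by
  have : k.angles K s' = k.angles K s := by simp only [angles, collar_eq_of_circle_eq h]
  obtain ⟨h1, h2, h3, h4, h5⟩ := hg
  exact ⟨h1, h2, this ▸ h3, this ▸ h4, this ▸ h5⟩

theorem arc_congr {s s' : Side} (h : k.circle s = k.circle s') (I : Set ℝ) :
    k.arc s I = k.arc s' I := by
  simp only [arc, collar_eq_of_circle_eq h]

end TileKind

namespace Realization

variable {F : Set (ℕ → Bool)} {ν : Vertex F → Bool} (D : Realization F ν)

/-- The ray to `f` does not cross any separating loop after its vertex `N`: the edges use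
components lying in the circles `s n`. -/
def Thread (f : F) (N : ℕ) (s : ℕ → Side) : Prop :=
  ∀ n ≥ N, D.atParent (rayEdge f n) ⊆ (tileKind F ν (rayVertexF f n)).circle (s n) ∧
    D.atChild (rayEdge f n) ⊆ (tileKind F ν (rayVertexF f (n + 1))).circle (s (n + 1))

/-- If there are two children, their edges use opposite sides, so both sides occur. Otherwise the
tile has a single circle, and there is a child because the tree has no dead ends. -/
theorem exists_child_edge (v : Vertex F) (s : Side) :
    ∃ e : Edge F, e.parent = v ∧ D.atParent e ⊆ (tileKind F ν e.parent).circle s := by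
  by_cases hbr : Branching F v
  · by_contra! h
    let e : Bool → Edge F := fun b => ⟨v.1, b, hbr b⟩
    obtain ⟨s0, h0⟩ := D.exists_side _ (D.isComp_atParent (e false))
    obtain ⟨s1, h1⟩ := D.exists_side _ (D.isComp_atParent (e true))
    have n0 : s0 ≠ s := fun h' => h (e false) rfl (h' ▸ h0)
    have n1 : s1 ≠ s := fun h' => h (e true) rfl (h' ▸ h1)
    have heq : s0 = s1 := by cases s0 <;> cases s1 <;> cases s <;> simp_all
    refine D.not_sameSide (e false) (e true) (fun h => by simpa [e] using congrArg Edge.dir h) rfl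
      ⟨s0, h0, heq ▸ h1⟩
  · obtain ⟨f, hf, n, hn⟩ := v.2
    refine ⟨rayEdge ⟨f, hf⟩ n, Subtype.ext hn, ?_⟩
    have hv : (rayEdge ⟨f, hf⟩ n).parent = v := Subtype.ext hn
    obtain ⟨s', h'⟩ := D.exists_side _ (D.isComp_atParent (rayEdge ⟨f, hf⟩ n))
    rw [← hv] at hbr
    rwa [TileKind.circle_eq_of_not_twoSided (not_twoSided_of_not_branching hbr) s s']

/-- Every circle of every tile lies on the thread of some ray. -/
theorem exists_thread (hF : IsClosed F) (v : Vertex F) (s : Side) :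
    ∃ f N t, rayVertexF f N = v ∧ t N = s ∧ D.Thread f N t := by
  choose e he hes using D.exists_child_edge
  choose σ hσ using fun e => D.exists_side _ (D.isComp_atChild e)
  -- Current vertex and side: go down the edge attached at this side, and continue with the side at
  -- which it reaches the child.
  let st : ℕ → Vertex F × Side := fun n =>
    n.rec (v, s) fun _ p => ((e p.1 p.2).child, σ (e p.1 p.2))
  let E : ℕ → Edge F := fun n => e (st n).1 (st n).2
  have hst : ∀ n, st (n + 1) = ((E n).child, σ (E n)) := fun n => rfl
  have hpar : ∀ n, (E n).parent = (st n).1 := fun n => he _ _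
  have hcons : ∀ n, (st (n + 1)).1.1 = (E n).dir :: (st n).1.1 := fun n => by
    rw [hst, ← hpar]; rfl
  obtain ⟨f, hf⟩ := exists_ray_of_path hF v.1.length (fun n => (st n).1.1) (fun n => (E n).dir) hcons
    (fun n => (st n).1.2) rfl
  have hedge : ∀ n, rayEdge f (v.1.length + n) = E n := fun n => by
    refine Edge.ext_of_child (Subtype.ext ?_)
    exact (hf (n + 1)).trans (by rw [hst])
  refine ⟨f, v.1.length, fun n => (st (n - v.1.length)).2, Subtype.ext (hf 0), by simp [st], ?_⟩
  intro n hn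
  obtain ⟨m, rfl⟩ := Nat.exists_eq_add_of_le hn
  have e1 : v.1.length + m - v.1.length = m := by omega
  have e2 : v.1.length + m + 1 - v.1.length = m + 1 := by omega
  dsimp only
  rw [e1, e2, ← rayEdge_child, ← rayEdge_parent, hedge, hst]
  exact ⟨hes _ _, hσ _⟩

variable {D}

theorem Thread.mono {f : F} {N M : ℕ} {s : ℕ → Side} (h : D.Thread f N s) (hNM : N ≤ M) :
    D.Thread f M s := fun n hn => h n (hNM.trans hn)

theorem circle_eq_of_subset {v : Vertex F} {A : Set Torus}
    (hA : (tileKind F ν v).IsBoundaryComponent (D.K v) A) {s s' : Side}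
    (h : A ⊆ (tileKind F ν v).circle s) (h' : A ⊆ (tileKind F ν v).circle s') :
    (tileKind F ν v).circle s = (tileKind F ν v).circle s' := by
  obtain ⟨x, hx⟩ := hA.nonempty
  exact TileKind.circle_eq_of_nonempty ⟨x, h hx, h' hx⟩

theorem Thread.circle_eq {f : F} {N : ℕ} {s s' : ℕ → Side} (h : D.Thread f N s)
    (h' : D.Thread f N s') {n : ℕ} (hn : N ≤ n) :
    (tileKind F ν (rayVertexF f n)).circle (s n) = (tileKind F ν (rayVertexF f n)).circle (s' n) :=
  circle_eq_of_subset (D.isComp_atParent (rayEdge f n)) (h n hn).1 (h' n hn).1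

variable (D) in
-- In a tile with only one circle any two boundary components lie on the same side, so the condition
-- on the kind of the tile can be dropped.
theorem xi_succ_eq_one_iff (f : F) (n : ℕ) : D.xi f (n + 1) = 1 ↔
    (tileKind F ν (rayVertexF f (n + 1))).SameSide (D.atChild (rayEdge f n))
      (D.atParent (rayEdge f (n + 1))) := by
  have key : ¬ (tileKind F ν (rayVertexF f (n + 1))).TwoSided →
      (tileKind F ν (rayVertexF f (n + 1))).SameSide (D.atChild (rayEdge f n))
      (D.atParent (rayEdge f (n + 1))) := fun h => by
    obtain ⟨s, hs⟩ := D.exists_side _ (D.isComp_atChild (rayEdge f n))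
    obtain ⟨s', hs'⟩ := D.exists_side _ (D.isComp_atParent (rayEdge f (n + 1)))
    refine ⟨s, hs, ?_⟩
    rw [TileKind.circle_eq_of_not_twoSided h s s']
    exact hs'
  rw [xi]
  split_ifs with h
  · simp [h.2]
  · simp only [true_iff]
    by_contra h'
    exact h ⟨not_not.1 fun h2 => h' (key h2), h'⟩

/-- The side `s n` is that of the arc towards the next vertex, and `xi` compares it with the arc of
arrival. A thread from `N` restricts the arrivals at the vertices `N + 1, N + 2, …`, which matches
the strict inequality in `TopAccessible`. -/
theorem topAccessible_iff {f : F} : D.TopAccessible f ↔ ∃ N s, D.Thread f N s := by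
  constructor
  · rintro ⟨N, hN⟩
    choose s hs using fun n => D.exists_side _ (D.isComp_atParent (rayEdge f n))
    refine ⟨N, s, fun n hn => ⟨hs n, ?_⟩⟩
    obtain ⟨t, h1, h2⟩ := (D.xi_succ_eq_one_iff f n).1 (hN (n + 1) (by omega))
    have := circle_eq_of_subset (D.isComp_atParent (rayEdge f (n + 1))) h2 (hs (n + 1))
    rw [← rayEdge_parent, ← this]
    exact h1
  · rintro ⟨N, s, h⟩
    refine ⟨N, fun n hn => ?_⟩
    obtain ⟨m, rfl⟩ := Nat.exists_eq_add_of_lt hn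
    rw [D.xi_succ_eq_one_iff]
    exact ⟨s (N + m + 1), (h _ (by omega)).2, (h _ (by omega)).1⟩

variable (D) in
-- The circle has points off `K` arbitrarily close to `κ`. Since `τ` is an arbitrary loop, it is the
-- points of the circle, and not just points near it, that are known to lie on a given side of it.
theorem ptEnd_comp_inter_circle {v : Vertex F} (κ : D.K v) {s : Side}
    (hκ : (κ : Torus) ∈ (tileKind F ν v).circle s) (C : Compacts D.W) :
    ((D.ptEnd v κ).comp C ∩ D.incl v '' {p | p.1 ∈ (tileKind F ν v).circle s}).Nonempty := by
  have h := D.endLim_ptEnd v κ C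
  rw [ptFilter, mem_map, mem_comap] at h
  obtain ⟨O, hO, hsub⟩ := h
  rw [TileKind.circle_eq_range] at hκ
  obtain ⟨x, hx⟩ := hκ
  have hx' : (tileKind F ν v).collar s x 0 = κ := hx
  have hc := ((tileKind F ν v).continuous_collar_left s 0).tendsto x
  rw [hx'] at hc
  obtain ⟨δ, hδ, hball⟩ := Metric.mem_nhds_iff.1 (hc hO)
  obtain ⟨y, hy, hyK⟩ := TileKind.exists_notMem_angles (s := s) (D.K_cantor v)
    (show x < x + δ by linarith)
  have hyO : (tileKind F ν v).collar s y 0 ∈ O := hball (by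
    rw [Metric.mem_ball, Real.dist_eq, abs_lt]
    constructor <;> linarith [hy.1, hy.2])
  refine ⟨D.incl v (D.mkTile v _ ⟨(tileKind F ν v).collar_mem_body s y (by simp), hyK⟩),
    hsub hyO, _, ?_, rfl⟩
  rw [TileKind.circle_eq_range]
  exact ⟨y, rfl⟩

/-- The removed points of the circles of a thread are not separated from the end of the ray. -/
theorem Thread.comp_eq {f : F} {N : ℕ} {s : ℕ → Side} (h : D.Thread f N s) (κ : D.K (rayVertexF f N))
    (hκ : (κ : Torus) ∈ (tileKind F ν (rayVertexF f N)).circle (s N)) {v : Vertex F}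
    {τ : C(Circle, D.Tile v)} (hτ : D.IsTau v τ) :
    (D.ptEnd _ κ).comp (D.trace v τ) = (D.rayEnd f).comp (D.trace v τ) := by
  classical
  choose S hS hSτ hSs using fun s => IsTau.exists_side D hτ s
  -- The tiles of the ray, except that the tile of the loop is replaced by the side of the loop
  -- containing the circle of the thread. Consecutive sets still meet, along the glued arc.
  let Z : ℕ → Set D.W := fun n => if rayVertexF f n = v then D.incl v '' S (s n) else
    range (D.incl (rayVertexF f n))
  have hZ : ∀ n, IsPreconnected (Z n) := fun n => by
    by_cases hn : rayVertexF f n = v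
    · simp only [Z, if_pos hn]
      exact (hS (s n)).image _ (D.incl v).continuous.continuousOn
    · simp only [Z, if_neg hn]
      exact D.isPreconnected_range_incl _
  have hZsub : ∀ n, Z n ⊆ (D.trace v τ : Set D.W)ᶜ := fun n => by
    by_cases hn : rayVertexF f n = v
    · simp only [Z, if_pos hn]
      rintro _ ⟨p, hp, rfl⟩ ⟨t, ht⟩
      exact hSτ _ hp ⟨t, D.incl_injective v ht⟩
    · simp only [Z, if_neg hn]
      exact D.disjoint_trace hτ (Ne.symm hn)
  have hZc : ∀ n, D.incl (rayVertexF f n) '' {p | p.1 ∈ (tileKind F ν (rayVertexF f n)).circle (s n)} ⊆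
      Z n := fun n => by
    by_cases hn : rayVertexF f n = v
    · simp only [Z, if_pos hn]
      subst hn
      exact image_mono fun p hp => hSs _ p hp
    · simp only [Z, if_neg hn]
      exact image_subset_range _ _
  have hU : IsPreconnected (⋃ n, Z (N + n)) := by
    refine IsPreconnected.iUnion_of_chain (fun n => hZ _) fun n => ?_
    obtain ⟨x, hx⟩ := (D.isComp_atChild (rayEdge f (N + n))).nonempty
    have hN := h (N + n) (by omega)
    refine ⟨D.incl _ (D.arcIncl _ (D.isComp_atChild (rayEdge f (N + n))) ⟨x, hx⟩), ?_, ?_⟩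
    · rw [D.incl_glue (rayEdge f (N + n)) ⟨x, hx⟩ rfl
        (q := D.arcIncl _ (D.isComp_atParent (rayEdge f (N + n))) (D.glue _ ⟨x, hx⟩)) rfl]
      exact hZc (N + n) ⟨_, hN.1 (D.glue _ ⟨x, hx⟩).2, rfl⟩
    · exact hZc (N + n + 1) ⟨_, hN.2 hx, rfl⟩
  refine Ends.comp_eq_of_connected _ _ hU (iUnion_subset fun n => hZsub _) ?_ ?_
  · obtain ⟨x, hx1, hx2⟩ := D.ptEnd_comp_inter_circle κ hκ (D.trace v τ)
    exact ⟨x, hx1, mem_iUnion.2 ⟨0, hZc N hx2⟩⟩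
  · have h1 := D.mem_rayFilter.1 (D.endLim_rayEnd f (D.trace v τ))
    have h2 : ∀ᶠ n in atTop, rayVertexF f n ≠ v := by
      rw [← Nat.cofinite_eq_atTop]
      exact (rayVertexF_injective f).tendsto_cofinite.eventually (eventually_cofinite_ne v)
    obtain ⟨n, hn, hnN, hnv⟩ := (h1.and ((eventually_ge_atTop N).and h2)).exists
    obtain ⟨m, rfl⟩ := Nat.exists_eq_add_of_le hnN
    obtain ⟨x, hx⟩ := D.range_incl_nonempty (rayVertexF f (N + m))
    refine ⟨x, hn hx, mem_iUnion.2 ⟨m, ?_⟩⟩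
    simp only [Z, if_neg hnv]
    exact hx

end Realization

/-! ### The ends of the boundary that are not separated from the end of a ray -/

namespace TileKind

variable {k : TileKind} {K : Set Torus} {s : Side}

theorem IsGap.eq_of_mem {a b c d x : ℝ} (h : k.IsGap K s a b) (h' : k.IsGap K s c d)
    (hx : x ∈ Ioo a b) (hx' : x ∈ Ioo c d) : a = c ∧ b = d := by
  have h1 := fun hh => h.disj c hh h'.left_mem
  have h2 := fun hh => h'.disj a hh h.left_mem
  have h3 := fun hh => h.disj d hh h'.right_mem
  have h4 := fun hh => h'.disj b hh h.right_mem
  constructor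
  · rcases lt_trichotomy a c with h5 | h5 | h5
    · exact (h1 ⟨h5, hx'.1.trans hx.2⟩).elim
    · exact h5
    · exact (h2 ⟨h5, hx.1.trans hx'.2⟩).elim
  · rcases lt_trichotomy b d with h5 | h5 | h5
    · exact (h4 ⟨hx'.1.trans hx.2, h5⟩).elim
    · exact h5
    · exact (h3 ⟨hx.1.trans hx'.2, h5⟩).elim

theorem IsGap.eq_of_arc_eq {a b c d : ℝ} (h : k.IsGap K s a b) (h' : k.IsGap K s c d)
    (heq : k.arc s (Ioo a b) = k.arc s (Ioo c d)) : ∃ n : ℤ, a = c + n ∧ b = d + n := by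
  obtain ⟨x, hx⟩ := exists_between h.lt
  have hm : k.collar s x 0 ∈ k.arc s (Ioo c d) := heq ▸ ⟨x, hx, rfl⟩
  obtain ⟨y, hy, hyx⟩ := hm
  obtain ⟨-, n, hn⟩ := k.collar_inj s (by simp) (by simp) hyx
  refine ⟨n, h.eq_of_mem (h'.add_int n) hx ⟨?_, ?_⟩⟩ <;> linarith [hy.1, hy.2]

theorem IsGap.mem_ends {a b : ℝ} (hg : k.IsGap K s a b) {κ : Torus} (hκ : κ ∈ K)
    (h : κ ∈ closure (k.arc s (Ioo a b))) : κ = k.collar s a 0 ∨ κ = k.collar s b 0 := by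
  obtain ⟨θ, hθ, rfl⟩ : κ ∈ k.arc s (Icc a b) := closure_minimal (arc_mono Ioo_subset_Icc_self)
    (isCompact_arc isCompact_Icc).isClosed h
  rcases hθ.1.eq_or_lt with rfl | h3
  · exact Or.inl rfl
  · rcases hθ.2.eq_or_lt with rfl | h4
    · exact Or.inr rfl
    · exact (hg.disj θ ⟨h3, h4⟩ hκ).elim

end TileKind

namespace Realization

variable {F : Set (ℕ → Bool)} {ν : Vertex F → Bool} (D : Realization F ν)

theorem angles_nonempty (v : Vertex F) (s : Side) : ((tileKind F ν v).angles (D.K v) s).Nonempty := by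
  obtain ⟨h⟩ := D.K_cantor v s
  obtain ⟨hK, hx⟩ := (h.symm fun _ => false).2
  obtain ⟨θ, hθ⟩ := (TileKind.circle_eq_range _ _).subset hx
  refine ⟨θ, ?_⟩
  change (fun θ => (tileKind F ν v).collar s θ 0) θ ∈ D.K v
  rw [hθ]
  exact hK

/-- The unglued boundary components are dense. -/
theorem exists_free_gap (v : Vertex F) {s : Side} {x δ : ℝ}
    (hx : x ∈ (tileKind F ν v).angles (D.K v) s) (hδ : 0 < δ) :
    ∃ a b, (tileKind F ν v).IsGap (D.K v) s a b ∧
      (tileKind F ν v).arc s (Ioo a b) ∉ D.gluedArcs v ∧ b ∈ Ioo (x - δ) (x + δ) := by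
  have hinf := TileKind.infinite_inter_arc (D.K_subset v) (D.K_cantor v) hx hδ
  -- The finitely many glued arcs have finitely many limit points in `K`, so near `x` there is a
  -- point `y` of the Cantor set at positive distance from all glued arcs.
  have hfin : (⋃ A ∈ D.gluedArcs v, closure A ∩ D.K v).Finite := by
    refine (D.finite_gluedArcs v).biUnion fun A hA => ?_
    obtain ⟨s', a, b, hg, rfl⟩ := (D.isBoundaryComponent_iff v).1
      (D.isBoundaryComponent_of_mem_gluedArcs hA)
    exact (toFinite {(tileKind F ν v).collar s' a 0, (tileKind F ν v).collar s' b 0}).subset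
      fun κ hκ => hg.mem_ends hκ.2 hκ.1
  obtain ⟨_, ⟨hyK, y, hy, rfl⟩, hyn⟩ := hinf.exists_notMem_finite hfin
  dsimp only at hyK hyn
  have hcl : IsClosed (⋃ A ∈ D.gluedArcs v, closure A) :=
    (D.finite_gluedArcs v).isClosed_biUnion fun _ _ => isClosed_closure
  have hyn' : (tileKind F ν v).collar s y 0 ∉ ⋃ A ∈ D.gluedArcs v, closure A := fun h => by
    obtain ⟨A, hA, h⟩ := mem_iUnion₂.1 h
    exact hyn (mem_iUnion₂.2 ⟨A, hA, h, hyK⟩)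
  obtain ⟨ε, hε, hball⟩ := Metric.mem_nhds_iff.1
    (((tileKind F ν v).continuous_collar_left s 0).tendsto y (hcl.isOpen_compl.mem_nhds hyn'))
  obtain ⟨z, hz, hzK⟩ := TileKind.exists_notMem_angles (s := s) (D.K_cantor v)
    (show max (y - ε) (x - δ) < y from max_lt (by linarith) hy.1)
  -- This gap contains a point `z` just before `y` and ends at `y` or earlier. It is not glued,
  -- because no point so close to `y` belongs to a glued arc.
  obtain ⟨a, b, hg, hzg⟩ := TileKind.exists_gap (D.K_subset v) (D.K_cantor v) hzK
  have hby : b ≤ y := by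
    by_contra! h
    exact hg.disj y ⟨hzg.1.trans hz.2, h⟩ hyK
  have hz1 := (le_max_left _ _).trans_lt hz.1
  have hz2 := (le_max_right _ _).trans_lt hz.1
  refine ⟨a, b, hg, fun hA => ?_, by linarith [hzg.2], by linarith [hy.2]⟩
  refine hball (a := z) ?_ (mem_biUnion hA (subset_closure ⟨z, hzg, rfl⟩))
  rw [Metric.mem_ball, Real.dist_eq, abs_lt]
  constructor <;> linarith [hz.2]

theorem angleEnd_congr {v : Vertex F} {s s' : Side} {x y : ℝ}
    (hx : x ∈ (tileKind F ν v).angles (D.K v) s) (hy : y ∈ (tileKind F ν v).angles (D.K v) s')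
    (h : (tileKind F ν v).collar s x 0 = (tileKind F ν v).collar s' y 0) :
    D.angleEnd v s ⟨x, hx⟩ = D.angleEnd v s' ⟨y, hy⟩ := by
  rw [angleEnd, angleEnd]
  congr 1
  exact Subtype.ext h

theorem ptEnd_injective (v : Vertex F) : Function.Injective (D.ptEnd v) := by
  intro κ κ' h
  rcases D.eq_or_matched_of_ptEnd_eq h with h | ⟨e, ⟨h1, h2, -⟩ | ⟨h1, h2, -⟩⟩
  · exact eq_of_heq (Sigma.mk.inj h).2
  · exact (e.child_ne_parent (h1.symm.trans h2)).elim
  · exact (e.child_ne_parent (h2.symm.trans h1)).elim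

variable {D}

/-- A thread that cannot be extended towards the root. -/
structure MinThread (D : Realization F ν) (f : F) (N : ℕ) (s : ℕ → Side) : Prop where
  thread : D.Thread f N s
  min : ∀ e : Edge F, e.child = rayVertexF f N → ¬ D.atChild e ⊆ (tileKind F ν e.child).circle (s N)

/-- Take the least starting level. If the arc of arrival at the first vertex lay in the circle of
the thread, the side at which the same edge leaves the parent would extend the thread by one level.
Nothing arrives at the root. -/
theorem exists_minThread {f : F} (h : ∃ N s, D.Thread f N s) : ∃ N s, D.MinThread f N s := by
  classical
  obtain ⟨s, hs⟩ := Nat.find_spec h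
  have hmin := fun M hM => Nat.find_min h (m := M) hM
  set N := Nat.find h
  refine ⟨N, s, hs, fun e he hsub => ?_⟩
  obtain ⟨M, hM⟩ : ∃ M, N = M + 1 := by
    refine Nat.exists_eq_succ_of_ne_zero fun h0 => ?_
    rw [h0] at he
    exact absurd (congrArg Subtype.val he) (List.cons_ne_nil _ _)
  rw [hM] at he hs hsub
  obtain rfl : e = rayEdge f M := Edge.ext_of_child he
  obtain ⟨t, ht⟩ := D.exists_side _ (D.isComp_atParent (rayEdge f M))
  refine hmin M (by omega) ⟨fun n => if n = M then t else s n, fun n hn => ?_⟩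
  rcases hn.eq_or_lt with rfl | hn
  · simp only [if_pos, if_neg (Nat.succ_ne_self M)]
    exact ⟨ht, hsub⟩
  · simp only [if_neg hn.ne', if_neg (show n + 1 ≠ M by omega)]
    exact hs n hn

/-- Two threads of the same ray use the same circles at common levels, both being those of the
outgoing arcs. An earlier start would put the arc of arrival at level `N` in the circle of the
thread. -/
theorem MinThread.le {f : F} {N M : ℕ} {s t : ℕ → Side} (h : D.MinThread f N s)
    (h' : D.Thread f M t) : N ≤ M := by
  by_contra! hlt
  obtain ⟨P, rfl⟩ : ∃ P, N = P + 1 := Nat.exists_eq_succ_of_ne_zero (by omega)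
  refine h.min (rayEdge f P) rfl ?_
  have h1 := Thread.circle_eq h.thread (h'.mono hlt.le) le_rfl
  exact (h' P (by omega)).2.trans h1.symm.subset

/-- A second child edge is attached at the opposite side, and at the first level minimality excludes
the arc towards the parent. -/
theorem MinThread.eq_of_mem_gluedArcs {f : F} {N : ℕ} {s : ℕ → Side} (h : D.MinThread f N s)
    {n : ℕ} {A : Set Torus} (hA : A ∈ D.gluedArcs (rayVertexF f (N + n)))
    (hs : A ⊆ (tileKind F ν (rayVertexF f (N + n))).circle (s (N + n))) :
    A = D.atParent (rayEdge f (N + n)) ∨ ∃ m, n = m + 1 ∧ A = D.atChild (rayEdge f (N + m)) := by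
  obtain ⟨e, ⟨he, rfl⟩ | ⟨he, rfl⟩⟩ := hA
  · right
    cases n with
    | zero => exact (h.min e he (he ▸ hs)).elim
    | succ m =>
      obtain rfl : e = rayEdge f (N + m) := Edge.ext_of_child he
      exact ⟨m, rfl, rfl⟩
  · left
    by_cases hne : e = rayEdge f (N + n)
    · rw [hne]
    · refine (D.not_sameSide e _ hne he ⟨s (N + n), ?_, ?_⟩).elim
      · rw [he]; exact hs
      · rw [he]; exact (h.thread (N + n) (by omega)).1

theorem Thread.mem_BEndsAt {f : F} {N : ℕ} {s : ℕ → Side} (h : D.Thread f N s) {x : ℝ}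
    (hx : x ∈ (tileKind F ν (rayVertexF f N)).angles (D.K (rayVertexF f N)) (s N))
    (hb : D.angleEnd _ _ ⟨x, hx⟩ ∈ D.BEnds) : D.angleEnd _ _ ⟨x, hx⟩ ∈ D.BEndsAt (D.rayEnd f) := by
  refine ⟨hb, fun v _ τ hτ => h.comp_eq _ ?_ hτ⟩
  rw [TileKind.circle_eq_range]
  exact ⟨x, rfl⟩

/-- The end is defined by a removed point on some circle of a tile, and the thread that starts at
this circle leads to the required `f`. -/
theorem exists_thread_of_mem_BEnds (hF : IsClosed F) {b : Ends D.W} (hb : b ∈ D.BEnds) :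
    ∃ f N s, D.Thread f N s ∧ b ∈ D.BEndsAt (D.rayEnd f) ∧
      ∃ x y, ∃ hg : (tileKind F ν (rayVertexF f N)).IsGap (D.K (rayVertexF f N)) (s N) x y,
      (tileKind F ν (rayVertexF f N)).arc (s N) (Ioo x y) ∉ D.gluedArcs (rayVertexF f N) ∧
      (b = D.angleEnd _ _ ⟨x, hg.left_mem⟩ ∨ b = D.angleEnd _ _ ⟨y, hg.right_mem⟩) := by
  obtain ⟨v, s', x, y, hg, hfree, h⟩ := D.mem_BEnds_iff.1 hb
  obtain ⟨f, N, s, rfl, rfl, hT⟩ := D.exists_thread hF v s'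
  refine ⟨f, N, s, hT, ?_, x, y, hg, hfree, h⟩
  rcases h with rfl | rfl
  exacts [hT.mem_BEndsAt _ hb, hT.mem_BEndsAt _ hb]

theorem iUnion_BEndsAt (hF : IsClosed F) : ⋃ f, D.BEndsAt (D.rayEnd f) = D.BEnds := by
  refine Subset.antisymm (iUnion_subset fun f b hb => hb.1) fun b hb => ?_
  obtain ⟨f, -, -, -, h, -⟩ := exists_thread_of_mem_BEnds hF hb
  exact mem_iUnion.2 ⟨f, h⟩

theorem exists_thread_of_mem_BEndsAt (hF : IsClosed F) {f : F} {b : Ends D.W}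
    (hb : b ∈ D.BEndsAt (D.rayEnd f)) :
    ∃ N s, D.Thread f N s ∧
      ∃ x y, ∃ hg : (tileKind F ν (rayVertexF f N)).IsGap (D.K (rayVertexF f N)) (s N) x y,
      (tileKind F ν (rayVertexF f N)).arc (s N) (Ioo x y) ∉ D.gluedArcs (rayVertexF f N) ∧
      (b = D.angleEnd _ _ ⟨x, hg.left_mem⟩ ∨ b = D.angleEnd _ _ ⟨y, hg.right_mem⟩) := by
  obtain ⟨f', N, s, hT, h1, h2⟩ := exists_thread_of_mem_BEnds hF hb.1
  obtain rfl : f = f' := by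
    by_contra hne
    exact disjoint_left.1 (D.disjoint_BEndsAt hne) hb h1
  exact ⟨N, s, hT, h2⟩

theorem MinThread.mem_BEndsAt {f : F} {N : ℕ} {s : ℕ → Side} (h : D.MinThread f N s) {n : ℕ} {x y : ℝ}
    (hg : (tileKind F ν (rayVertexF f (N + n))).IsGap (D.K (rayVertexF f (N + n))) (s (N + n)) x y)
    (hfree : (tileKind F ν (rayVertexF f (N + n))).arc (s (N + n)) (Ioo x y) ∉
      D.gluedArcs (rayVertexF f (N + n))) :
    D.angleEnd _ _ ⟨y, hg.right_mem⟩ ∈ D.BEndsAt (D.rayEnd f) :=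
  (h.thread.mono (by omega)).mem_BEndsAt _ (D.mem_BEnds_iff.2 ⟨_, _, x, y, hg, hfree, Or.inr rfl⟩)

/-- By disjointness the thread through the circle of `b` is one of the ray to `f`. It starts at
level `N` or later and there uses the same circles as the minimal thread, though perhaps with
another name of the side. -/
theorem MinThread.exists_of_mem_BEndsAt (hF : IsClosed F) {f : F} {N : ℕ} {s : ℕ → Side}
    (h : D.MinThread f N s) {b : Ends D.W} (hb : b ∈ D.BEndsAt (D.rayEnd f)) :
    ∃ n x, ∃ hx : x ∈ (tileKind F ν (rayVertexF f (N + n))).angles (D.K (rayVertexF f (N + n)))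
      (s (N + n)), b = D.angleEnd _ _ ⟨x, hx⟩ := by
  obtain ⟨M, t, hT, x, y, hg, -, hb⟩ := exists_thread_of_mem_BEndsAt hF hb
  obtain ⟨n, rfl⟩ := Nat.exists_eq_add_of_le (h.le hT)
  have hc := Thread.circle_eq hT (h.thread.mono (by omega)) le_rfl
  have hg' := hg.congr hc
  have hcol := fun x => congrFun (congrFun (TileKind.collar_eq_of_circle_eq hc) x) 0
  rcases hb with rfl | rfl
  · exact ⟨n, x, hg'.left_mem, D.angleEnd_congr _ _ (hcol x)⟩
  · exact ⟨n, y, hg'.right_mem, D.angleEnd_congr _ _ (hcol y)⟩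

theorem nonempty_BEndsAt_iff (hF : IsClosed F) (f : F) :
    (D.BEndsAt (D.rayEnd f)).Nonempty ↔ D.TopAccessible f := by
  rw [topAccessible_iff]
  constructor
  · rintro ⟨b, hb⟩
    obtain ⟨N, s, hT, -⟩ := exists_thread_of_mem_BEndsAt hF hb
    exact ⟨N, s, hT⟩
  · intro h
    obtain ⟨N, s, h⟩ := exists_minThread h
    obtain ⟨x, hx⟩ := D.angles_nonempty (rayVertexF f (N + 0)) (s (N + 0))
    obtain ⟨a, b, hg, hfree, -⟩ := D.exists_free_gap _ hx one_pos
    exact ⟨_, h.mem_BEndsAt hg hfree⟩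

end Realization

/-! ### Coordinates on the Cantor sets -/

/-- A monotone function that collapses exactly the gaps of a closed set, normalized on an
interval. -/
theorem exists_piece_coordinate {Q : Set ℝ} (hQ : IsClosed Q) {c d : ℝ} (hc : c ∈ Q)
    (hcd : (Ioo c d ∩ Q).Nonempty) {G : ℝ → ℝ} (hG : Continuous G) (hm : Monotone G)
    (hGQ : ∀ x y, c ≤ x → x < y → y ≤ d → (G x = G y ↔ Disjoint (Ioo x y) Q)) :
    ∃ g : ℝ → ℝ, Continuous g ∧ Monotone g ∧ g c = 0 ∧ g d = 1 ∧
      (∀ x y, c ≤ x → x < y → y ≤ d → (g x = g y ↔ Disjoint (Ioo x y) Q)) ∧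
      ∀ r ∈ Icc (0 : ℝ) 1, ∃ x ∈ Q ∩ Icc c d, g x = r := by
  obtain ⟨q, hq, hqQ⟩ := hcd
  have hlt : c < d := hq.1.trans hq.2
  have hpos : 0 < G d - G c := by
    refine sub_pos.2 ((hm hlt.le).lt_of_ne fun h => ?_)
    exact disjoint_left.1 ((hGQ c d le_rfl hlt le_rfl).1 h) hq hqQ
  set g : ℝ → ℝ := fun x => (G x - G c) / (G d - G c) with hg
  have hgc : Continuous g := (hG.sub continuous_const).div_const _
  have hgQ : ∀ x y, c ≤ x → x < y → y ≤ d → (g x = g y ↔ Disjoint (Ioo x y) Q) := by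
    intro x y h1 h2 h3
    rw [← hGQ x y h1 h2 h3, hg]
    dsimp only
    rw [div_left_inj' hpos.ne', sub_left_inj]
  have h0 : g c = 0 := by simp [hg]
  have h1 : g d = 1 := div_self hpos.ne'
  refine ⟨g, hgc, fun x y h => ?_, h0, h1, hgQ, fun r hr => ?_⟩
  · exact div_le_div_of_nonneg_right (sub_le_sub_right (hm h) _) hpos.le
  · obtain ⟨x, hx, rfl⟩ := intermediate_value_Icc hlt.le hgc.continuousOn (by rwa [h0, h1])
    -- A value taken at `x` is also taken at the last point of `Q` up to `x`, since the function is
    -- constant from there to `x`.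
    have hcomp : IsCompact (Q ∩ Icc c x) := isCompact_Icc.inter_left hQ
    have hne : (Q ∩ Icc c x).Nonempty := ⟨c, hc, le_rfl, hx.1⟩
    have hs := hcomp.sSup_mem hne
    set y := sSup (Q ∩ Icc c x)
    refine ⟨y, ⟨hs.1, hs.2.1, hs.2.2.trans hx.2⟩, ?_⟩
    rcases hs.2.2.eq_or_lt with h | h
    · rw [h]
    · refine (hgQ y x hs.2.1 h hx.2).2 (disjoint_left.2 fun z hz hzQ => ?_)
      exact (le_csSup hcomp.bddAbove ⟨hzQ, hs.2.1.trans hz.1.le, hz.2.le⟩).not_gt hz.1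

namespace TileKind

variable {k : TileKind} {K : Set Torus} {s : Side}

/-- Cutting the circle open at the gap `(a, b)` leaves the angles `[b, a + 1]`, less than one turn,
in which every point of `K` on the circle is represented exactly once. -/
theorem exists_cantor_param (hK : K ⊆ k.rim) (hC : ∀ s, IsCantorSet (K ∩ k.circle s)) {a b : ℝ}
    (hg : k.IsGap K s a b) : ∃ ρ : (ℕ → Bool) → ℝ, Continuous ρ ∧ Function.Injective ρ ∧
      range ρ = k.angles K s ∩ Icc b (a + 1) := by
  obtain ⟨φ⟩ := hC s
  have hmem : ∀ x : ↥(k.angles K s ∩ Icc b (a + 1)), k.collar s x 0 ∈ K ∩ k.circle s := fun x =>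
    ⟨x.2.1, by rw [circle_eq_range]; exact ⟨x, rfl⟩⟩
  let m : ↥(k.angles K s ∩ Icc b (a + 1)) → ↥(K ∩ k.circle s) := fun x => ⟨k.collar s x 0, hmem x⟩
  have hm : Continuous m :=
    ((k.continuous_collar_left s 0).comp continuous_subtype_val).subtype_mk _
  have hinj : Function.Injective m := by
    rintro ⟨x, hx⟩ ⟨y, hy⟩ h
    obtain ⟨-, n, hn⟩ := k.collar_inj s (by simp) (by simp) (congrArg Subtype.val h)
    dsimp only at hn
    have hlt := hg.lt
    have h1 : (n : ℝ) < 1 := by linarith [hx.2.1, hy.2.2]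
    have h2 : (-1 : ℝ) < n := by linarith [hx.2.2, hy.2.1]
    have h1' : n < 1 := by exact_mod_cast h1
    have h2' : -1 < n := by exact_mod_cast h2
    obtain rfl : n = 0 := by omega
    exact Subtype.ext (by simpa using hn.symm)
  have hsurj : Function.Surjective m := by
    rintro ⟨p, hp, hpc⟩
    obtain ⟨θ, rfl⟩ := (circle_eq_range k s).subset hpc
    obtain ⟨n, hn⟩ := exists_int_shift b θ
    have hang : θ + n ∈ k.angles K s := (angles_add_int n).2 hp
    refine ⟨⟨θ + n, hang, hn.1, ?_⟩, Subtype.ext (k.collar_add_int s θ 0 n)⟩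
    by_contra! h
    have := (hg.add_int 1).disj (θ + n)
    rw [Int.cast_one] at this
    exact this ⟨h, hn.2⟩ hang
  have hcomp : CompactSpace ↥(k.angles K s ∩ Icc b (a + 1)) := isCompact_iff_compactSpace.1
    (isCompact_Icc.inter_left (isClosed_angles hK hC s))
  let e := hm.homeoOfEquivCompactToT2 (f := Equiv.ofBijective m ⟨hinj, hsurj⟩)
  refine ⟨fun z => (e.symm (φ.symm z) : ℝ), continuous_subtype_val.comp
    (e.symm.continuous.comp φ.symm.continuous), fun z z' h => ?_, ?_⟩
  · exact φ.symm.injective (e.symm.injective (Subtype.ext h))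
  · ext x
    constructor
    · rintro ⟨z, rfl⟩
      exact (e.symm (φ.symm z)).2
    · intro hx
      exact ⟨φ (e ⟨x, hx⟩), by simp⟩

/-- Two different gaps in cyclic order on a circle. -/
structure Frame (k : TileKind) (K : Set Torus) (s : Side) (p c : Set Torus) where
  a₀ : ℝ
  a₁ : ℝ
  a₂ : ℝ
  a₃ : ℝ
  gap_p : k.IsGap K s a₀ a₁
  gap_c : k.IsGap K s a₂ a₃
  arc_p : p = k.arc s (Ioo a₀ a₁)
  arc_c : c = k.arc s (Ioo a₂ a₃)
  lt₁₂ : a₁ < a₂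
  lt₃₀ : a₃ < a₀ + 1

/-- The second gap is translated by an integer to follow the first one. The inequalities between
different gaps are strict because gaps are never adjacent. -/
theorem nonempty_frame (hK : K ⊆ k.rim) (hC : ∀ s, IsCantorSet (K ∩ k.circle s)) {p c : Set Torus}
    (hp : k.IsBoundaryComponent K p) (hc : k.IsBoundaryComponent K c) (hps : p ⊆ k.circle s)
    (hcs : c ⊆ k.circle s) (hne : p ≠ c) : Nonempty (Frame k K s p c) := by
  obtain ⟨a₀, a₁, hg, rfl⟩ := hp.exists_isGap hK hC hps
  obtain ⟨b₂, b₃, hg', rfl⟩ := hc.exists_isGap hK hC hcs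
  obtain ⟨n, hn⟩ := exists_int_shift a₀ b₂
  rw [← arc_add_int b₂ b₃ n] at hne ⊢
  have hg' := hg'.add_int n
  set a₂ := b₂ + (n : ℝ)
  set a₃ := b₃ + (n : ℝ)
  have hg1 := hg.add_int 1
  rw [Int.cast_one] at hg1
  have h1 : a₀ ≠ a₂ := by
    intro h
    obtain ⟨x, h1, h2⟩ := exists_between (lt_min hg.lt (h ▸ hg'.lt))
    obtain ⟨h3, h4⟩ := hg.eq_of_mem hg' ⟨h1, h2.trans_le (min_le_left _ _)⟩
      ⟨h ▸ h1, h2.trans_le (min_le_right _ _)⟩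
    exact hne (by rw [h3, h4])
  have h2 : a₁ ≤ a₂ := by
    by_contra! h
    exact hg.disj a₂ ⟨hn.1.lt_of_ne h1, h⟩ hg'.left_mem
  have h3 : a₃ ≤ a₀ + 1 := by
    by_contra! h
    exact hg'.disj (a₀ + 1) ⟨hn.2, h⟩ hg1.left_mem
  refine ⟨⟨a₀, a₁, a₂, a₃, hg, hg', rfl, rfl, h2.lt_of_ne ?_, h3.lt_of_ne ?_⟩⟩
  · rintro h
    exact not_adjacent_gaps hK hC hg (h ▸ hg')
  · rintro h
    exact not_adjacent_gaps hK hC hg' (h ▸ hg1)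

/-- A coordinate on the Cantor set between two gaps, with the absolute value in `[n, n + 1]`. -/
structure FrameCoord {p c : Set Torus} (fr : Frame k K s p c) (n : ℕ) where
  ρ : (ℕ → Bool) → ℝ
  h : (ℕ → Bool) → ℝ
  continuous_ρ : Continuous ρ
  injective_ρ : Function.Injective ρ
  range_ρ : range ρ = k.angles K s ∩ Icc fr.a₁ (fr.a₀ + 1)
  continuous_h : Continuous h
  le_abs : ∀ z, n ≤ |h z|
  abs_le : ∀ z, |h z| ≤ n + 1
  surj : ∀ r : ℝ, n ≤ |r| → |r| ≤ n + 1 → ∃ z, h z = r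
  eq_iff₂ : ∀ z, h z = n + 1 ↔ ρ z = fr.a₂
  eq_iff₃ : ∀ z, h z = -(n + 1) ↔ ρ z = fr.a₃
  eq_iff₁ : ∀ z, 0 < n → (h z = n ↔ ρ z = fr.a₁)
  eq_iff₀ : ∀ z, 0 < n → (h z = -n ↔ ρ z = fr.a₀ + 1)
  eq_iff : ∀ z z', ρ z < ρ z' → (h z = h z' ↔ (k.IsGap K s (ρ z) (ρ z') ∧ ρ z ≠ fr.a₂) ∨
    (n = 0 ∧ ρ z = fr.a₁ ∧ ρ z' = fr.a₀ + 1))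

/-- The Cantor function is normalized separately on the two pieces: `h` grows from `n` to `n + 1` on
`[a₁, a₂]` and from `-(n + 1)` to `-n` on `[a₃, a₀ + 1]`. It identifies precisely the ends of the
gaps inside the pieces, and takes its extreme values only once because gaps are never adjacent. For
`n = 0` the value `0` is common to both pieces, so the ends of the gap `p` are identified too. -/
theorem nonempty_frameCoord (hK : K ⊆ k.rim) (hC : ∀ s, IsCantorSet (K ∩ k.circle s))
    {p c : Set Torus} (fr : Frame k K s p c) (n : ℕ) : Nonempty (FrameCoord fr n) := by
  obtain ⟨ρ, hρ, hinj, hrange⟩ := exists_cantor_param hK hC fr.gap_p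
  obtain ⟨G, hG, hm, hGρ⟩ := exists_staircase hρ hinj
  have gp := fr.gap_p
  have gp1 := fr.gap_p.add_int 1
  rw [Int.cast_one] at gp1
  have gc := fr.gap_c
  have l1 := gp.lt
  have l2 := fr.lt₁₂
  have l3 := gc.lt
  have l4 := fr.lt₃₀
  have hQ := isClosed_angles hK hC s
  have hGQ : ∀ x y, fr.a₁ ≤ x → y ≤ fr.a₀ + 1 → x < y →
      (G x = G y ↔ Disjoint (Ioo x y) (k.angles K s)) := by
    intro x y hx hy hxy
    rw [hGρ x y hxy, hrange, disjoint_left, disjoint_left]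
    exact forall₂_congr fun z hz => not_congr
      (and_iff_left ⟨hx.trans hz.1.le, hz.2.le.trans hy⟩)
  -- both pieces contain points of the Cantor set in their interiors
  have hne : ∀ {a b c : ℝ}, k.IsGap K s a b → b < c → (Ioo b c ∩ k.angles K s).Nonempty := by
    intro a b c hg hbc
    obtain ⟨y, hy, hyb, hy'⟩ := exists_ne_mem_angles hK hC hg.right_mem
      (δ := min (b - a) (c - b)) (lt_min (by linarith [hg.lt]) (by linarith))
    have m1 := min_le_left (b - a) (c - b)
    have m2 := min_le_right (b - a) (c - b)
    refine ⟨y, ⟨?_, by linarith [hy'.2]⟩, hy⟩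
    by_contra! h
    exact hg.disj y ⟨by linarith [hy'.1], h.lt_of_ne hyb⟩ hy
  obtain ⟨g, hg, gm, gc0, gd1, gQ, gs⟩ := exists_piece_coordinate hQ gp.right_mem
    (hne gp l2) hG hm fun x y h1 h2 h3 => hGQ x y h1 (h3.trans (l3.le.trans l4.le)) h2
  obtain ⟨g', hg', gm', gc0', gd1', gQ', gs'⟩ := exists_piece_coordinate hQ gc.right_mem
    (hne gc l4) hG hm fun x y h1 h2 h3 => hGQ x y (l2.le.trans (l3.le.trans h1)) h3 h2
  -- A point inside the gap `c` separates the two pieces; as `ρ` never takes this value, the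
  -- definition of `h` by cases is continuous.
  obtain ⟨m, hm1, hm2⟩ := exists_between l3
  have hcase : ∀ z, (ρ z ≤ m ∧ ρ z ∈ Icc fr.a₁ fr.a₂) ∨ (¬ ρ z ≤ m ∧ ρ z ∈ Icc fr.a₃ (fr.a₀ + 1)) := by
    intro z
    have hz : ρ z ∈ k.angles K s ∩ Icc fr.a₁ (fr.a₀ + 1) := hrange ▸ mem_range_self z
    by_cases h : ρ z ≤ m
    · refine Or.inl ⟨h, hz.2.1, ?_⟩
      by_contra! h'
      exact gc.disj _ ⟨h', h.trans_lt hm2⟩ hz.1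
    · refine Or.inr ⟨h, ?_, hz.2.2⟩
      by_contra! h'
      exact gc.disj _ ⟨hm1.trans (not_le.1 h), h'⟩ hz.1
  let h : (ℕ → Bool) → ℝ := fun z => if ρ z ≤ m then n + g (ρ z) else -(n + 1) + g' (ρ z)
  have hl : ∀ z, ρ z ≤ m → h z = n + g (ρ z) := fun z hz => if_pos hz
  have hr : ∀ z, ¬ ρ z ≤ m → h z = -(n + 1) + g' (ρ z) := fun z hz => if_neg hz
  have bl : ∀ z, ρ z ∈ Icc fr.a₁ fr.a₂ → 0 ≤ g (ρ z) ∧ g (ρ z) ≤ 1 := fun z hz =>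
    ⟨gc0 ▸ gm hz.1, gd1 ▸ gm hz.2⟩
  have br : ∀ z, ρ z ∈ Icc fr.a₃ (fr.a₀ + 1) → 0 ≤ g' (ρ z) ∧ g' (ρ z) ≤ 1 := fun z hz =>
    ⟨gc0' ▸ gm' hz.1, gd1' ▸ gm' hz.2⟩
  have hn0 : (0 : ℝ) ≤ n := n.cast_nonneg
  have hgap : ∀ {x y : ℝ}, x ∈ k.angles K s → y ∈ k.angles K s → x < y → fr.a₁ ≤ x →
      y ≤ fr.a₀ + 1 → Disjoint (Ioo x y) (k.angles K s) → k.IsGap K s x y := by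
    intro x y hx hy hxy h1 h2 hd
    exact ⟨hxy, by linarith, hx, hy, fun z hz => disjoint_left.1 hd hz⟩
  have mem : ∀ z, ρ z ∈ k.angles K s := fun z =>
    (show ρ z ∈ k.angles K s ∩ Icc fr.a₁ (fr.a₀ + 1) from hrange ▸ mem_range_self z).1
  -- the extreme values are only taken at the ends
  have e1 : ∀ z, ρ z ∈ Icc fr.a₁ fr.a₂ → (g (ρ z) = 0 ↔ ρ z = fr.a₁) := by
    intro z hz
    refine ⟨fun h0 => ?_, fun h0 => by rw [h0, gc0]⟩
    by_contra hne
    have hlt := hz.1.lt_of_ne (Ne.symm hne)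
    refine not_adjacent_gaps hK hC gp (hgap gp.right_mem (mem z) hlt le_rfl (by linarith [hz.2]) ?_)
    exact (gQ _ _ le_rfl hlt hz.2).1 (gc0.trans h0.symm)
  have e2 : ∀ z, ρ z ∈ Icc fr.a₁ fr.a₂ → (g (ρ z) = 1 ↔ ρ z = fr.a₂) := by
    intro z hz
    refine ⟨fun h0 => ?_, fun h0 => by rw [h0, gd1]⟩
    by_contra hne
    have hlt := hz.2.lt_of_ne hne
    refine not_adjacent_gaps hK hC (hgap (mem z) gc.left_mem hlt hz.1 (by linarith) ?_) gc
    exact (gQ _ _ hz.1 hlt le_rfl).1 (h0.trans gd1.symm)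
  have e3 : ∀ z, ρ z ∈ Icc fr.a₃ (fr.a₀ + 1) → (g' (ρ z) = 0 ↔ ρ z = fr.a₃) := by
    intro z hz
    refine ⟨fun h0 => ?_, fun h0 => by rw [h0, gc0']⟩
    by_contra hne
    have hlt := hz.1.lt_of_ne (Ne.symm hne)
    refine not_adjacent_gaps hK hC gc (hgap gc.right_mem (mem z) hlt (by linarith) hz.2 ?_)
    exact (gQ' _ _ le_rfl hlt hz.2).1 (gc0'.trans h0.symm)
  have e0 : ∀ z, ρ z ∈ Icc fr.a₃ (fr.a₀ + 1) → (g' (ρ z) = 1 ↔ ρ z = fr.a₀ + 1) := by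
    intro z hz
    refine ⟨fun h0 => ?_, fun h0 => by rw [h0, gd1']⟩
    by_contra hne
    have hlt := hz.2.lt_of_ne hne
    refine not_adjacent_gaps hK hC (hgap (mem z) gp1.left_mem hlt (by linarith [hz.1]) le_rfl ?_) gp1
    exact (gQ' _ _ hz.1 hlt le_rfl).1 (h0.trans gd1'.symm)
  refine ⟨⟨ρ, h, hρ, hinj, hrange, ?_, fun z => ?_, fun z => ?_, fun r h1 h2 => ?_, fun z => ?_,
    fun z => ?_, fun z hn => ?_, fun z hn => ?_, fun z z' hzz => ?_⟩⟩
  · refine Continuous.if_le (by fun_prop) (by fun_prop) hρ continuous_const fun z hz => ?_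
    rcases hcase z with ⟨-, h'⟩ | ⟨h', -⟩
    · linarith [h'.2]
    · exact (h' hz.le).elim
  · rw [le_abs]
    rcases hcase z with ⟨h1, h2⟩ | ⟨h1, h2⟩
    · left; rw [hl z h1]; linarith [bl z h2]
    · right; rw [hr z h1]; linarith [br z h2]
  · rw [abs_le]
    rcases hcase z with ⟨h1, h2⟩ | ⟨h1, h2⟩
    · rw [hl z h1]; constructor <;> linarith [bl z h2]
    · rw [hr z h1]; constructor <;> linarith [br z h2]
  · rcases le_total 0 r with hr0 | hr0
    · rw [abs_of_nonneg hr0] at h1 h2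
      obtain ⟨x, hx, hxr⟩ := gs (r - n) ⟨by linarith, by linarith⟩
      obtain ⟨z, rfl⟩ : x ∈ range ρ := by
        rw [hrange]; exact ⟨hx.1, hx.2.1, by linarith [hx.2.2]⟩
      exact ⟨z, by rw [hl z (by linarith [hx.2.2]), hxr]; ring⟩
    · rw [abs_of_nonpos hr0] at h1 h2
      obtain ⟨x, hx, hxr⟩ := gs' (r + (n + 1)) ⟨by linarith, by linarith⟩
      obtain ⟨z, rfl⟩ : x ∈ range ρ := by
        rw [hrange]; exact ⟨hx.1, by linarith [hx.2.1], hx.2.2⟩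
      exact ⟨z, by rw [hr z (by linarith [hx.2.1]), hxr]; ring⟩
  · rcases hcase z with ⟨h1, h2⟩ | ⟨h1, h2⟩
    · rw [hl z h1, add_right_inj, e2 z h2]
    · rw [hr z h1]
      exact iff_of_false (by linarith [br z h2]) (by linarith [h2.1])
  · rcases hcase z with ⟨h1, h2⟩ | ⟨h1, h2⟩
    · rw [hl z h1]
      exact iff_of_false (by linarith [bl z h2]) (by linarith [h2.2])
    · rw [hr z h1, ← e3 z h2]
      exact ⟨fun h => by linarith, fun h => by linarith⟩
  · have hn' : (0 : ℝ) < n := Nat.cast_pos.2 hn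
    rcases hcase z with ⟨h1, h2⟩ | ⟨h1, h2⟩
    · rw [hl z h1, ← e1 z h2]
      exact ⟨fun h => by linarith, fun h => by linarith⟩
    · rw [hr z h1]
      exact iff_of_false (by linarith [br z h2]) (by linarith [h2.1])
  · have hn' : (0 : ℝ) < n := Nat.cast_pos.2 hn
    rcases hcase z with ⟨h1, h2⟩ | ⟨h1, h2⟩
    · rw [hl z h1]
      exact iff_of_false (by linarith [bl z h2]) (by linarith [h2.2])
    · rw [hr z h1, ← e0 z h2]
      exact ⟨fun h => by linarith, fun h => by linarith⟩
  · rcases hcase z with ⟨h1, h2⟩ | ⟨h1, h2⟩ <;> rcases hcase z' with ⟨h3, h4⟩ | ⟨h3, h4⟩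
    · rw [hl z h1, hl z' h3, add_right_inj, gQ _ _ h2.1 hzz h4.2]
      constructor
      · exact fun hd => Or.inl ⟨hgap (mem z) (mem z') hzz h2.1 (by linarith [h4.2]) hd,
          (hzz.trans_le h4.2).ne⟩
      · rintro (⟨hg, -⟩ | ⟨-, -, h'⟩)
        · exact disjoint_left.2 hg.disj
        · linarith [h4.2]
    · rw [hl z h1, hr z' h3]
      constructor
      · intro heq
        have b1 := bl z h2
        have b2 := br z' h4
        have hn : (n : ℝ) = 0 := by linarith
        refine Or.inr ⟨by exact_mod_cast hn, (e1 z h2).1 (by linarith), (e0 z' h4).1 (by linarith)⟩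
      · rintro (⟨hg, h'⟩ | ⟨hn, h5, h6⟩)
        · exact (hg.disj fr.a₂ ⟨h2.2.lt_of_ne h', by linarith [h4.1]⟩ gc.left_mem).elim
        · rw [(e1 z h2).2 h5, (e0 z' h4).2 h6, hn]
          simp
    · linarith
    · rw [hr z h1, hr z' h3, add_right_inj, gQ' _ _ h2.1 hzz h4.2]
      constructor
      · exact fun hd => Or.inl ⟨hgap (mem z) (mem z') hzz (by linarith [h2.1]) h4.2 hd,
          by linarith [h2.1]⟩
      · rintro (⟨hg, -⟩ | ⟨-, h', -⟩)
        · exact disjoint_left.2 hg.disj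
        · linarith [h2.1]

namespace FrameCoord

variable {p c : Set Torus} {fr : Frame k K s p c} {n : ℕ} (co : FrameCoord fr n)

theorem mem (z : ℕ → Bool) : co.ρ z ∈ k.angles K s ∩ Icc fr.a₁ (fr.a₀ + 1) :=
  co.range_ρ ▸ mem_range_self z

theorem exists_ρ {x : ℝ} (hx : x ∈ k.angles K s) (h1 : fr.a₁ ≤ x) (h2 : x ≤ fr.a₀ + 1) :
    ∃ z, co.ρ z = x := by
  have : x ∈ k.angles K s ∩ Icc fr.a₁ (fr.a₀ + 1) := ⟨hx, h1, h2⟩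
  rwa [← co.range_ρ] at this

theorem exists_collar {x : ℝ} (hx : x ∈ k.angles K s) :
    ∃ z, k.collar s (co.ρ z) 0 = k.collar s x 0 := by
  obtain ⟨m, hm⟩ := exists_int_shift fr.a₁ x
  have hx' : x + m ∈ k.angles K s := (angles_add_int m).2 hx
  have h2 : x + m ≤ fr.a₀ + 1 := by
    by_contra! h
    have := (fr.gap_p.add_int 1).disj (x + m)
    rw [Int.cast_one] at this
    exact this ⟨h, hm.2⟩ hx'
  obtain ⟨z, hz⟩ := co.exists_ρ hx' hm.1 h2
  exact ⟨z, by rw [hz, collar_add_int]⟩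

theorem eq_of_collar_eq {z : ℕ → Bool} {x : ℝ} (h1 : fr.a₁ ≤ x) (h2 : x ≤ fr.a₀ + 1)
    (h : k.collar s (co.ρ z) 0 = k.collar s x 0) : co.ρ z = x := by
  obtain ⟨-, m, hm⟩ := k.collar_inj s (by simp) (by simp) h
  have hz := (co.mem z).2
  have hlt := fr.gap_p.lt
  have h3 : (m : ℝ) < 1 := by linarith [hz.1]
  have h4 : (-1 : ℝ) < m := by linarith [hz.2]
  have h3' : m < 1 := by exact_mod_cast h3
  have h4' : -1 < m := by exact_mod_cast h4
  obtain rfl : m = 0 := by omega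
  simpa using hm.symm

theorem bounds : fr.a₀ < fr.a₁ ∧ fr.a₁ < fr.a₂ ∧ fr.a₂ < fr.a₃ ∧ fr.a₃ < fr.a₀ + 1 :=
  ⟨fr.gap_p.lt, fr.lt₁₂, fr.gap_c.lt, fr.lt₃₀⟩

/-- The ends of the other gaps have the same coordinate. -/
theorem exists_of_gap {a b : ℝ} (hg : k.IsGap K s a b) (hc : k.arc s (Ioo a b) ≠ c)
    (hp : k.arc s (Ioo a b) = p → n = 0) : ∃ z z', k.collar s (co.ρ z) 0 = k.collar s a 0 ∧
      k.collar s (co.ρ z') 0 = k.collar s b 0 ∧ co.h z = co.h z' := by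
  obtain ⟨m, hm⟩ := exists_int_shift fr.a₁ a
  have hg' := hg.add_int m
  rw [← arc_add_int a b m] at hc hp
  rw [← k.collar_add_int s a 0 m, ← k.collar_add_int s b 0 m]
  generalize a + (m : ℝ) = a at *
  generalize b + (m : ℝ) = b at *
  have gp1 := fr.gap_p.add_int 1
  rw [Int.cast_one] at gp1
  obtain ⟨l1, l2, l3, l4⟩ := bounds (fr := fr)
  have ha : a ≤ fr.a₀ + 1 := by
    by_contra! h
    exact gp1.disj a ⟨h, hm.2⟩ hg'.left_mem
  have hlt := hg'.lt
  obtain ⟨z, hz⟩ := co.exists_ρ hg'.left_mem hm.1 ha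
  -- If `a = a₀ + 1` the gap is a translate of `p`, which is allowed for `n = 0` only. Otherwise it
  -- lies inside one of the two pieces.
  rcases ha.eq_or_lt with heq | ha
  · obtain ⟨x, h1, h2⟩ := exists_between (lt_min hlt (show a < fr.a₁ + 1 by linarith))
    obtain ⟨-, hb⟩ := hg'.eq_of_mem gp1 ⟨h1, h2.trans_le (min_le_left _ _)⟩
      ⟨heq ▸ h1, h2.trans_le (min_le_right _ _)⟩
    obtain ⟨z', hz'⟩ := co.exists_ρ fr.gap_p.right_mem le_rfl (by linarith)
    refine ⟨z, z', by rw [hz], ?_, ?_⟩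
    · rw [hz', hb]
      simpa using (k.collar_add_int s fr.a₁ 0 1).symm
    · refine ((co.eq_iff z' z (by linarith)).2 (Or.inr ⟨hp ?_, hz', hz.trans heq⟩)).symm
      rw [heq, hb]
      refine Eq.trans ?_ fr.arc_p.symm
      simpa using arc_add_int (k := k) (s := s) fr.a₀ fr.a₁ 1
  · have hb : b ≤ fr.a₀ + 1 := by
      by_contra! h
      exact hg'.disj _ ⟨ha, h⟩ gp1.left_mem
    obtain ⟨z', hz'⟩ := co.exists_ρ hg'.right_mem (hm.1.trans hlt.le) hb
    refine ⟨z, z', by rw [hz], by rw [hz'], (co.eq_iff z z' (by rw [hz, hz']; exact hlt)).2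
      (Or.inl ⟨by rw [hz, hz']; exact hg', fun h => hc ?_⟩)⟩
    rw [hz] at h
    obtain ⟨x, h1, h2⟩ := exists_between (lt_min hlt (h ▸ l3 : a < fr.a₃))
    obtain ⟨-, hb⟩ := hg'.eq_of_mem fr.gap_c ⟨h1, h2.trans_le (min_le_left _ _)⟩
      ⟨h ▸ h1, h2.trans_le (min_le_right _ _)⟩
    rw [h, hb]
    exact fr.arc_c.symm

/-- Points with the same coordinate are ends of such gaps. -/
theorem exists_gap_of_eq {z z' : ℕ → Bool} (hlt : co.ρ z < co.ρ z') (h : co.h z = co.h z') :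
    ∃ a b, k.IsGap K s a b ∧ k.arc s (Ioo a b) ≠ c ∧ (k.arc s (Ioo a b) = p → n = 0) ∧
      ((k.collar s (co.ρ z) 0 = k.collar s a 0 ∧ k.collar s (co.ρ z') 0 = k.collar s b 0) ∨
      (k.collar s (co.ρ z) 0 = k.collar s b 0 ∧ k.collar s (co.ρ z') 0 = k.collar s a 0)) := by
  obtain ⟨l1, l2, l3, l4⟩ := bounds (fr := fr)
  have hz := (co.mem z).2
  have hz' := (co.mem z').2
  rcases (co.eq_iff z z' hlt).1 h with ⟨hg, hne⟩ | ⟨hn, h1, h2⟩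
  · refine ⟨_, _, hg, fun heq => hne ?_, fun heq => ?_, Or.inl ⟨rfl, rfl⟩⟩
    · replace heq := heq.trans fr.arc_c
      obtain ⟨m, h1, h2⟩ := hg.eq_of_arc_eq fr.gap_c heq
      have h3 : (m : ℝ) < 1 := by linarith [hz'.2]
      have h4 : (-1 : ℝ) < m := by linarith [hz.1]
      have h3' : m < 1 := by exact_mod_cast h3
      have h4' : -1 < m := by exact_mod_cast h4
      obtain rfl : m = 0 := by omega
      simpa using h1
    · replace heq := heq.trans fr.arc_p
      obtain ⟨m, h1, h2⟩ := hg.eq_of_arc_eq fr.gap_p heq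
      have h3 : (m : ℝ) < 1 := by linarith [hz'.2]
      have h4 : (0 : ℝ) < m := by linarith [hz.1]
      have h3' : m < 1 := by exact_mod_cast h3
      have h4' : 0 < m := by exact_mod_cast h4
      omega
  · refine ⟨fr.a₀, fr.a₁, fr.gap_p, fun heq => ?_, fun _ => hn, Or.inr ⟨by rw [h1], ?_⟩⟩
    · replace heq := heq.trans fr.arc_c
      obtain ⟨m, h3, h4⟩ := fr.gap_p.eq_of_arc_eq fr.gap_c heq
      have h3 : (m : ℝ) < 0 := by linarith
      have h4 : (-1 : ℝ) < m := by linarith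
      have h3' : m < 0 := by exact_mod_cast h3
      have h4' : -1 < m := by exact_mod_cast h4
      omega
    · rw [h2]
      simpa using k.collar_add_int s fr.a₀ 0 1

end FrameCoord

end TileKind

/-! ### Coordinates on the ends that are not separated from the end of a ray -/

namespace Realization

variable {F : Set (ℕ → Bool)} {ν : Vertex F → Bool} {D : Realization F ν}

/-- The identification of the ends of two glued arcs. -/
theorem angleEnd_glued (e : Edge F) {s t : Side} {a b c d : ℝ}
    (hg : (tileKind F ν e.child).IsGap (D.K e.child) s a b)
    (hg' : (tileKind F ν e.parent).IsGap (D.K e.parent) t c d)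
    (h : D.atChild e = (tileKind F ν e.child).arc s (Ioo a b))
    (h' : D.atParent e = (tileKind F ν e.parent).arc t (Ioo c d)) :
    (D.angleEnd _ _ ⟨b, hg.right_mem⟩ = D.angleEnd _ _ ⟨c, hg'.left_mem⟩ ∧
      D.angleEnd _ _ ⟨a, hg.left_mem⟩ = D.angleEnd _ _ ⟨d, hg'.right_mem⟩) ∨
    (D.angleEnd _ _ ⟨b, hg.right_mem⟩ = D.angleEnd _ _ ⟨d, hg'.right_mem⟩ ∧
      D.angleEnd _ _ ⟨a, hg.left_mem⟩ = D.angleEnd _ _ ⟨c, hg'.left_mem⟩) := by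
  obtain ⟨l₀, h1, h2⟩ := TileKind.exists_arc_param (k := tileKind F ν e.child) (s := s) hg.lt
    hg.lt_add_one
  let l : ℝ ≃ₜ D.atChild e := l₀.trans (Homeomorph.setCongr h.symm)
  have hl : ∀ t, (l t : Torus) = l₀ t := fun t => rfl
  let m : ℝ ≃ₜ (tileKind F ν e.parent).arc t (Ioo c d) :=
    (l.trans (D.glue e)).trans (Homeomorph.setCongr h')
  have hm : ∀ t, (m t : Torus) = D.glue e (l t) := fun t => rfl
  have key : ∀ (κ : D.K e.child) (κ' : D.K e.parent),
      (Tendsto (fun t => (l₀ t : Torus)) atTop (𝓝 κ) ∧ Tendsto (fun t => (m t : Torus)) atTop (𝓝 κ')) ∨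
      (Tendsto (fun t => (l₀ t : Torus)) atBot (𝓝 κ) ∧ Tendsto (fun t => (m t : Torus)) atBot (𝓝 κ')) →
      D.ptEnd _ κ = D.ptEnd _ κ' := by
    rintro κ κ' (⟨t1, t2⟩ | ⟨t1, t2⟩)
    · exact GluedEnds.ptEnd_eq D ⟨l, t1, t2⟩
    · exact GluedEnds.ptEnd_eq D ⟨(Homeomorph.neg ℝ).trans l, t1.comp tendsto_neg_atTop_atBot,
        t2.comp tendsto_neg_atTop_atBot⟩
  rcases TileKind.arc_ends hg'.lt_add_one m with ⟨h3, h4⟩ | ⟨h3, h4⟩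
  · exact Or.inr ⟨key _ _ (Or.inl ⟨h2, h4⟩), key _ _ (Or.inr ⟨h1, h3⟩)⟩
  · exact Or.inl ⟨key _ _ (Or.inl ⟨h2, h4⟩), key _ _ (Or.inr ⟨h1, h3⟩)⟩

/-- The data defining coordinates along a thread: on each circle the arc `p n` towards the
preceding vertex and the arc towards the next vertex, coordinates, and signs making the
coordinates compatible with the gluing maps. -/
structure Chart (D : Realization F ν) (f : F) (N : ℕ) (s : ℕ → Side) where
  p : ℕ → Set Torus
  p_succ : ∀ n, p (n + 1) = D.atChild (rayEdge f (N + n))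
  fr : ∀ n, TileKind.Frame (tileKind F ν (rayVertexF f (N + n))) (D.K (rayVertexF f (N + n)))
    (s (N + n)) (p n) (D.atParent (rayEdge f (N + n)))
  co : ∀ n, TileKind.FrameCoord (fr n) n
  σ : ℕ → ℝ
  σ_eq : ∀ n, σ n = 1 ∨ σ n = -1
  align : ∀ n, (σ (n + 1) = σ n ∧
      D.angleEnd _ _ ⟨_, (fr (n + 1)).gap_p.right_mem⟩ = D.angleEnd _ _ ⟨_, (fr n).gap_c.left_mem⟩ ∧
      D.angleEnd _ _ ⟨_, (fr (n + 1)).gap_p.left_mem⟩ = D.angleEnd _ _ ⟨_, (fr n).gap_c.right_mem⟩) ∨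
    (σ (n + 1) = -σ n ∧
      D.angleEnd _ _ ⟨_, (fr (n + 1)).gap_p.right_mem⟩ = D.angleEnd _ _ ⟨_, (fr n).gap_c.right_mem⟩ ∧
      D.angleEnd _ _ ⟨_, (fr (n + 1)).gap_p.left_mem⟩ = D.angleEnd _ _ ⟨_, (fr n).gap_c.left_mem⟩)

/-- The first circle has no arc towards a preceding vertex, so an unglued gap serves as `p 0`. The
sign changes whenever the gluing joins right ends to right ends, since the values `m + 1` and `-(m +
1)` of consecutive circles would otherwise be exchanged. -/
theorem MinThread.nonempty_chart {f : F} {N : ℕ} {s : ℕ → Side} (h : D.MinThread f N s) :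
    Nonempty (D.Chart f N s) := by
  classical
  obtain ⟨x, hx⟩ := D.angles_nonempty (rayVertexF f N) (s N)
  obtain ⟨a, b, hg, hfree, -⟩ := D.exists_free_gap _ hx one_pos
  let p : ℕ → Set Torus := fun n => n.casesOn ((tileKind F ν (rayVertexF f N)).arc (s N) (Ioo a b))
    fun m => D.atChild (rayEdge f (N + m))
  have hfr : ∀ n, Nonempty (TileKind.Frame (tileKind F ν (rayVertexF f (N + n)))
      (D.K (rayVertexF f (N + n))) (s (N + n)) (p n) (D.atParent (rayEdge f (N + n)))) := by
    intro n
    have hc := (h.thread (N + n) (by omega)).1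
    cases n with
    | zero =>
      refine TileKind.nonempty_frame (D.K_subset _) (D.K_cantor _) hg.isBoundaryComponent
        (D.isComp_atParent (rayEdge f (N + 0))) (TileKind.arc_subset_circle _) hc fun heq => hfree ?_
      exact ⟨rayEdge f N, Or.inr ⟨rfl, heq⟩⟩
    | succ m =>
      exact TileKind.nonempty_frame (D.K_subset _) (D.K_cantor _) (D.isComp_atChild (rayEdge f (N + m)))
        (D.isComp_atParent (rayEdge f (N + (m + 1)))) (h.thread (N + m) (by omega)).2 hc
        (D.child_ne_parent (rayEdge f (N + m)) (rayEdge f (N + (m + 1))) rfl)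
  let fr := fun n => (hfr n).some
  have hco : ∀ n, Nonempty (TileKind.FrameCoord (fr n) n) := fun n =>
    TileKind.nonempty_frameCoord (D.K_subset _) (D.K_cantor _) _ _
  let A : ℕ → Prop := fun n =>
    D.angleEnd _ _ ⟨_, (fr (n + 1)).gap_p.right_mem⟩ = D.angleEnd _ _ ⟨_, (fr n).gap_c.left_mem⟩ ∧
    D.angleEnd _ _ ⟨_, (fr (n + 1)).gap_p.left_mem⟩ = D.angleEnd _ _ ⟨_, (fr n).gap_c.right_mem⟩
  let σ : ℕ → ℝ := fun n => n.rec 1 fun m r => if A m then r else -r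
  have hσ : ∀ n, σ (n + 1) = if A n then σ n else -σ n := fun n => rfl
  refine ⟨⟨p, fun n => rfl, fr, fun n => (hco n).some, σ, fun n => ?_, fun n => ?_⟩⟩
  · induction n with
    | zero => exact Or.inl rfl
    | succ n ih =>
      rw [hσ]
      split_ifs
      · exact ih
      · rcases ih with h | h <;> simp [h]
  · rw [hσ]
    by_cases hA : A n
    · exact Or.inl ⟨if_pos hA, hA⟩
    · refine Or.inr ⟨if_neg hA, ?_⟩
      exact (angleEnd_glued (rayEdge f (N + n)) (fr (n + 1)).gap_p (fr n).gap_c (fr (n + 1)).arc_p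
        (fr n).arc_c).resolve_left hA

/-! ### Compatibility of the coordinates of consecutive circles -/

namespace Chart

variable {f : F} {N : ℕ} {s : ℕ → Side} (ch : D.Chart f N s)

/-- The ends on the `n`-th circle of the thread. -/
noncomputable def gEnd (n : ℕ) (z : ℕ → Bool) : Ends D.W :=
  D.angleEnd (rayVertexF f (N + n)) (s (N + n)) ⟨(ch.co n).ρ z, ((ch.co n).mem z).1⟩

/-- The coordinate of the ends on the `n`-th circle of the thread. -/
noncomputable def u (n : ℕ) (z : ℕ → Bool) : ℝ := ch.σ n * (ch.co n).h z

theorem continuous_gEnd (n : ℕ) : Continuous (ch.gEnd n) :=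
  (D.continuous_angleEnd _ _).comp ((ch.co n).continuous_ρ.subtype_mk _)

theorem continuous_u (n : ℕ) : Continuous (ch.u n) := continuous_const.mul (ch.co n).continuous_h

theorem abs_u (n : ℕ) (z : ℕ → Bool) : |ch.u n z| = |(ch.co n).h z| := by
  rcases ch.σ_eq n with h | h <;> simp [u, h]

theorem u_eq_iff {n : ℕ} {z z' : ℕ → Bool} :
    ch.u n z = ch.u n z' ↔ (ch.co n).h z = (ch.co n).h z' := by
  rcases ch.σ_eq n with h | h <;> simp [u, h]

theorem exists_u_eq (r : ℝ) : ∃ n z, ch.u n z = r := by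
  -- The circle of level `n` covers the values with absolute value in `[n, n + 1]`.
  obtain ⟨z, hz⟩ := (ch.co ⌊|r|⌋₊).surj (ch.σ ⌊|r|⌋₊ * r) (by
    rcases ch.σ_eq ⌊|r|⌋₊ with h | h <;> simp [h, Nat.floor_le (abs_nonneg r)]) (by
    rcases ch.σ_eq ⌊|r|⌋₊ with h | h <;> simp [h, (Nat.lt_floor_add_one |r|).le])
  refine ⟨⌊|r|⌋₊, z, ?_⟩
  rw [u, hz]
  rcases ch.σ_eq ⌊|r|⌋₊ with h | h <;> simp [h]

theorem gEnd_eq_of_collar {n : ℕ} {z : ℕ → Bool} {x : ℝ}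
    (hx : x ∈ (tileKind F ν (rayVertexF f (N + n))).angles (D.K (rayVertexF f (N + n))) (s (N + n)))
    (h : (tileKind F ν (rayVertexF f (N + n))).collar (s (N + n)) ((ch.co n).ρ z) 0 =
      (tileKind F ν (rayVertexF f (N + n))).collar (s (N + n)) x 0) :
    ch.gEnd n z = D.angleEnd _ _ ⟨x, hx⟩ := D.angleEnd_congr _ _ h

theorem gEnd_injective (n : ℕ) : Function.Injective (ch.gEnd n) := by
  intro z z' h
  have h1 := congrArg Subtype.val (D.ptEnd_injective _ h)
  have h2 := ((ch.co n).mem z').2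
  exact (ch.co n).injective_ρ ((ch.co n).eq_of_collar_eq h2.1 h2.2 h1)

theorem length_rayVertexF (f : F) (n : ℕ) : (rayVertexF f n).1.length = n := length_rayVertex f.1 n

theorem level_of_gEnd_eq {n m : ℕ} {z z' : ℕ → Bool} (h : ch.gEnd n z = ch.gEnd m z') :
    n = m ∨ n = m + 1 ∨ m = n + 1 := by
  have hlen := length_rayVertexF f
  rcases D.eq_or_matched_of_ptEnd_eq h with h | ⟨e, ⟨h1, h2, -⟩ | ⟨h1, h2, -⟩⟩
  · have := congrArg (fun v : Vertex F => v.1.length) (Sigma.mk.inj h).1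
    simp only [hlen] at this
    omega
  · have h3 := hlen (N + n)
    have h4 := hlen (N + m)
    rw [h1] at h3
    rw [h2] at h4
    have : e.child.1.length = e.parent.1.length + 1 := rfl
    omega
  · have h3 := hlen (N + n)
    have h4 := hlen (N + m)
    rw [h1] at h3
    rw [h2] at h4
    have : e.child.1.length = e.parent.1.length + 1 := rfl
    omega

/-- Removed points of different tiles that define the same end are limits of the arc between these
tiles, here the gap `p` of level `m + 1` and the gap `c` of level `m`. -/
theorem ends_of_gEnd_eq {m : ℕ} {z z' : ℕ → Bool} (h : ch.gEnd (m + 1) z = ch.gEnd m z') :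
    ((ch.co (m + 1)).ρ z = (ch.fr (m + 1)).a₁ ∨ (ch.co (m + 1)).ρ z = (ch.fr (m + 1)).a₀ + 1) ∧
    ((ch.co m).ρ z' = (ch.fr m).a₂ ∨ (ch.co m).ρ z' = (ch.fr m).a₃) := by
  have hlen := length_rayVertexF f
  rcases D.eq_or_matched_of_ptEnd_eq h with h | ⟨e, ⟨h1, h2, h3⟩ | ⟨h1, h2, -⟩⟩
  · have := congrArg (fun v : Vertex F => v.1.length) (Sigma.mk.inj h).1
    simp only [hlen] at this
    omega
  · obtain rfl : e = rayEdge f (N + m) := Edge.ext_of_child h1.symm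
    obtain ⟨l, hl, hl'⟩ := h3
    have c1 := mem_closure_of_tendsto hl (Eventually.of_forall fun t => (l t).2)
    have c2 := mem_closure_of_tendsto hl' (Eventually.of_forall fun t => (D.glue _ (l t)).2)
    replace c1 := (congrArg closure ((ch.p_succ m).symm.trans (ch.fr (m + 1)).arc_p)).subset c1
    replace c2 := (congrArg closure (ch.fr m).arc_c).subset c2
    obtain ⟨l1, l2, l3, l4⟩ := TileKind.FrameCoord.bounds (fr := ch.fr (m + 1))
    obtain ⟨k1, k2, k3, k4⟩ := TileKind.FrameCoord.bounds (fr := ch.fr m)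
    constructor
    · rcases (ch.fr (m + 1)).gap_p.mem_ends ((ch.co (m + 1)).mem z).1 c1 with h | h
      · right
        refine (ch.co (m + 1)).eq_of_collar_eq (by linarith) le_rfl (h.trans ?_)
        simpa using ((tileKind F ν (rayVertexF f (N + (m + 1)))).collar_add_int _
          (ch.fr (m + 1)).a₀ 0 1).symm
      · left
        exact (ch.co (m + 1)).eq_of_collar_eq le_rfl (by linarith) h
    · rcases (ch.fr m).gap_c.mem_ends ((ch.co m).mem z').1 c2 with h | h
      · left
        exact (ch.co m).eq_of_collar_eq k2.le (by linarith) h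
      · right
        exact (ch.co m).eq_of_collar_eq (by linarith) k4.le h
  · have h3 := hlen (N + (m + 1))
    have h4 := hlen (N + m)
    rw [h1] at h3
    rw [h2] at h4
    have : e.child.1.length = e.parent.1.length + 1 := rfl
    omega

/-- The ranges of the absolute values at levels `m` and `m + 1` only share `m + 1`, which is
attained at the ends of the common arc only. -/
theorem ends_of_u_eq {m : ℕ} {z z' : ℕ → Bool} (h : ch.u (m + 1) z = ch.u m z') :
    ((ch.co (m + 1)).ρ z = (ch.fr (m + 1)).a₁ ∨ (ch.co (m + 1)).ρ z = (ch.fr (m + 1)).a₀ + 1) ∧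
    ((ch.co m).ρ z' = (ch.fr m).a₂ ∨ (ch.co m).ρ z' = (ch.fr m).a₃) := by
  have h1 := (ch.co (m + 1)).le_abs z
  have h2 := (ch.co m).abs_le z'
  have h3 := congrArg abs h
  rw [abs_u, abs_u] at h3
  push_cast at h1
  have h4 : |(ch.co (m + 1)).h z| = (m : ℝ) + 1 := by linarith
  have h5 : |(ch.co m).h z'| = (m : ℝ) + 1 := by linarith
  rw [← (ch.co (m + 1)).eq_iff₁ z m.succ_pos, ← (ch.co (m + 1)).eq_iff₀ z m.succ_pos,
    ← (ch.co m).eq_iff₂, ← (ch.co m).eq_iff₃]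
  push_cast
  have h0 : (0 : ℝ) ≤ m + 1 := by positivity
  exact ⟨(abs_eq h0).1 h4, (abs_eq h0).1 h5⟩

/-- Either equality forces both points to be ends of the arc between the two circles. For the four
resulting pairs, `align` says which ends of the arc correspond and that the signs match this
correspondence. -/
theorem gEnd_eq_iff_u_eq {m : ℕ} {z z' : ℕ → Bool} :
    ch.gEnd (m + 1) z = ch.gEnd m z' ↔ ch.u (m + 1) z = ch.u m z' := by
  suffices H : ((ch.co (m + 1)).ρ z = (ch.fr (m + 1)).a₁ ∨
      (ch.co (m + 1)).ρ z = (ch.fr (m + 1)).a₀ + 1) ∧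
      ((ch.co m).ρ z' = (ch.fr m).a₂ ∨ (ch.co m).ρ z' = (ch.fr m).a₃) →
      (ch.gEnd (m + 1) z = ch.gEnd m z' ↔ ch.u (m + 1) z = ch.u m z') from
    ⟨fun h => (H (ch.ends_of_gEnd_eq h)).1 h, fun h => (H (ch.ends_of_u_eq h)).2 h⟩
  rintro ⟨h1, h2⟩
  have hpos : (0 : ℝ) < m + 1 := by positivity
  -- the two points of the circle of level `m`
  obtain ⟨k1, k2, k3, k4⟩ := TileKind.FrameCoord.bounds (fr := ch.fr m)
  obtain ⟨z₂, hz₂⟩ := (ch.co m).exists_ρ (ch.fr m).gap_c.left_mem k2.le (by linarith)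
  obtain ⟨z₃, hz₃⟩ := (ch.co m).exists_ρ (ch.fr m).gap_c.right_mem (by linarith) k4.le
  have hne : z₂ ≠ z₃ := fun h => k3.ne (by rw [← hz₂, ← hz₃, h])
  have g₂ : ch.gEnd m z₂ = D.angleEnd _ _ ⟨_, (ch.fr m).gap_c.left_mem⟩ :=
    ch.gEnd_eq_of_collar _ (by rw [hz₂])
  have g₃ : ch.gEnd m z₃ = D.angleEnd _ _ ⟨_, (ch.fr m).gap_c.right_mem⟩ :=
    ch.gEnd_eq_of_collar _ (by rw [hz₃])
  have v₂ : (ch.co m).h z₂ = m + 1 := ((ch.co m).eq_iff₂ z₂).2 hz₂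
  have v₃ : (ch.co m).h z₃ = -(m + 1) := ((ch.co m).eq_iff₃ z₃).2 hz₃
  have hz' : z' = z₂ ∨ z' = z₃ :=
    h2.imp (fun h => (ch.co m).injective_ρ (h.trans hz₂.symm))
      (fun h => (ch.co m).injective_ρ (h.trans hz₃.symm))
  have hz : (ch.gEnd (m + 1) z = D.angleEnd _ _ ⟨_, (ch.fr (m + 1)).gap_p.right_mem⟩ ∧
      (ch.co (m + 1)).h z = m + 1) ∨
      (ch.gEnd (m + 1) z = D.angleEnd _ _ ⟨_, (ch.fr (m + 1)).gap_p.left_mem⟩ ∧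
      (ch.co (m + 1)).h z = -(m + 1)) := by
    refine h1.imp (fun h => ⟨ch.gEnd_eq_of_collar _ (by rw [h]), ?_⟩)
      (fun h => ⟨ch.gEnd_eq_of_collar _ ?_, ?_⟩)
    · simpa using ((ch.co (m + 1)).eq_iff₁ z m.succ_pos).2 h
    · rw [h]
      simpa using (tileKind F ν (rayVertexF f (N + (m + 1)))).collar_add_int _
          (ch.fr (m + 1)).a₀ 0 1
    · simpa using ((ch.co (m + 1)).eq_iff₀ z m.succ_pos).2 h
  have hσ : ch.σ m ≠ 0 := by rcases ch.σ_eq m with h | h <;> simp [h]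
  have hm2 : -((m : ℝ) + 1) ≠ m + 1 := by linarith
  have hinj : ch.gEnd m z₂ ≠ ch.gEnd m z₃ := fun h => hne (ch.gEnd_injective m h)
  rcases ch.align m with ⟨a1, a2, a3⟩ | ⟨a1, a2, a3⟩ <;> rw [← g₂, ← g₃] at * <;>
    rcases hz with ⟨b1, b2⟩ | ⟨b1, b2⟩ <;> rcases hz' with rfl | rfl
  all_goals
    rw [b1, u, u, b2, a1]
    first | rw [a2] | rw [a3]
    first | rw [v₂] | rw [v₃]
    first
      | exact iff_of_true rfl (by ring)
      | (refine iff_of_false (by first | exact hinj | exact hinj.symm) fun h => ?_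
         exact hm2 (mul_left_cancel₀ hσ (by linarith)))

theorem u_eq_of_gEnd_eq {n m : ℕ} {z z' : ℕ → Bool} (h : ch.gEnd n z = ch.gEnd m z') :
    ch.u n z = ch.u m z' := by
  rcases ch.level_of_gEnd_eq h with rfl | rfl | rfl
  · rw [ch.gEnd_injective n h]
  · exact ch.gEnd_eq_iff_u_eq.1 h
  · exact (ch.gEnd_eq_iff_u_eq.1 h.symm).symm

end Chart

end Realization

/-! ### Auxiliary topology -/

/-- Finite levels are isolated in `ℕ∞`; at infinity the convergence is required to be uniform in
`z`, which is what the filter `⊤` on `Z` expresses. -/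
theorem continuous_recTopCoe {Z Y : Type*} [TopologicalSpace Z] [TopologicalSpace Y] {g : ℕ → Z → Y}
    {y : Y} (hg : ∀ n, Continuous (g n))
    (hlim : Tendsto (fun p : ℕ × Z => g p.1 p.2) (atTop ×ˢ ⊤) (𝓝 y)) :
    Continuous fun x : ℕ∞ × Z => ENat.recTopCoe (C := fun _ => Y) y (fun n => g n x.2) x.1 := by
  rw [continuous_iff_continuousAt]
  rintro ⟨n, z⟩
  induction n using ENat.recTopCoe with
  | top =>
    intro V hV
    obtain ⟨S, hS, T, hT, hST⟩ := mem_prod_iff.1 (hlim hV)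
    rw [mem_top] at hT
    obtain ⟨M, hM⟩ := mem_atTop_sets.1 hS
    have hnhds : {x : ℕ∞ × Z | (M : ℕ∞) < x.1} ∈ 𝓝 ((⊤ : ℕ∞), z) :=
      (isOpen_Ioi.preimage continuous_fst).mem_nhds (ENat.natCast_lt_top M)
    refine mem_map.2 (mem_of_superset hnhds fun x hx => ?_)
    obtain ⟨m, w⟩ := x
    induction m using ENat.recTopCoe with
    | top => exact (show y ∈ V from mem_of_mem_nhds hV)
    | coe m =>
      refine hST (show (m, w) ∈ S ×ˢ T from ⟨hM m ?_, hT ▸ mem_univ w⟩)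
      exact (Nat.cast_lt.1 (show (M : ℕ∞) < m from hx)).le
  | coe n =>
    have hnhds : {x : ℕ∞ × Z | x.1 = n} ∈ 𝓝 ((n : ℕ∞), z) :=
      ((ENat.isOpen_singleton (ENat.natCast_ne_top n)).preimage continuous_fst).mem_nhds rfl
    refine ContinuousAt.congr (f := fun x : ℕ∞ × Z => g n x.2)
      ((hg n).comp continuous_snd).continuousAt ?_
    filter_upwards [hnhds] with x hx
    rw [show x.1 = n from hx]
    rfl

/-- As `X` is compact and `S` is Hausdorff, `q` is a quotient map, so `Ψ` descends to `S` and then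
to `Quot r`. There it is a continuous bijection from a compact space to a Hausdorff space. -/
theorem nonempty_quot_homeomorph {X S C : Type*} [TopologicalSpace X] [CompactSpace X]
    [TopologicalSpace S] [T2Space S] [TopologicalSpace C] [T2Space C] {q : X → S} {Ψ : X → C}
    {r : S → S → Prop} (hq : Continuous q) (hqs : Function.Surjective q) (hΨ : Continuous Ψ)
    (hΨs : Function.Surjective Ψ) (h1 : ∀ x y, r (q x) (q y) → Ψ x = Ψ y)
    (h2 : ∀ x y, Ψ x = Ψ y → r (q x) (q y)) : Nonempty (Quot r ≃ₜ C) := by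
  have hS : CompactSpace S := hqs.compactSpace hq
  let m : S → C := fun s => Ψ (Function.surjInv hqs s)
  have hm : ∀ x, m (q x) = Ψ x := fun x => h1 _ _ (by
    rw [Function.surjInv_eq hqs]
    exact h2 x x rfl)
  have hmc : Continuous m := by
    rw [(hq.isClosedMap.isQuotientMap hq hqs).continuous_iff]
    exact hΨ.congr fun x => (hm x).symm
  have hresp : ∀ a b, r a b → m a = m b := by
    intro a b hab
    obtain ⟨x, rfl⟩ := hqs a
    obtain ⟨y, rfl⟩ := hqs b
    rw [hm, hm]
    exact h1 x y hab
  have hc : Continuous (Quot.lift m hresp) := continuous_quot_lift hresp hmc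
  have hbij : Function.Bijective (Quot.lift m hresp) := by
    constructor
    · rintro ⟨a⟩ ⟨b⟩ hab
      obtain ⟨x, rfl⟩ := hqs a
      obtain ⟨y, rfl⟩ := hqs b
      change m (q x) = m (q y) at hab
      rw [hm, hm] at hab
      exact Quot.sound (h2 x y hab)
    · intro c
      obtain ⟨x, rfl⟩ := hΨs c
      exact ⟨Quot.mk r (q x), hm x⟩
  exact ⟨hc.homeoOfEquivCompactToT2 (f := Equiv.ofBijective _ hbij)⟩

/-- The parametrization of the circle minus a point by the real line. -/
noncomputable def circlePoint (r : ℝ) : Circle := Circle.exp (2 * Real.arctan r)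

theorem continuous_circlePoint : Continuous circlePoint :=
  Circle.exp.continuous.comp (continuous_const.mul Real.continuous_arctan)

theorem arg_circlePoint (r : ℝ) : Complex.arg (circlePoint r) = 2 * Real.arctan r := by
  have h1 := Real.neg_pi_div_two_lt_arctan r
  have h2 := Real.arctan_lt_pi_div_two r
  exact Circle.arg_exp (by linarith) (by linarith)

theorem circlePoint_injective : Function.Injective circlePoint := by
  intro r r' h
  have := congrArg (fun z : Circle => Complex.arg z) h
  simp only [arg_circlePoint] at this
  exact Real.arctan_injective (by linarith)

theorem circlePoint_ne (r : ℝ) : circlePoint r ≠ Circle.exp Real.pi := by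
  intro h
  have := congrArg (fun z : Circle => Complex.arg z) h
  simp only [arg_circlePoint] at this
  rw [Circle.arg_exp (by linarith [Real.pi_pos]) le_rfl] at this
  linarith [Real.arctan_lt_pi_div_two r]

theorem exists_circlePoint (w : Circle) (hw : w ≠ Circle.exp Real.pi) : ∃ r, circlePoint r = w := by
  have h1 := Complex.neg_pi_lt_arg (w : ℂ)
  have h2 : Complex.arg (w : ℂ) < Real.pi := (Complex.arg_le_pi _).lt_of_ne fun h => hw (by
    rw [← h, Circle.exp_arg])
  refine ⟨Real.tan (Complex.arg w / 2), ?_⟩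
  rw [circlePoint, Real.arctan_tan (by linarith) (by linarith), mul_div_cancel₀ _ two_ne_zero,
    Circle.exp_arg]

theorem tendsto_circlePoint : Tendsto circlePoint (cocompact ℝ) (𝓝 (Circle.exp Real.pi)) := by
  rw [cocompact_eq_atBot_atTop, tendsto_sup]
  have hc : ∀ x : ℝ, Tendsto (fun y => Circle.exp (2 * y)) (𝓝 x) (𝓝 (Circle.exp (2 * x))) := fun x =>
    (Circle.exp.continuous.comp (continuous_const.mul continuous_id)).tendsto x
  constructor
  · have h := (hc (-(Real.pi / 2))).comp (Real.tendsto_arctan_atBot.mono_right nhdsWithin_le_nhds)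
    have heq : Circle.exp (2 * -(Real.pi / 2)) = Circle.exp Real.pi := by
      rw [← Circle.periodic_exp]
      congr 1
      ring
    rwa [heq] at h
  · have h := (hc (Real.pi / 2)).comp (Real.tendsto_arctan_atTop.mono_right nhdsWithin_le_nhds)
    rwa [mul_div_cancel₀ _ two_ne_zero] at h

/-! ### The circle of ends -/

namespace Realization

variable {F : Set (ℕ → Bool)} {ν : Vertex F → Bool} {D : Realization F ν}

theorem joinedByBoundary_symm {e e' : Ends D.W} (h : JoinedByBoundary D.boundary e e') :
    JoinedByBoundary D.boundary e' e := by
  obtain ⟨v, s, a, b, hg, hfree, h⟩ := D.joinedByBoundary_iff.1 h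
  exact D.joinedByBoundary_iff.2 ⟨v, s, a, b, hg, hfree, h.symm.imp And.symm And.symm⟩

/-- The ends of an unglued arc are not identified with other removed points. -/
theorem eq_of_ptEnd_eq_of_free {v w : Vertex F} {κ : D.K v} {κ' : D.K w} {A : Set Torus}
    (hA : (tileKind F ν w).IsBoundaryComponent (D.K w) A) (hfree : A ∉ D.gluedArcs w)
    (hκ' : (κ' : Torus) ∈ closure A) (h : D.ptEnd v κ = D.ptEnd w κ') :
    (⟨v, κ⟩ : Σ v, D.K v) = ⟨w, κ'⟩ := by
  refine (D.eq_or_matched_of_ptEnd_eq h).resolve_right ?_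
  have key : ∀ B ∈ D.gluedArcs w, (κ' : Torus) ∉ closure B := fun B hB hκB => by
    rw [hA.eq_of_mem_closure (D.K_subset w) (D.K_cantor w) (D.isBoundaryComponent_of_mem_gluedArcs hB)
      κ'.2 hκ' hκB] at hfree
    exact hfree hB
  rintro ⟨e, ⟨rfl, rfl, l, -, hl⟩ | ⟨rfl, rfl, l, hl, -⟩⟩
  · exact key _ ⟨e, Or.inr ⟨rfl, rfl⟩⟩
      (mem_closure_of_tendsto hl (Eventually.of_forall fun t => (D.glue e (l t)).2))
  · exact key _ ⟨e, Or.inl ⟨rfl, rfl⟩⟩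
      (mem_closure_of_tendsto hl (Eventually.of_forall fun t => (l t).2))

namespace Chart

variable {f : F} {N : ℕ} {s : ℕ → Side} (ch : D.Chart f N s)

/-- An unglued gap differs from the gap `c`, and from the gap `p` except possibly at level `0`,
where the ends of `p` have the same coordinate anyway. -/
theorem exists_of_free {n : ℕ} {a b : ℝ}
    (hg : (tileKind F ν (rayVertexF f (N + n))).IsGap (D.K (rayVertexF f (N + n))) (s (N + n)) a b)
    (hfree : (tileKind F ν (rayVertexF f (N + n))).arc (s (N + n)) (Ioo a b) ∉
      D.gluedArcs (rayVertexF f (N + n))) :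
    ∃ z z', ch.gEnd n z = D.angleEnd _ _ ⟨a, hg.left_mem⟩ ∧
      ch.gEnd n z' = D.angleEnd _ _ ⟨b, hg.right_mem⟩ ∧ ch.u n z = ch.u n z' := by
  obtain ⟨z, z', h1, h2, h3⟩ := (ch.co n).exists_of_gap hg
    (fun h => hfree ⟨rayEdge f (N + n), Or.inr ⟨rfl, h⟩⟩) (fun h => by
      cases n with
      | zero => rfl
      | succ m => exact (hfree ⟨rayEdge f (N + m), Or.inl ⟨rfl, h.trans (ch.p_succ m)⟩⟩).elim)
  exact ⟨z, z', ch.gEnd_eq_of_collar _ h1, ch.gEnd_eq_of_collar _ h2, ch.u_eq_iff.2 h3⟩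

/-- Points of one circle with the same coordinate bound a gap, and this gap is unglued because on a
minimal thread only `c` and, for `n > 0`, `p` are glued. -/
theorem joined_of_u_eq (hT : D.MinThread f N s) {n : ℕ} {z z' : ℕ → Bool}
    (hlt : (ch.co n).ρ z < (ch.co n).ρ z') (h : ch.u n z = ch.u n z') :
    JoinedByBoundary D.boundary (ch.gEnd n z) (ch.gEnd n z') := by
  obtain ⟨a, b, hg, hc, hp, hab⟩ := (ch.co n).exists_gap_of_eq hlt (ch.u_eq_iff.1 h)
  refine D.joinedByBoundary_iff.2 ⟨_, _, a, b, hg, fun hA => ?_, hab.imp ?_ ?_⟩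
  · rcases hT.eq_of_mem_gluedArcs hA (TileKind.arc_subset_circle _) with h | ⟨m, rfl, h⟩
    · exact hc h
    · exact m.succ_ne_zero (hp (h.trans (ch.p_succ m).symm))
  · exact fun h => ⟨ch.gEnd_eq_of_collar _ h.1, ch.gEnd_eq_of_collar _ h.2⟩
  · exact fun h => ⟨ch.gEnd_eq_of_collar _ h.1, ch.gEnd_eq_of_collar _ h.2⟩

/-- The absolute values confine equal coordinates to the same or to consecutive levels. On
consecutive levels the two ends are equal; on the same level they are equal or joined by a boundary
component. -/
theorem asympRel_of_u_eq (hT : D.MinThread f N s) {n m : ℕ} {z z' : ℕ → Bool}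
    (h : ch.u n z = ch.u m z') : asympRel D.boundary (ch.gEnd n z) (ch.gEnd m z') := by
  have key : ∀ n m z z', n < m → ch.u n z = ch.u m z' → ch.gEnd n z = ch.gEnd m z' := by
    intro n m z z' hnm h
    have h1 := congrArg abs h
    rw [abs_u, abs_u] at h1
    have h2 := (ch.co n).abs_le z
    have h3 := (ch.co m).le_abs z'
    have h4 : (m : ℝ) ≤ n + 1 := by linarith
    have h5 : m ≤ n + 1 := by exact_mod_cast h4
    obtain rfl : m = n + 1 := by omega
    exact (ch.gEnd_eq_iff_u_eq.2 h.symm).symm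
  rcases lt_trichotomy n m with hnm | rfl | hnm
  · rw [key _ _ _ _ hnm h]; exact Relation.EqvGen.refl _
  · rcases lt_trichotomy ((ch.co n).ρ z) ((ch.co n).ρ z') with hlt | heq | hlt
    · exact Relation.EqvGen.rel _ _ (ch.joined_of_u_eq hT hlt h)
    · rw [(ch.co n).injective_ρ heq]; exact Relation.EqvGen.refl _
    · exact Relation.EqvGen.symm _ _ (Relation.EqvGen.rel _ _ (ch.joined_of_u_eq hT hlt h.symm))
  · rw [key _ _ _ _ hnm h.symm]; exact Relation.EqvGen.refl _

/-- The ends of an unglued arc are not defined by points of other tiles, so a boundary component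
that starts at an end of the `n`-th circle lies in that circle, and its other end is also there. -/
theorem exists_of_joined {n : ℕ} {z : ℕ → Bool} {e : Ends D.W}
    (h : JoinedByBoundary D.boundary (ch.gEnd n z) e) :
    ∃ z', ch.gEnd n z' = e ∧ ch.u n z' = ch.u n z := by
  obtain ⟨w, t, a, b, hg, hfree, h⟩ := D.joinedByBoundary_iff.1 h
  have hA := hg.isBoundaryComponent
  have hcl : ∀ x ∈ Icc a b, (tileKind F ν w).collar t x 0 ∈
      closure ((tileKind F ν w).arc t (Ioo a b)) := by
    intro x hx
    rw [← closure_Ioo hg.lt.ne] at hx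
    exact image_closure_subset_closure_image ((tileKind F ν w).continuous_collar_left t 0) ⟨x, hx, rfl⟩
  have hloc : ∃ x : ℝ, ∃ hx : x ∈ (tileKind F ν w).angles (D.K w) t, x ∈ Icc a b ∧
      ch.gEnd n z = D.angleEnd w t ⟨x, hx⟩ := by
    rcases h with ⟨h, -⟩ | ⟨h, -⟩
    exacts [⟨a, hg.left_mem, left_mem_Icc.2 hg.lt.le, h⟩,
      ⟨b, hg.right_mem, right_mem_Icc.2 hg.lt.le, h⟩]
  obtain ⟨x, hx, hxab, hxe⟩ := hloc
  have hsig := eq_of_ptEnd_eq_of_free hA hfree (hcl x hxab) hxe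
  obtain ⟨rfl, hκ⟩ := Sigma.mk.inj hsig
  have hκ' := congrArg Subtype.val (eq_of_heq hκ)
  have hc : (tileKind F ν (rayVertexF f (N + n))).circle t =
      (tileKind F ν (rayVertexF f (N + n))).circle (s (N + n)) := by
    refine TileKind.circle_eq_of_nonempty ⟨(tileKind F ν (rayVertexF f (N + n))).collar t x 0, ?_, ?_⟩
    · rw [TileKind.circle_eq_range]; exact ⟨x, rfl⟩
    · rw [TileKind.circle_eq_range]; exact ⟨_, hκ'⟩
  have hg' := hg.congr hc
  rw [TileKind.arc_congr hc] at hfree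
  have hcol := fun x => congrFun (congrFun (TileKind.collar_eq_of_circle_eq hc) x) 0
  obtain ⟨z₁, z₂, h1, h2, h3⟩ := ch.exists_of_free hg' hfree
  rw [D.angleEnd_congr hg'.left_mem hg.left_mem (hcol a).symm] at h1
  rw [D.angleEnd_congr hg'.right_mem hg.right_mem (hcol b).symm] at h2
  rcases h with ⟨h4, h5⟩ | ⟨h4, h5⟩
  · rw [ch.gEnd_injective n (h4.trans h1.symm), h5]
    exact ⟨z₂, h2, h3.symm⟩
  · rw [ch.gEnd_injective n (h4.trans h2.symm), h5]
    exact ⟨z₁, h1, h3⟩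

/-- The ends of the closure of the set of ends that are not separated from the end of the ray. -/
noncomputable def endMap (x : ℕ∞ × (ℕ → Bool)) : Ends D.W :=
  ENat.recTopCoe (C := fun _ => Ends D.W) (D.rayEnd f) (fun n => ch.gEnd n x.2) x.1

/-- The points of the circle corresponding to the ends. -/
noncomputable def circMap (x : ℕ∞ × (ℕ → Bool)) : Circle :=
  ENat.recTopCoe (C := fun _ => Circle) (Circle.exp Real.pi) (fun n => circlePoint (ch.u n x.2)) x.1

theorem gEnd_ne_rayEnd (n : ℕ) (z : ℕ → Bool) (g : F) : ch.gEnd n z ≠ D.rayEnd g :=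
  D.ptEnd_ne_rayEnd _ _ g

/-- At infinity: the ends of the late circles and the end of the ray all meet one tail of tiles,
which is connected and avoids the given compact set. -/
theorem continuous_endMap : Continuous ch.endMap := by
  refine continuous_recTopCoe ch.continuous_gEnd (Ends.tendsto_iff.2 fun C => ?_)
  obtain ⟨M, hM⟩ := D.eventually_ray_disjoint f C
  have hev : ∀ᶠ p : ℕ × (ℕ → Bool) in atTop ×ˢ ⊤, M ≤ p.1 :=
    tendsto_fst.eventually (eventually_ge_atTop M)
  filter_upwards [hev] with p hp
  refine Ends.comp_eq_of_connected _ _ (D.isPreconnected_ray_tail f (N + p.1))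
    (iUnion_subset fun n => hM _ (by omega)) ?_ ?_
  · have h1 := D.endLim_ptEnd (rayVertexF f (N + p.1)) ⟨_, ((ch.co p.1).mem p.2).1⟩ C
    have := D.ptFilter_neBot ((ch.co p.1).mem p.2).1
    obtain ⟨x, hx, hx'⟩ := Filter.nonempty_of_mem (inter_mem h1 range_mem_map)
    exact ⟨x, hx, mem_iUnion.2 ⟨0, hx'⟩⟩
  · obtain ⟨n, hn, hnM⟩ := ((D.mem_rayFilter.1 (D.endLim_rayEnd f C)).and
      (eventually_ge_atTop (N + p.1))).exists
    obtain ⟨m, rfl⟩ := Nat.exists_eq_add_of_le hnM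
    obtain ⟨x, hx⟩ := D.range_incl_nonempty (rayVertexF f (N + p.1 + m))
    exact ⟨x, hn hx, mem_iUnion.2 ⟨m, hx⟩⟩

theorem continuous_circMap : Continuous ch.circMap := by
  refine continuous_recTopCoe (fun n => continuous_circlePoint.comp (ch.continuous_u n))
    (tendsto_circlePoint.comp ?_)
  rw [← Metric.cobounded_eq_cocompact, ← tendsto_norm_atTop_iff_cobounded]
  -- The coordinates on the `n`-th circle have absolute value at least `n`, so they escape to
  -- infinity uniformly.
  refine tendsto_atTop_mono (fun p => ?_) (tendsto_natCast_atTop_atTop.comp tendsto_fst)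
  rw [Real.norm_eq_abs, abs_u]
  exact (ch.co p.1).le_abs p.2

theorem surjective_circMap : Function.Surjective ch.circMap := by
  intro w
  by_cases hw : w = Circle.exp Real.pi
  · exact ⟨(⊤, fun _ => false), hw.symm⟩
  · obtain ⟨r, rfl⟩ := exists_circlePoint w hw
    obtain ⟨n, z, rfl⟩ := ch.exists_u_eq r
    exact ⟨(n, z), rfl⟩

theorem circMap_eq_of_endMap_eq {x y : ℕ∞ × (ℕ → Bool)} (h : ch.endMap x = ch.endMap y) :
    ch.circMap x = ch.circMap y := by
  obtain ⟨n, z⟩ := x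
  obtain ⟨m, w⟩ := y
  induction n using ENat.recTopCoe with
  | top =>
    induction m using ENat.recTopCoe with
    | top => rfl
    | coe m => exact (ch.gEnd_ne_rayEnd m w f h.symm).elim
  | coe n =>
    induction m using ENat.recTopCoe with
    | top => exact (ch.gEnd_ne_rayEnd n z f h).elim
    | coe m => exact congrArg circlePoint (ch.u_eq_of_gEnd_eq h)

theorem asympRel_of_circMap_eq (hT : D.MinThread f N s) {x y : ℕ∞ × (ℕ → Bool)}
    (h : ch.circMap x = ch.circMap y) : asympRel D.boundary (ch.endMap x) (ch.endMap y) := by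
  obtain ⟨n, z⟩ := x
  obtain ⟨m, w⟩ := y
  induction n using ENat.recTopCoe with
  | top =>
    induction m using ENat.recTopCoe with
    | top => exact Relation.EqvGen.refl _
    | coe m => exact (circlePoint_ne _ h.symm).elim
  | coe n =>
    induction m using ENat.recTopCoe with
    | top => exact (circlePoint_ne _ h).elim
    | coe m => exact ch.asympRel_of_u_eq hT (circlePoint_injective h)

theorem exists_of_joined_endMap {x : ℕ∞ × (ℕ → Bool)} {e : Ends D.W}
    (h : JoinedByBoundary D.boundary (ch.endMap x) e) :
    ∃ y, ch.endMap y = e ∧ ch.circMap y = ch.circMap x := by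
  obtain ⟨n, z⟩ := x
  induction n using ENat.recTopCoe with
  | top =>
    obtain ⟨v, t, a, b, hg, -, ⟨h, -⟩ | ⟨h, -⟩⟩ := D.joinedByBoundary_iff.1 h
    · exact (D.ptEnd_ne_rayEnd _ _ f h.symm).elim
    · exact (D.ptEnd_ne_rayEnd _ _ f h.symm).elim
  | coe n =>
    obtain ⟨z', h1, h2⟩ := ch.exists_of_joined h
    exact ⟨(n, z'), h1, congrArg circlePoint h2⟩

/-- A chain generating `≍` runs through ends not known in advance to be in the range of `endMap`. So
the induction carries along the set of points of the circle over an end, which is the same at both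
ends of each link. -/
theorem circMap_eq_of_asympRel {x y : ℕ∞ × (ℕ → Bool)}
    (h : asympRel D.boundary (ch.endMap x) (ch.endMap y)) : ch.circMap x = ch.circMap y := by
  have key : ∀ e e', asympRel D.boundary e e' → ∀ c,
      (∃ x, ch.endMap x = e ∧ ch.circMap x = c) ↔ ∃ x, ch.endMap x = e' ∧ ch.circMap x = c := by
    intro e e' h
    induction h with
    | rel e e' h =>
      intro c
      constructor
      · rintro ⟨x, rfl, rfl⟩
        exact ch.exists_of_joined_endMap h
      · rintro ⟨x, rfl, rfl⟩
        exact ch.exists_of_joined_endMap (joinedByBoundary_symm h)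
    | refl => exact fun _ => Iff.rfl
    | symm _ _ _ ih => exact fun c => (ih c).symm
    | trans _ _ _ _ _ ih1 ih2 => exact fun c => (ih1 c).trans (ih2 c)
  obtain ⟨y', h1, h2⟩ := (key _ _ h (ch.circMap x)).1 ⟨x, rfl, rfl⟩
  rw [← h2]
  exact ch.circMap_eq_of_endMap_eq h1

/-- The range is compact, hence closed, and contains all the ends of `BEndsAt`. Conversely, the ends
of unglued gaps are dense in every Cantor set of the thread, and the end of the ray is a limit of
ends of the circles. -/
theorem closure_BEndsAt (hF : IsClosed F) (hT : D.MinThread f N s) :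
    closure (D.BEndsAt (D.rayEnd f)) = range ch.endMap := by
  refine Subset.antisymm (closure_minimal ?_ (isCompact_range ch.continuous_endMap).isClosed) ?_
  · intro b hb
    obtain ⟨n, x, hx, rfl⟩ := hT.exists_of_mem_BEndsAt hF hb
    obtain ⟨z, hz⟩ := (ch.co n).exists_collar hx
    exact ⟨(n, z), ch.gEnd_eq_of_collar _ hz⟩
  · have hfin : ∀ n z, ch.gEnd n z ∈ closure (D.BEndsAt (D.rayEnd f)) := by
      intro n z
      rw [mem_closure_iff]
      intro V hV hz
      have hc := (hV.preimage (D.continuous_angleEnd (rayVertexF f (N + n)) (s (N + n)))).mem_nhds hz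
      obtain ⟨δ, hδ, hball⟩ := Metric.mem_nhds_iff.1 hc
      obtain ⟨a, b, hg, hfree, hb⟩ := D.exists_free_gap _ ((ch.co n).mem z).1 hδ
      refine ⟨_, hball (a := ⟨b, hg.right_mem⟩) ?_, hT.mem_BEndsAt hg hfree⟩
      rw [Metric.mem_ball, Subtype.dist_eq, Real.dist_eq, abs_lt]
      constructor <;> linarith [hb.1, hb.2]
    rintro _ ⟨⟨n, z⟩, rfl⟩
    induction n using ENat.recTopCoe with
    | top =>
      have hlim : Tendsto (fun n : ℕ => ch.endMap (n, z)) atTop (𝓝 (ch.endMap (⊤, z))) :=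
        (ch.continuous_endMap.tendsto _).comp
          (ENat.tendsto_natCast_nhds_top.prodMk_nhds tendsto_const_nhds)
      exact isClosed_closure.mem_of_tendsto hlim (Eventually.of_forall fun n => hfin n z)
    | coe n => exact hfin n z

/-- There are no isolated points: the end of the ray is a limit of ends of the circles, and on each
circle the Cantor set is mapped injectively. -/
theorem isCantorSet_range_endMap : IsCantorSet (range ch.endMap) := by
  refine isCantorSet_range ch.continuous_endMap Ends.exists_clopen ?_
  rintro ⟨n, z⟩ V hV hz
  induction n using ENat.recTopCoe with
  | top =>
    have hlim : Tendsto (fun n : ℕ => ch.endMap (n, z)) atTop (𝓝 (ch.endMap (⊤, z))) :=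
      (ch.continuous_endMap.tendsto _).comp
        (ENat.tendsto_natCast_nhds_top.prodMk_nhds tendsto_const_nhds)
    obtain ⟨n, hn⟩ := (hlim.eventually_mem (hV.mem_nhds hz)).exists
    exact ⟨_, hn, ch.gEnd_ne_rayEnd n z f⟩
  | coe n =>
    have hne := nhdsNE_neBot_cantor z
    have h1 : ∀ᶠ w in 𝓝[≠] z, ch.gEnd n w ∈ V :=
      ((ch.continuous_gEnd n).tendsto z).mono_left nhdsWithin_le_nhds (hV.mem_nhds hz)
    obtain ⟨w, hw, hwz⟩ := (h1.and self_mem_nhdsWithin).exists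
    exact ⟨(n, w), hw, fun h => hwz (ch.gEnd_injective n h)⟩

theorem range_endMap_inter : range ch.endMap ∩ range D.rayEnd = {D.rayEnd f} := by
  refine Subset.antisymm ?_ (singleton_subset_iff.2
    ⟨⟨(⊤, fun _ => false), rfl⟩, mem_range_self f⟩)
  rintro _ ⟨⟨⟨n, z⟩, h⟩, g, rfl⟩
  induction n using ENat.recTopCoe with
  | top => exact h.symm
  | coe n => exact (ch.gEnd_ne_rayEnd n z g h).elim

theorem nonempty_homeomorph_circle (hT : D.MinThread f N s) :
    Nonempty (D.AsympQuotient (range ch.endMap) ≃ₜ Circle) :=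
  nonempty_quot_homeomorph (q := rangeFactorization ch.endMap)
    (ch.continuous_endMap.subtype_mk _) rangeFactorization_surjective ch.continuous_circMap
    ch.surjective_circMap (fun _ _ h => ch.circMap_eq_of_asympRel h)
    (fun _ _ h => ch.asympRel_of_circMap_eq hT h)

end Chart

end Realization

theorem mainTheorem8 (F : Set (ℕ → Bool)) (hF : IsClosed F)
    (hroot : ∀ b : Bool, ∃ f ∈ F, f 0 = b)
    (ν : Vertex F → Bool) (D : Realization F ν) :
    ∃ ι : F → Ends D.W,
      (∀ f, D.IsEndOfRay f (ι f)) ∧ Function.Injective ι ∧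
      (∀ f, (D.BEndsAt (ι f)).Nonempty ↔ D.TopAccessible f) ∧
      (⋃ f, D.BEndsAt (ι f)) = D.BEnds ∧
      (∀ f f', f ≠ f' → Disjoint (D.BEndsAt (ι f)) (D.BEndsAt (ι f'))) ∧
      (∀ f, (D.BEndsAt (ι f)).Nonempty →
        IsCantorSet (closure (D.BEndsAt (ι f))) ∧
        closure (D.BEndsAt (ι f)) ∩ range ι = {ι f} ∧
        Nonempty (D.AsympQuotient (closure (D.BEndsAt (ι f))) ≃ₜ Circle)) := by
  refine ⟨D.rayEnd, D.isEndOfRay_rayEnd, D.rayEnd_injective, Realization.nonempty_BEndsAt_iff hF,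
    Realization.iUnion_BEndsAt hF, fun f f' h => D.disjoint_BEndsAt h, fun f hf => ?_⟩
  -- Accessibility provides a thread; only a minimal one reaches all the circles whose ends belong
  -- to `BEndsAt`.
  obtain ⟨N, s, hT⟩ := Realization.exists_minThread
    (Realization.topAccessible_iff.1 ((Realization.nonempty_BEndsAt_iff hF f).1 hf))
  obtain ⟨ch⟩ := hT.nonempty_chart
  rw [ch.closure_BEndsAt hF hT]
  exact ⟨ch.isCantorSet_range_endMap, ch.range_endMap_inter, ch.nonempty_homeomorph_circle hT⟩
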